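/- Notation. For a function $x(s)$ of $s\in\mathbb C$ (a lattice) and a function $f$ on the lattice put $$\mathbb D_xf(x(s))=\frac{f(x(s+\frac12))-f(x(s-\frac12))}{x(s+\frac12)-x(s-\frac12)},\qquad \mathbb S_xf(x(s))=\frac{f(x(s+\frac12))+f(x(s-\frac12))}2 .$$ Equations on the lattice are required at all $s$ with $x(s+\frac12)\ne x(s-\frac12)$, $x(s+1)\neq x(s)$, $x(s)\ne x(s-1)$. Let $(a;q)_k=\prod_{j<k}(1-aq^j)$, $(a_1,\dots,a_r;q)_k=\prod_i(a_i;q)_k$, $(a)_k=\prod_{j<k}(a+j)$; ${}_{s+1}\phi_s$ and ${}_{s+1}F_s$ are the usual (basic) hypergeometric series. For $a\ne0$, $y=\cos\theta$, the Askey–Wilson polynomial is $$p_n(y;a,b,c,d\,|\,q)=\frac1{a^{n}}\sum_{k=0}^n\frac{(q^{-n},abcdq^{n-1},ae^{i\theta},ae^{-i\theta};q)_k\,(abq^k,acq^k,adq^k;q)_{n-k}}{(q;q)_k}\,q^k,$$ which is $a^{-n}(ab,ac,ad;q)_n\,{}_4\phi_3\big(q^{-n},abcdq^{n-1},ae^{i\theta},ae^{-i\theta};ab,ac,ad;q,q\big)$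 when no denominator vanishes. Put $$p_n^{(1)}(y;a,b,c)=\sum_{k=0}^n(q^{-n},ae^{i\theta},ae^{-i\theta};q)_k(abq^k,acq^k;q)_{n-k}\frac{(bcq^n)^k}{(q;q)_k},$$ $$p_n^{(2)}(y;a,b)=\sum_{k=0}^n(q^{-n},ae^{i\theta},ae^{-i\theta};q)_k(abq^k;q)_{n-k}\,q^{-\binom k2}\frac{(-bq^n/a)^k}{(q;q)_k},$$ $$p_n^{(3)}(y;a)=\sum_{k=0}^n(q^{-n},ae^{i\theta},ae^{-i\theta};q)_k\,q^{-2\binom k2}\frac{(q^n/a^2)^k}{(q;q)_k},\qquad H_n(y\,|\,r)=\sum_{k=0}^n\frac{(r;r)_n}{(r;r)_k(r;r)_{n-k}}\cos((n-2k)\theta).$$ Let $$W_n(t;a,b,c,d)=\sum_{k=0}^n\frac{(-n)_k(n+a+b+c+d-1)_k(a+b+k)_{n-k}(a+c+k)_{n-k}(a+d+k)_{n-k}}{k!}\prod_{j<k}\big((a+j)^2+t\big),$$ $$S_n(t;a,b,c)=\sum_{k=0}^n\frac{(-n)_k(a+b+k)_{n-k}(a+c+k)_{n-k}}{k!}\prod_{j<k}\big((a+j)^2+t\big)$$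 be the Wilson and the continuous dual Hahn polynomials. **Theorem.** Let $(P_n)_{n\ge0}$ be polynomials over $\mathbb C$ with $\deg P_n=n$, and let $x(s)$ be one of the lattices in (1), (2). The following are equivalent: (i) there are polynomials $\phi,\psi$ with $\deg\phi\le2$, $\deg\psi\le1$ and pairwise distinct constants $\lambda_n$ such that for every $n\ge0$, $y=P_n$ solves $$\phi(x)\mathbb D_x^2y+\psi(x)\mathbb S_x\mathbb D_xy+\lambda_ny=0;$$ (ii) there are functions $A,B,C$ of $s$ and pairwise distinct constants $\lambda_n$ such that for every $n\ge 0$ $$A(s)P_n(x(s+1))+B(s)P_n(x(s))+C(s)P_n(x(s-1))=\lambda_nP_n(x(s));$$ (iii) the explicit form in (1), respectively (2), holds. (1) Let $x(s)=c_1q^{-s}+c_2q^s$, where $q\in\mathbb C\setminus\{0\}$ is not a root of unity and $c_1c_2\neq0$; put $u=c_2/c_1$ and $y(s)=\frac12\big(u^{1/2}q^s+u^{-1/2}q^{-s}\big)$ (powers are principal). Then (iii) means that one of the following families equals $(P_n(x(s)))_n$ up to nonzero constants depending on $n$: $p_n(y(s);u^{1/2}a,u^{1/2}b,u^{1/2}c,u^{1/2}d\,|\,q)$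 for some $a\ne0$ and $b,c,d\in\mathbb C$; $H_n(y(s)\,|\,q)$; $p_n^{(1)}(y(s);u^{1/2}a,u^{1/2}b,u^{1/2}c)$, $p_n^{(2)}(y(s);u^{1/2}a,u^{1/2}b)$ or $p_n^{(3)}(y(s);u^{1/2}a)$ for some nonzero $a,b,c$; $H_n(y(s)\,|\,q^{-1})$. For $a\neq0$ and $(abu,acu,adu;q)_n\ne0$, $${}_4\phi_3\!\left(\begin{matrix}q^{-n},u^2abcdq^{n-1},aq^{-s},auq^s\\abu,acu,adu\end{matrix};q,q\right)=\frac{(u^{1/2}a)^n\,p_n(y(s);u^{1/2}a,u^{1/2}b,u^{1/2}c,u^{1/2}d\,|\,q)}{(abu,acu,adu;q)_n}.$$ The other families are subcases and limits of the Askey–Wilson polynomials: for all $n$ and $y$, $$H_n(y|q)=\lim_{a,b,c,d\to0,\ a\ne0}p_n(y;a,b,c,d|q),\qquad p_n^{(1)}(y;a,b,c)=\lim_{d\to\infty}\frac{a^np_n(y;a,b,c,d|q)}{(ad;q)_n},$$ $$p_n^{(2)}(y;a,b)=\lim_{c,d\to\infty}\frac{a^np_n(y;a,b,c,d|q)}{(ac,ad;q)_n},\quad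 p_n^{(3)}(y;a)=\lim_{b,c,d\to\infty}\frac{a^np_n(y;a,b,c,d|q)}{(ab,ac,ad;q)_n},\quad H_n(y|q^{-1})=\lim_{a,b,c,d\to\infty}\frac{a^{2n}p_n(y;a,b,c,d|q)}{(ab,ac,ad;q)_n},$$ where in the middle three limits $a\ne 0$, and where several parameters tend to their limits independently. (2) Let $x(s)=c_4s^2+c_5s$ with $c_4\ne0$ and put $u=c_5/c_4$. Then (iii) means that, for some $a,b,c,d\in\mathbb C$, up to nonzero constants depending on $n$, either $P_n(x(s))$ equals $W_n\big(-(s+\frac u2)^2;a+\frac u2,b+\frac u2,c+\frac u2,d+\frac u2\big)$ for all $n$, or $P_n(x(s))$ equals $S_n\big(-(s+\frac u2)^2;a+\frac u2,b+\frac u2,c+\frac u2\big)$ for all $n$. Moreover, if $(a+b+u)_n(a+c+u)_n\neq0$, then $${}_3F_2\!\left(\begin{matrix}-n,a-s,a+u+s\\a+b+u,a+c+u\end{matrix};1\right)=\frac{S_n\big(-(s+\frac u2)^2;a+\frac u2,b+\frac u2,c+\frac u2\big)}{(a+b+u)_n(a+c+u)_n},$$ and if also $(a+d+u)_n\ne0$,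 then $${}_4F_3\!\left(\begin{matrix}-n,a+b+c+d+2u+n-1,a-s,a+u+s\\a+b+u,a+c+u,a+d+u\end{matrix};1\right)=\frac{W_n\big(-(s+\frac u2)^2;a+\frac u2,b+\frac u2,c+\frac u2,d+\frac u2\big)}{(a+b+u)_n(a+c+u)_n(a+d+u)_n}.$$ -/

import Mathlib

/-- The `q`-shifted factorial `(a; q)_k`. -/
noncomputable def qPoch (a q : ℂ) (k : ℕ) : ℂ :=
  ∏ j ∈ Finset.range k, (1 - a * q ^ j)

/-- The shifted factorial `(a)_k = a (a + 1) ⋯ (a + k - 1)`. -/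
noncomputable def risingFactorial (a : ℂ) (k : ℕ) : ℂ :=
  (ascPochhammer ℂ k).eval a

/-- The basic hypergeometric series `_{s+1}φ_s` with numerator parameters `as` and
denominator parameters `bs`, in base `q`, at `z`. -/
noncomputable def basicHypergeometric (as bs : List ℂ) (q z : ℂ) : ℂ :=
  ∑' k : ℕ, (as.map fun a => qPoch a q k).prod / (bs.map fun b => qPoch b q k).prod
    * (z ^ k / qPoch q q k)

/-- The hypergeometric series `_{s+1}F_s` with numerator parameters `as` and
denominator parameters `bs`, at `z`. -/
noncomputable def hypergeometric (as bs : List ℂ) (z : ℂ) : ℂ :=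
  ∑' k : ℕ, (as.map fun a => risingFactorial a k).prod / (bs.map fun b => risingFactorial b k).prod
    * (z ^ k / (Nat.factorial k : ℂ))

/-- The `q`-quadratic lattice `x(s) = c₁ q^{-s} + c₂ q^s` (principal powers). -/
noncomputable def qQuadraticLattice (q c₁ c₂ : ℂ) (s : ℂ) : ℂ :=
  c₁ * q ^ (-s) + c₂ * q ^ s

/-- The quadratic lattice `x(s) = c₄ s² + c₅ s`. -/
noncomputable def quadraticLattice (c₄ c₅ : ℂ) (s : ℂ) : ℂ :=
  c₄ * s ^ 2 + c₅ * s

/-- The divided-difference operator `𝔻_x`, acting on functions of `s`. -/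
noncomputable def divDiff (x g : ℂ → ℂ) (s : ℂ) : ℂ :=
  (g (s + 1 / 2) - g (s - 1 / 2)) / (x (s + 1 / 2) - x (s - 1 / 2))

/-- The averaging operator `𝕊_x`, acting on functions of `s`. -/
noncomputable def avgOp (g : ℂ → ℂ) (s : ℂ) : ℂ :=
  (g (s + 1 / 2) + g (s - 1 / 2)) / 2

/-- The points `s` at which none of the divided differences in `𝔻_x² y(x(s))` and
`𝕊_x 𝔻_x y(x(s))` has a zero denominator. On the lattices considered here the excluded `s` form
a discrete set, so that an identity between polynomials in `x(s)` is not weakened. -/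
def RegularPoint (x : ℂ → ℂ) (s : ℂ) : Prop :=
  x (s + 1 / 2) ≠ x (s - 1 / 2) ∧ x (s + 1) ≠ x s ∧ x s ≠ x (s - 1)

/-- `y` solves `φ 𝔻_x² y + ψ 𝕊_x 𝔻_x y + lam y = 0` on the lattice `x`. -/
def SolvesSturmLiouville (x : ℂ → ℂ) (φ ψ : Polynomial ℂ) (lam : ℂ) (y : Polynomial ℂ) : Prop :=
  ∀ s : ℂ, RegularPoint x s →
    φ.eval (x s) * divDiff x (divDiff x fun t => y.eval (x t)) s
      + ψ.eval (x s) * avgOp (divDiff x fun t => y.eval (x t)) s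
      + lam * y.eval (x s) = 0

/-- The `P n` are solutions, for pairwise distinct constants `lam n`, of one Sturm–Liouville type
equation with `deg φ ≤ 2` and `deg ψ ≤ 1`. -/
def HasSturmLiouvilleEquation (x : ℂ → ℂ) (P : ℕ → Polynomial ℂ) : Prop :=
  ∃ (φ ψ : Polynomial ℂ) (lam : ℕ → ℂ), φ.natDegree ≤ 2 ∧ ψ.natDegree ≤ 1 ∧
    Function.Injective lam ∧ ∀ n, SolvesSturmLiouville x φ ψ (lam n) (P n)

/-- The `P n` are solutions, for pairwise distinct constants `lam n`, of one three-term difference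
equation `A(s) P_n(x(s+1)) + B(s) P_n(x(s)) + C(s) P_n(x(s-1)) = lam_n P_n(x(s))`. -/
def HasVinetZhedanovEquation (x : ℂ → ℂ) (P : ℕ → Polynomial ℂ) : Prop :=
  ∃ (A B C : ℂ → ℂ) (lam : ℕ → ℂ), Function.Injective lam ∧
    ∀ (n : ℕ) (s : ℂ), RegularPoint x s →
      A s * (P n).eval (x (s + 1)) + B s * (P n).eval (x s) + C s * (P n).eval (x (s - 1))
        = lam n * (P n).eval (x s)

/-- `P_n(x(s))` is, up to a nonzero multiplicative constant depending on `n`, equal to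
`R n s`. -/
def IsMultipleOf (x : ℂ → ℂ) (P : ℕ → Polynomial ℂ) (R : ℕ → ℂ → ℂ) : Prop :=
  ∀ n : ℕ, ∃ K : ℂ, K ≠ 0 ∧ ∀ s : ℂ, (P n).eval (x s) = K * R n s

/-- `(a e^{iθ}; q)_k (a e^{-iθ}; q)_k` as a polynomial in `y = cos θ`. -/
noncomputable def awBasis (a q : ℂ) (k : ℕ) (y : ℂ) : ℂ :=
  ∏ j ∈ Finset.range k, (1 - 2 * a * y * q ^ j + a ^ 2 * q ^ (2 * j))

/-- The Askey–Wilson polynomial `p_n(y; a, b, c, d | q)` for `a ≠ 0`, that is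
`a^{-n} (ab, ac, ad; q)_n` times the `₄φ₃` with denominator parameters `ab, ac, ad`; the
denominators are cancelled against the prefactor, so that no condition on them is needed. -/
noncomputable def askeyWilson (q : ℂ) (n : ℕ) (a b c d y : ℂ) : ℂ :=
  (a ^ n)⁻¹ * ∑ k ∈ Finset.range (n + 1),
    qPoch (q ^ (-(n : ℤ))) q k * qPoch (a * b * c * d * q ^ ((n : ℤ) - 1)) q k
      * qPoch (a * b * q ^ k) q (n - k) * qPoch (a * c * q ^ k) q (n - k)
      * qPoch (a * d * q ^ k) q (n - k) * awBasis a q k y * (q ^ k / qPoch q q k)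

/-- The limiting case `d → ∞` of the Askey–Wilson polynomials. -/
noncomputable def askeyWilsonLim₁ (q : ℂ) (n : ℕ) (a b c y : ℂ) : ℂ :=
  ∑ k ∈ Finset.range (n + 1),
    qPoch (q ^ (-(n : ℤ))) q k * qPoch (a * b * q ^ k) q (n - k)
      * qPoch (a * c * q ^ k) q (n - k) * awBasis a q k y * ((b * c * q ^ n) ^ k / qPoch q q k)

/-- The limiting case `c, d → ∞` of the Askey–Wilson polynomials. -/
noncomputable def askeyWilsonLim₂ (q : ℂ) (n : ℕ) (a b y : ℂ) : ℂ :=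
  ∑ k ∈ Finset.range (n + 1),
    qPoch (q ^ (-(n : ℤ))) q k * qPoch (a * b * q ^ k) q (n - k) * awBasis a q k y
      * (q ^ k.choose 2)⁻¹ * ((-(b * q ^ n / a)) ^ k / qPoch q q k)

/-- The limiting case `b, c, d → ∞` of the Askey–Wilson polynomials. -/
noncomputable def askeyWilsonLim₃ (q : ℂ) (n : ℕ) (a y : ℂ) : ℂ :=
  ∑ k ∈ Finset.range (n + 1),
    qPoch (q ^ (-(n : ℤ))) q k * awBasis a q k y
      * (q ^ (2 * k.choose 2))⁻¹ * ((q ^ n / a ^ 2) ^ k / qPoch q q k)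

/-- The continuous `q`-Hermite polynomial in base `r`, that is the sum over `0 ≤ k ≤ n` of
`(r;r)_n / ((r;r)_k (r;r)_{n-k}) cos((n - 2k)θ)` as a polynomial in `y = cos θ`. -/
noncomputable def continuousQHermite (r : ℂ) (n : ℕ) (y : ℂ) : ℂ :=
  ∑ k ∈ Finset.range (n + 1),
    qPoch r r n / (qPoch r r k * qPoch r r (n - k))
      * (Polynomial.Chebyshev.T ℂ ((n : ℤ) - 2 * (k : ℤ))).eval y

/-- The principal square root. -/
noncomputable def csqrt (u : ℂ) : ℂ := u ^ (1 / 2 : ℂ)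

/-- The rescaled variable `(u^{1/2} q^s + u^{-1/2} q^{-s}) / 2`. -/
noncomputable def awVariable (q u s : ℂ) : ℂ :=
  (csqrt u * q ^ s + (csqrt u)⁻¹ * q ^ (-s)) / 2

/-- The `P_n`, up to multiplicative constants, are the rescaled Askey–Wilson polynomials for some
parameters `a, b, c, d` not all zero (the parameters `b, c, d` may vanish, which covers the
continuous dual `q`-Hahn, Al-Salam–Chihara and continuous big `q`-Hermite subcases), the subcase
where all parameters are zero, or one of the limiting cases where one, two, three or four
parameters tend to infinity. -/
def IsAskeyWilsonFamily (q u : ℂ) (x : ℂ → ℂ) (P : ℕ → Polynomial ℂ) : Prop :=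
  (∃ a b c d : ℂ, a ≠ 0 ∧
    IsMultipleOf x P fun n s => askeyWilson q n (csqrt u * a) (csqrt u * b) (csqrt u * c)
      (csqrt u * d) (awVariable q u s)) ∨
  (IsMultipleOf x P fun n s => continuousQHermite q n (awVariable q u s)) ∨
  (∃ a b c : ℂ, a ≠ 0 ∧ b ≠ 0 ∧ c ≠ 0 ∧
    IsMultipleOf x P fun n s => askeyWilsonLim₁ q n (csqrt u * a) (csqrt u * b) (csqrt u * c)
      (awVariable q u s)) ∨
  (∃ a b : ℂ, a ≠ 0 ∧ b ≠ 0 ∧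
    IsMultipleOf x P fun n s => askeyWilsonLim₂ q n (csqrt u * a) (csqrt u * b)
      (awVariable q u s)) ∨
  (∃ a : ℂ, a ≠ 0 ∧
    IsMultipleOf x P fun n s => askeyWilsonLim₃ q n (csqrt u * a) (awVariable q u s)) ∨
  (IsMultipleOf x P fun n s => continuousQHermite q⁻¹ n (awVariable q u s))

/-- `(a - i x)_k (a + i x)_k` as a polynomial in `t = x²`. -/
noncomputable def wilsonBasis (a : ℂ) (k : ℕ) (t : ℂ) : ℂ :=
  ∏ j ∈ Finset.range k, ((a + j) ^ 2 + t)

/-- The Wilson polynomial `W_n(t; a, b, c, d)`, that is `(a+b)_n (a+c)_n (a+d)_n` times the `₄F₃`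
with denominator parameters `a+b, a+c, a+d`, denominators being cancelled. -/
noncomputable def wilsonPoly (n : ℕ) (a b c d t : ℂ) : ℂ :=
  ∑ k ∈ Finset.range (n + 1),
    risingFactorial (-(n : ℂ)) k * risingFactorial (n + a + b + c + d - 1) k
      * risingFactorial (a + b + k) (n - k) * risingFactorial (a + c + k) (n - k)
      * risingFactorial (a + d + k) (n - k) * wilsonBasis a k t / (Nat.factorial k : ℂ)

/-- The continuous dual Hahn polynomial `S_n(t; a, b, c)`, that is `(a+b)_n (a+c)_n` times the
`₃F₂` with denominator parameters `a+b, a+c`, denominators being cancelled. -/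
noncomputable def continuousDualHahn (n : ℕ) (a b c t : ℂ) : ℂ :=
  ∑ k ∈ Finset.range (n + 1),
    risingFactorial (-(n : ℂ)) k * risingFactorial (a + b + k) (n - k)
      * risingFactorial (a + c + k) (n - k) * wilsonBasis a k t / (Nat.factorial k : ℂ)

/-- The `P_n`, up to multiplicative constants, are the shifted Wilson polynomials or the shifted
continuous dual Hahn polynomials for some parameters. -/
def IsWilsonFamily (u : ℂ) (x : ℂ → ℂ) (P : ℕ → Polynomial ℂ) : Prop :=
  (∃ a b c d : ℂ,
    IsMultipleOf x P fun n s => wilsonPoly n (a + u / 2) (b + u / 2) (c + u / 2) (d + u / 2)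
      (-(s + u / 2) ^ 2)) ∨
  (∃ a b c : ℂ,
    IsMultipleOf x P fun n s => continuousDualHahn n (a + u / 2) (b + u / 2) (c + u / 2)
      (-(s + u / 2) ^ 2))

/-! ### Divided differences and means as operators on polynomials. -/

section Lattice
open Polynomial

/-! On both kinds of lattice the neighbours x(s ± 1/2) are αx + β ± h, where h² = U(x) is a
polynomial in x. Hence the divided difference and the mean of a polynomial in x are again
polynomials in x, and L = φ𝔻² + ψ𝕊𝔻 becomes a linear operator on ℂ[X] that does not raise degrees.
An eigenpolynomial of degree n must have the n-th diagonal entry as its eigenvalue, and if these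
entries are distinct it is unique up to a scalar (`eigenvector_unique`). So (i) amounts to listing
the pairs (φ, ψ) with distinct diagonal entries and exhibiting one eigenpolynomial in each degree.

Written out, LP = A(s)(P(x(s+1)) - P(x(s))) + C(s)(P(x(s-1)) - P(x(s))). In the variable z = u^{1/2}
q^s (on the quadratic lattice: S = s + u/2), A is a polynomial f of degree at most 4 over a fixed
denominator, and C is A with z replaced by 1/z (S by -S). Every pair (φ, ψ) comes from such an f, so
the classification is by the roots of f. If f has a factor 1 - az (respectively a + S), then L is
bidiagonal in the basis (az, a/z; q)_k (respectively (a-S)_k (a+S)_k), by `op_awBasis` and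
`wilson_op_basis`. The eigenvalue equation is then a two-term recursion with hypergeometric solution
(`bidiagonal_eigen`); the other factors of f supply the other parameters. The diagonal entries are
distinct exactly when the resulting polynomials keep their full degree (`wilson_injective_iff`,
`diag_injective_iff`).

On the quadratic lattice, deg f = 4 gives Wilson and deg f = 3 gives continuous dual Hahn
polynomials. On the q-quadratic lattice the order of vanishing of f at z = 0 counts the parameters
sent to infinity. The two cases without a factor 1 - az, a ≠ 0, are f constant and f a multiple of
z⁴; they give the q-Hermite polynomials in base q and 1/q, treated by the Rogers–Szegő recursions
(`continuousQHermite_eigen`).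

Equation (ii) reduces to (i) because its cases n = 0, 1, 2 already determine A, B, C and identify
them with the coefficients of some L (`vinetZhedanov_iff`). The two Hermite limits follow from
continuity of eigenvectors in the operator (`tendsto_eigenvector_coeff`), the other three limits
term by term. -/

/-- The constants describing a quadratic or `q`-quadratic lattice `x`: with
`x± = x(s ± 1/2)` one has `x₊ + x₋ = 2 (α x + β)` and `(x₊ - x₋)² = 4 U(x)`, and the divided
difference and the mean of `x ^ n` have leading coefficients `γ n` and `μ n`. -/
structure LatticeData where
  α : ℂ
  β : ℂ
  U : ℂ[X]
  γ : ℕ → ℂ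
  μ : ℕ → ℂ
  α_ne : α ≠ 0
  U_natDegree : U.natDegree ≤ 2
  U_coeff : U.coeff 2 = α ^ 2 - 1
  γ_zero : γ 0 = 0
  μ_zero : μ 0 = 1
  γ_succ : ∀ n, γ (n + 1) = α * γ n + μ n
  μ_succ : ∀ n, μ (n + 1) = (α ^ 2 - 1) * γ n + α * μ n

theorem Polynomial.natDegree_mul_le_and_coeff {p q : ℂ[X]} {m n k : ℕ} (hp : p.natDegree ≤ m)
    (hq : q.natDegree ≤ n) (hk : m + n = k) :
    (p * q).natDegree ≤ k ∧ (p * q).coeff k = p.coeff m * q.coeff n := by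
  subst hk
  exact ⟨natDegree_mul_le_of_le hp hq, coeff_mul_add_eq_of_natDegree_le hp hq⟩

theorem Polynomial.linearMap_apply_eq_sum (T : ℂ[X] →ₗ[ℂ] ℂ[X]) {P : ℂ[X]} {n : ℕ}
    (hP : P.natDegree ≤ n) : T P = ∑ i ∈ Finset.range (n + 1), C (P.coeff i) * T (X ^ i) := by
  conv_lhs => rw [P.as_sum_range_C_mul_X_pow' (Nat.lt_succ_of_le hP), map_sum]
  simp only [← smul_eq_C_mul, map_smul]

namespace LatticeData

variable (Λ : LatticeData)

/-- The divided difference and the mean of `x ^ n` as polynomials in `x`. -/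
noncomputable def pow : ℕ → ℂ[X] × ℂ[X]
  | 0 => (0, 1)
  -- With m = αx + β and h² = U(x), the pair (d, e) encodes (m ± h)^n = e ± h d; multiplying by m ±
  -- h gives the recursion.
  | n + 1 => ((C Λ.α * X + C Λ.β) * (pow n).1 + (pow n).2,
      Λ.U * (pow n).1 + (C Λ.α * X + C Λ.β) * (pow n).2)

/-- The divided difference operator on polynomials. -/
noncomputable def D : ℂ[X] →ₗ[ℂ] ℂ[X] :=
  (Polynomial.basisMonomials ℂ).constr ℂ fun n => (Λ.pow n).1

/-- The averaging operator on polynomials. -/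
noncomputable def S : ℂ[X] →ₗ[ℂ] ℂ[X] :=
  (Polynomial.basisMonomials ℂ).constr ℂ fun n => (Λ.pow n).2

/-- The Sturm–Liouville operator `φ D² + ψ S D`. -/
noncomputable def op (φ ψ : ℂ[X]) : ℂ[X] →ₗ[ℂ] ℂ[X] :=
  (LinearMap.mulLeft ℂ φ).comp (Λ.D.comp Λ.D) + (LinearMap.mulLeft ℂ ψ).comp (Λ.S.comp Λ.D)

/-- The diagonal entries of `φ D² + ψ S D`. -/
noncomputable def diag (φ ψ : ℂ[X]) (n : ℕ) : ℂ :=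
  Λ.γ n * (φ.coeff 2 * Λ.γ (n - 1) + ψ.coeff 1 * Λ.μ (n - 1))

theorem D_X_pow (n : ℕ) : Λ.D (X ^ n) = (Λ.pow n).1 := by
  have := (Polynomial.basisMonomials ℂ).constr_basis ℂ (fun n => (Λ.pow n).1) n
  simp only [Polynomial.coe_basisMonomials, Polynomial.monomial_one_right_eq_X_pow] at this
  exact this

theorem S_X_pow (n : ℕ) : Λ.S (X ^ n) = (Λ.pow n).2 := by
  have := (Polynomial.basisMonomials ℂ).constr_basis ℂ (fun n => (Λ.pow n).2) n
  simp only [Polynomial.coe_basisMonomials, Polynomial.monomial_one_right_eq_X_pow] at this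
  exact this

theorem op_apply (φ ψ P : ℂ[X]) : Λ.op φ ψ P = φ * Λ.D (Λ.D P) + ψ * Λ.S (Λ.D P) := rfl

theorem linear_natDegree : (C Λ.α * X + C Λ.β).natDegree ≤ 1 := natDegree_linear_le

/-- The leading coefficients satisfy the recursions of `γ` and `μ` because the x²-coefficient of U
is α² - 1. -/
theorem pow_succ_natDegree (n : ℕ) :
    ((Λ.pow (n + 1)).1.natDegree ≤ n ∧ (Λ.pow (n + 1)).1.coeff n = Λ.γ (n + 1)) ∧
      (Λ.pow (n + 1)).2.natDegree ≤ n + 1 ∧ (Λ.pow (n + 1)).2.coeff (n + 1) = Λ.μ (n + 1) := by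
  induction n with
  | zero =>
    have h : (Λ.pow 1).2 = C Λ.α * X + C Λ.β := by simp [pow]
    rw [zero_add, h]
    refine ⟨?_, Λ.linear_natDegree, ?_⟩ <;>
      simp [pow, Λ.γ_succ, Λ.γ_zero, Λ.μ_zero, Λ.μ_succ]
  | succ n ih =>
    obtain ⟨⟨h1, h2⟩, h3, h4⟩ := ih
    obtain ⟨a1, a2⟩ := natDegree_mul_le_and_coeff Λ.linear_natDegree h1 (add_comm 1 n)
    obtain ⟨b1, b2⟩ := natDegree_mul_le_and_coeff Λ.linear_natDegree h3 (add_comm 1 (n + 1))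
    obtain ⟨c1, c2⟩ := natDegree_mul_le_and_coeff Λ.U_natDegree h1
      (show 2 + n = n + 1 + 1 by ring)
    refine ⟨⟨natDegree_add_le_of_degree_le a1 h3, ?_⟩, natDegree_add_le_of_degree_le c1 b1, ?_⟩
    · rw [pow, coeff_add, a2, h2, h4, Λ.γ_succ (n + 1)]
      simp
    · rw [pow, coeff_add, c2, b2, h2, h4, Λ.μ_succ (n + 1), Λ.U_coeff]
      simp

theorem D_natDegree {P : ℂ[X]} {n : ℕ} (hP : P.natDegree ≤ n + 1) :
    (Λ.D P).natDegree ≤ n ∧ (Λ.D P).coeff n = Λ.γ (n + 1) * P.coeff (n + 1) := by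
  rw [linearMap_apply_eq_sum _ hP, Finset.sum_range_succ]
  have low : ∀ i ∈ Finset.range (n + 1), (C (P.coeff i) * Λ.D (X ^ i)).natDegree ≤ n ∧
      (C (P.coeff i) * Λ.D (X ^ i)).coeff n = 0 := by
    intro i hi
    rw [Finset.mem_range] at hi
    rcases i with _ | i
    · rw [D_X_pow]
      simp [pow]
    · have h := (Λ.pow_succ_natDegree i).1.1
      rw [D_X_pow]
      refine ⟨(natDegree_C_mul_le _ _).trans (h.trans (by omega)), ?_⟩
      rw [coeff_C_mul, coeff_eq_zero_of_natDegree_lt (h.trans_lt (by omega)), mul_zero]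
  have h := (Λ.pow_succ_natDegree n).1
  constructor
  · refine natDegree_add_le_of_degree_le
      (natDegree_sum_le_of_forall_le _ _ fun i hi => (low i hi).1)
      ((natDegree_C_mul_le _ _).trans ?_)
    rw [D_X_pow]; exact h.1
  · rw [coeff_add, finsetSum_coeff, Finset.sum_eq_zero fun i hi => (low i hi).2, coeff_C_mul,
      D_X_pow, h.2]
    ring

theorem S_natDegree {P : ℂ[X]} {n : ℕ} (hP : P.natDegree ≤ n) :
    (Λ.S P).natDegree ≤ n ∧ (Λ.S P).coeff n = Λ.μ n * P.coeff n := by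
  rw [linearMap_apply_eq_sum _ hP, Finset.sum_range_succ]
  have h : ∀ n, (Λ.pow n).2.natDegree ≤ n ∧ (Λ.pow n).2.coeff n = Λ.μ n := by
    rintro (_ | n)
    · simp [pow, Λ.μ_zero]
    · exact (Λ.pow_succ_natDegree n).2
  have low : ∀ i ∈ Finset.range n, (C (P.coeff i) * Λ.S (X ^ i)).natDegree ≤ n ∧
      (C (P.coeff i) * Λ.S (X ^ i)).coeff n = 0 := by
    intro i hi
    rw [Finset.mem_range] at hi
    rw [S_X_pow]
    refine ⟨(natDegree_C_mul_le _ _).trans ((h i).1.trans (by omega)), ?_⟩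
    rw [coeff_C_mul, coeff_eq_zero_of_natDegree_lt ((h i).1.trans_lt (by omega)), mul_zero]
  constructor
  · refine natDegree_add_le_of_degree_le
      (natDegree_sum_le_of_forall_le _ _ fun i hi => (low i hi).1)
      ((natDegree_C_mul_le _ _).trans ?_)
    rw [S_X_pow]; exact (h n).1
  · rw [coeff_add, finsetSum_coeff, Finset.sum_eq_zero fun i hi => (low i hi).2, coeff_C_mul,
      S_X_pow, (h n).2]
    ring

theorem D_C (c : ℂ) : Λ.D (C c) = 0 := by
  have := Λ.D_X_pow 0
  rw [pow_zero] at this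
  rw [← mul_one (C c), ← smul_eq_C_mul, map_smul, this]
  simp [pow]

/-- `D` lowers the degree by one and `S` preserves it, so the bounds 2 and 1 on φ and ψ exactly
compensate: the operator is triangular with respect to degree. -/
theorem op_natDegree {φ ψ : ℂ[X]} (hφ : φ.natDegree ≤ 2) (hψ : ψ.natDegree ≤ 1) {P : ℂ[X]} {n : ℕ}
    (hP : P.natDegree ≤ n) :
    (Λ.op φ ψ P).natDegree ≤ n ∧ (Λ.op φ ψ P).coeff n = Λ.diag φ ψ n * P.coeff n := by
  rw [op_apply]
  rcases n with _ | n
  · rw [eq_C_of_natDegree_le_zero hP, D_C]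
    simp [diag, Λ.γ_zero]
  obtain ⟨h1, h2⟩ := Λ.D_natDegree hP
  obtain ⟨h3, h4⟩ := Λ.S_natDegree h1
  obtain ⟨h5, h6⟩ := natDegree_mul_le_and_coeff hψ h3 (add_comm 1 n)
  -- In degree one `D²` vanishes; the formula for `diag` persists there because `γ 0 = 0`.
  rcases n with _ | n
  · have h : Λ.D (Λ.D P) = 0 := by rw [eq_C_of_natDegree_le_zero h1, D_C]
    rw [h, mul_zero, zero_add, h6, h4, h2]
    refine ⟨h5, ?_⟩
    simp only [diag, zero_add, Nat.sub_self, Λ.γ_zero]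
    ring
  · obtain ⟨h7, h8⟩ := Λ.D_natDegree h1
    obtain ⟨h9, h10⟩ := natDegree_mul_le_and_coeff hφ h7 (show 2 + n = n + 1 + 1 by ring)
    refine ⟨natDegree_add_le_of_degree_le h9 h5, ?_⟩
    rw [coeff_add, h10, h6, h8, h4, h2]
    simp only [diag, Nat.add_sub_cancel]
    ring

/-- An eigenvector of degree `n` has the `n`-th diagonal entry as its eigenvalue. -/
theorem eigenvalue_eq_diag {φ ψ : ℂ[X]} (hφ : φ.natDegree ≤ 2) (hψ : ψ.natDegree ≤ 1) {P : ℂ[X]}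
    (hP : P ≠ 0) {l : ℂ} (h : Λ.op φ ψ P = C l * P) : l = Λ.diag φ ψ P.natDegree := by
  have := (Λ.op_natDegree hφ hψ (le_refl P.natDegree)).2
  rw [h, coeff_C_mul] at this
  exact mul_right_cancel₀ (leadingCoeff_ne_zero.mpr hP) this

/-- Eigenvectors of the same degree are proportional if the eigenvalues are distinct. -/
theorem eigenvector_unique {φ ψ : ℂ[X]} (hφ : φ.natDegree ≤ 2) (hψ : ψ.natDegree ≤ 1)
    (hinj : Function.Injective (Λ.diag φ ψ)) {P R : ℂ[X]} {n : ℕ} (hR : R.coeff n ≠ 0)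
    (hLP : Λ.op φ ψ P = C (Λ.diag φ ψ n) * P) (hLR : Λ.op φ ψ R = C (Λ.diag φ ψ n) * R) :
    P = C (P.coeff n / R.coeff n) * R := by
  by_contra hne
  -- If nonzero, this difference is an eigenvector for the same eigenvalue, so by injectivity its
  -- degree is n; but its n-th coefficient has been cancelled.
  set Q := P - C (P.coeff n / R.coeff n) * R with hQ
  have hQ0 : Q ≠ 0 := sub_ne_zero.mpr hne
  have hLQ : Λ.op φ ψ Q = C (Λ.diag φ ψ n) * Q := by
    rw [hQ, map_sub, ← smul_eq_C_mul, map_smul, hLP, hLR]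
    simp only [smul_eq_C_mul]
    ring
  have h1 := hinj (Λ.eigenvalue_eq_diag hφ hψ hQ0 hLQ)
  have h2 : Q.coeff n = 0 := by
    rw [hQ, coeff_sub, coeff_C_mul]
    field_simp
    ring
  rw [h1] at h2
  exact hQ0 (leadingCoeff_eq_zero.mp h2)

/-- The two evaluation rules which make `x` a lattice with the constants `Λ`. -/
structure IsLattice (x : ℂ → ℂ) : Prop where
  sum : ∀ s, x (s + 1 / 2) + x (s - 1 / 2) = 2 * (Λ.α * x s + Λ.β)
  sq : ∀ s, (x (s + 1 / 2) - x (s - 1 / 2)) ^ 2 = 4 * Λ.U.eval (x s)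
  infinite : (x '' {s | RegularPoint x s}).Infinite

variable {Λ} {x : ℂ → ℂ}

namespace IsLattice

variable (hx : Λ.IsLattice x)
include hx

/-- This ties the algebraic operators to the lattice. Stated without division, it also holds where
x(s + 1/2) = x(s - 1/2). -/
theorem eval_D_S (P : ℂ[X]) (s : ℂ) :
    P.eval (x (s + 1 / 2)) - P.eval (x (s - 1 / 2))
        = (x (s + 1 / 2) - x (s - 1 / 2)) * (Λ.D P).eval (x s) ∧
      P.eval (x (s + 1 / 2)) + P.eval (x (s - 1 / 2)) = 2 * (Λ.S P).eval (x s) := by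
  induction P using Polynomial.induction_on' with
  | add p q hp hq =>
    simp only [eval_add, map_add]
    constructor
    · linear_combination hp.1 + hq.1
    · linear_combination hp.2 + hq.2
  | monomial n a =>
    rw [← C_mul_X_pow_eq_monomial, ← smul_eq_C_mul, map_smul, map_smul, D_X_pow, S_X_pow]
    simp only [eval_smul, smul_eq_mul, eval_pow, eval_X]
    have key : x (s + 1 / 2) ^ n - x (s - 1 / 2) ^ n
        = (x (s + 1 / 2) - x (s - 1 / 2)) * ((Λ.pow n).1).eval (x s) ∧
        x (s + 1 / 2) ^ n + x (s - 1 / 2) ^ n = 2 * ((Λ.pow n).2).eval (x s) := by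
      induction n with
      | zero => simp [LatticeData.pow]; norm_num
      | succ n ih =>
        have h1 := hx.sum s
        have h2 := hx.sq s
        obtain ⟨i1, i2⟩ := ih
        simp only [LatticeData.pow, eval_add, eval_mul, eval_C, eval_X]
        set p := x (s + 1 / 2)
        set m := x (s - 1 / 2)
        constructor
        · linear_combination (p + m) / 2 * i1 + (p - m) / 2 * i2
            + (p - m) * (Λ.pow n).1.eval (x s) / 2 * h1
        · linear_combination (p - m) / 2 * i1 + (p + m) / 2 * i2
            + (Λ.pow n).1.eval (x s) / 2 * h2 + (Λ.pow n).2.eval (x s) * h1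
    constructor
    · linear_combination a * key.1
    · linear_combination a * key.2

end IsLattice
end LatticeData
end Lattice

/-! ### From equations on the lattice to an eigenvalue problem for polynomials. -/

section LatticeEquations
open Polynomial

namespace LatticeData
variable {Λ : LatticeData} {x : ℂ → ℂ}
namespace IsLattice
variable (hx : Λ.IsLattice x)
include hx

theorem poly_ext {p r : ℂ[X]} (h : ∀ s, RegularPoint x s → p.eval (x s) = r.eval (x s)) :
    p = r := by
  refine Polynomial.eq_of_infinite_eval_eq p r (hx.infinite.mono ?_)
  rintro _ ⟨s, hs, rfl⟩
  exact h s hs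

theorem divDiff_eval (P : ℂ[X]) {s : ℂ} (hs : x (s + 1 / 2) ≠ x (s - 1 / 2)) :
    divDiff x (fun t => P.eval (x t)) s = (Λ.D P).eval (x s) := by
  rw [divDiff, (hx.eval_D_S P s).1, mul_div_cancel_left₀ _ (sub_ne_zero.mpr hs)]

/-- The last two conditions of `RegularPoint` are the nonvanishing of the denominators at s ± 1/2,
which the second-order operators need. -/
theorem divDiff_shift (P : ℂ[X]) {s : ℂ} (hs : RegularPoint x s) :
    divDiff x (fun t => P.eval (x t)) (s + 1 / 2) = (Λ.D P).eval (x (s + 1 / 2)) ∧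
      divDiff x (fun t => P.eval (x t)) (s - 1 / 2) = (Λ.D P).eval (x (s - 1 / 2)) := by
  obtain ⟨-, h1, h2⟩ := hs
  constructor <;> apply hx.divDiff_eval
  · rwa [show s + 1 / 2 + 1 / 2 = s + 1 by ring, show s + 1 / 2 - 1 / 2 = s by ring]
  · rwa [show s - 1 / 2 + 1 / 2 = s by ring, show s - 1 / 2 - 1 / 2 = s - 1 by ring]

theorem op_eval_eq_divDiff (φ ψ P : ℂ[X]) {s : ℂ} (hs : RegularPoint x s) :
    (Λ.op φ ψ P).eval (x s) = φ.eval (x s) * divDiff x (divDiff x fun t => P.eval (x t)) s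
      + ψ.eval (x s) * avgOp (divDiff x fun t => P.eval (x t)) s := by
  obtain ⟨h1, h2⟩ := hx.divDiff_shift P hs
  have e1 := hx.divDiff_eval (Λ.D P) hs.1
  have e2 := (hx.eval_D_S (Λ.D P) s).2
  rw [divDiff] at e1
  rw [op_apply, divDiff.eq_1 x (divDiff x fun t => P.eval (x t)) s, avgOp, h1, h2, e1, e2]
  simp

/-- The operator as a three-term difference operator: the coefficients of the two differences are
the functions A and C of the Vinet–Zhedanov equation. -/
theorem op_eval (φ ψ P : ℂ[X]) {s : ℂ} (hs : RegularPoint x s) :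
    (Λ.op φ ψ P).eval (x s)
      = (φ.eval (x s) / (x (s + 1 / 2) - x (s - 1 / 2)) + ψ.eval (x s) / 2)
          / (x (s + 1) - x s) * (P.eval (x (s + 1)) - P.eval (x s))
        + (φ.eval (x s) / (x (s + 1 / 2) - x (s - 1 / 2)) - ψ.eval (x s) / 2)
          / (x s - x (s - 1)) * (P.eval (x (s - 1)) - P.eval (x s)) := by
  rw [hx.op_eval_eq_divDiff φ ψ P hs]
  simp only [divDiff, avgOp]
  rw [show s + 1 / 2 + 1 / 2 = s + 1 by ring, show s + 1 / 2 - 1 / 2 = s by ring,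
    show s - 1 / 2 + 1 / 2 = s by ring, show s - 1 / 2 - 1 / 2 = s - 1 by ring]
  ring

theorem solves_iff (φ ψ : ℂ[X]) (lam : ℂ) (y : ℂ[X]) :
    SolvesSturmLiouville x φ ψ lam y ↔ Λ.op φ ψ y = C (-lam) * y := by
  constructor
  · intro h
    refine hx.poly_ext fun s hs => ?_
    rw [hx.op_eval_eq_divDiff φ ψ y hs, eval_mul, eval_C]
    linear_combination h s hs
  · intro h s hs
    rw [← hx.op_eval_eq_divDiff φ ψ y hs, h, eval_mul, eval_C]
    ring

/-- Triangularity forces -λ_n to be the n-th diagonal entry, so distinctness of the λ_n becomes a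
property of φ and ψ alone. -/
theorem hasSturmLiouville_iff {P : ℕ → ℂ[X]} (hP : ∀ n, (P n).degree = (n : WithBot ℕ)) :
    HasSturmLiouvilleEquation x P ↔ ∃ φ ψ : ℂ[X], φ.natDegree ≤ 2 ∧ ψ.natDegree ≤ 1 ∧
      Function.Injective (Λ.diag φ ψ) ∧ ∀ n, Λ.op φ ψ (P n) = C (Λ.diag φ ψ n) * P n := by
  constructor
  · rintro ⟨φ, ψ, lam, hφ, hψ, hlam, h⟩
    have key : ∀ n, -lam n = Λ.diag φ ψ n := by
      intro n
      have := Λ.eigenvalue_eq_diag hφ hψ (ne_zero_of_degree_gt (n := ⊥) (by simp [hP]))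
        ((hx.solves_iff φ ψ (lam n) (P n)).mp (h n))
      rwa [natDegree_eq_of_degree_eq_some (hP n)] at this
    refine ⟨φ, ψ, hφ, hψ, fun m n hmn => hlam ?_, fun n => ?_⟩
    · rw [← key, ← key] at hmn
      exact neg_injective hmn
    · rw [← key]
      exact (hx.solves_iff φ ψ (lam n) (P n)).mp (h n)
  · rintro ⟨φ, ψ, hφ, hψ, hinj, h⟩
    refine ⟨φ, ψ, fun n => -Λ.diag φ ψ n, hφ, hψ, fun m n hmn => hinj (neg_injective hmn),
      fun n => ?_⟩
    rw [hx.solves_iff, neg_neg]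
    exact h n

omit hx in
theorem D_X : Λ.D X = 1 := by
  have := Λ.D_X_pow 1
  rw [pow_one] at this
  simp [this, LatticeData.pow]

omit hx in
theorem D_X_sq : Λ.D (X ^ 2) = C (2 * Λ.α) * X + C (2 * Λ.β) := by
  simp only [D_X_pow, LatticeData.pow, C_mul, map_ofNat]
  ring

omit hx in
theorem D_D_X_sq : Λ.D (Λ.D (X ^ 2)) = C (2 * Λ.α) := by
  rw [D_X_sq, map_add, D_C, add_zero, ← smul_eq_C_mul, map_smul, D_X, smul_eq_C_mul, mul_one]

omit hx in
theorem S_D_X : Λ.S (Λ.D X) = 1 := by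
  have := Λ.S_X_pow 0
  rw [pow_zero] at this
  rw [D_X, this, LatticeData.pow]

/-- Since α ≠ 0, this shows x(s + 1) ≠ x(s - 1) at regular points, so that two coefficients can be
recovered from the action on x and x². -/
theorem sum_shift (s : ℂ) :
    x (s + 1) - x (s - 1) = 2 * Λ.α * (x (s + 1 / 2) - x (s - 1 / 2)) := by
  have h1 := hx.sum (s + 1 / 2)
  have h2 := hx.sum (s - 1 / 2)
  rw [show s + 1 / 2 + 1 / 2 = s + 1 by ring, show s + 1 / 2 - 1 / 2 = s by ring] at h1
  rw [show s - 1 / 2 + 1 / 2 = s by ring, show s - 1 / 2 - 1 / 2 = s - 1 by ring] at h2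
  linear_combination h1 - h2

/-- After subtracting λ_0, the difference operator kills constants and, by the cases n = 1, 2, sends
x and x² to polynomials in x of degree at most 1 and 2. Some φ𝔻² + ψ𝕊𝔻 has the same images of x and
x², and two operators of this three-term shape that agree on 1, x, x² coincide at regular points. -/
theorem vinetZhedanov_iff {P : ℕ → ℂ[X]} (hP : ∀ n, (P n).degree = (n : WithBot ℕ)) :
    HasVinetZhedanovEquation x P ↔ HasSturmLiouvilleEquation x P := by
  constructor
  · rintro ⟨A, B, E, lam, hlam, h⟩
    have nd : ∀ n, (P n).natDegree = n := fun n => natDegree_eq_of_degree_eq_some (hP n)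
    have lc : ∀ n, (P n).coeff n ≠ 0 := fun n => coeff_ne_zero_of_eq_degree (hP n)
    have hABE : ∀ s, RegularPoint x s → A s + B s + E s = lam 0 := by
      intro s hs
      have := h 0 s hs
      rw [eq_C_of_natDegree_le_zero (nd 0).le] at this
      simp only [eval_C] at this
      exact mul_right_cancel₀ (lc 0) (by linear_combination this)
    have hT : ∀ n s, RegularPoint x s →
        A s * ((P n).eval (x (s + 1)) - (P n).eval (x s))
          + E s * ((P n).eval (x (s - 1)) - (P n).eval (x s))
          = (lam n - lam 0) * (P n).eval (x s) := by
      intro n s hs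
      linear_combination h n s hs - (P n).eval (x s) * hABE s hs
    -- ψ and χ are the images of x and x². As 𝔻x = 1 and 𝔻²x = 0, the image of x must be ψ itself;
    -- as 𝔻²x² = 2α, the equation 2αφ + ψ𝕊𝔻x² = χ then determines φ.
    set ψ : ℂ[X] := C ((lam 1 - lam 0) / (P 1).coeff 1) * P 1 with hψ
    set χ : ℂ[X] := C ((P 2).coeff 2)⁻¹ * (C (lam 2 - lam 0) * P 2 - C ((P 2).coeff 1) * ψ) with hχ
    set φ : ℂ[X] := C (2 * Λ.α)⁻¹ * (χ - ψ * Λ.S (Λ.D (X ^ 2))) with hφ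
    have dψ : ψ.natDegree ≤ 1 := (natDegree_C_mul_le _ _).trans (nd 1).le
    have dχ : χ.natDegree ≤ 2 := by
      refine (natDegree_C_mul_le _ _).trans ((natDegree_sub_le_iff_left ?_).mpr ?_)
      · exact (natDegree_C_mul_le _ _).trans (dψ.trans one_le_two)
      · exact (natDegree_C_mul_le _ _).trans (nd 2).le
    have dφ : φ.natDegree ≤ 2 := by
      refine (natDegree_C_mul_le _ _).trans ((natDegree_sub_le_iff_left ?_).mpr dχ)
      exact natDegree_mul_le_of_le dψ
        (Λ.S_natDegree (Λ.D_natDegree (n := 1) (natDegree_X_pow_le 2)).1).1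
    have opX : Λ.op φ ψ X = ψ := by
      rw [op_apply, S_D_X, D_X, ← C_1, D_C, C_1]
      ring
    have opX2 : Λ.op φ ψ (X ^ 2) = χ := by
      rw [op_apply, D_D_X_sq, hφ]
      have : C (2 * Λ.α)⁻¹ * C (2 * Λ.α) = (1 : ℂ[X]) := by
        rw [← C_mul, inv_mul_cancel₀ (mul_ne_zero two_ne_zero Λ.α_ne), C_1]
      linear_combination (χ - ψ * Λ.S (Λ.D (X ^ 2))) * this
    have T1 : ∀ s, RegularPoint x s →
        A s * (x (s + 1) - x s) + E s * (x (s - 1) - x s) = ψ.eval (x s) := by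
      intro s hs
      have := hT 1 s hs
      rw [(P 1).as_sum_range_C_mul_X_pow' (Nat.lt_succ_of_le (nd 1).le)] at this
      rw [hψ, (P 1).as_sum_range_C_mul_X_pow' (Nat.lt_succ_of_le (nd 1).le)]
      have l1 := lc 1
      simp [Finset.sum_range_succ] at this ⊢
      field_simp
      linear_combination this
    have T2 : ∀ s, RegularPoint x s →
        A s * (x (s + 1) ^ 2 - x s ^ 2) + E s * (x (s - 1) ^ 2 - x s ^ 2) = χ.eval (x s) := by
      intro s hs
      have h2 := hT 2 s hs
      have h1 := T1 s hs
      have e : ∀ t, (P 2).eval t = (P 2).coeff 0 + (P 2).coeff 1 * t + (P 2).coeff 2 * t ^ 2 := by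
        intro t
        conv_lhs => rw [(P 2).as_sum_range_C_mul_X_pow' (Nat.lt_succ_of_le (nd 2).le)]
        simp [Finset.sum_range_succ]
      have l2 := lc 2
      rw [hχ, eval_mul, eval_sub, eval_mul, eval_mul, eval_C, eval_C, eval_C, ← h2, ← h1, e, e, e]
      field_simp
      ring
    refine ⟨φ, ψ, fun n => -(lam n - lam 0), dφ, dψ, fun m n hmn => hlam ?_, fun n => ?_⟩
    · linear_combination -hmn
    rw [hx.solves_iff, neg_neg]
    refine hx.poly_ext fun s hs => ?_
    rw [eval_mul, eval_C, ← hT n s hs, hx.op_eval φ ψ _ hs]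
    have o1 := (T1 s hs).trans
      ((congrArg (eval (x s)) opX).symm.trans (hx.op_eval φ ψ X hs))
    have o2 := (T2 s hs).trans
      ((congrArg (eval (x s)) opX2).symm.trans (hx.op_eval φ ψ (X ^ 2) hs))
    simp only [eval_pow, eval_X] at o1 o2
    have hne := hx.sum_shift s
    obtain ⟨r1, r2, r3⟩ := hs
    have r4 : x (s + 1) - x (s - 1) ≠ 0 := by
      rw [hne]
      exact mul_ne_zero (mul_ne_zero two_ne_zero Λ.α_ne) (sub_ne_zero.mpr r1)
    set A' := (φ.eval (x s) / (x (s + 1 / 2) - x (s - 1 / 2)) + ψ.eval (x s) / 2)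
          / (x (s + 1) - x s)
    set E' := (φ.eval (x s) / (x (s + 1 / 2) - x (s - 1 / 2)) - ψ.eval (x s) / 2)
          / (x s - x (s - 1))
    have hA : A s = A' := by
      -- Subtracting x(s) + x(s-1) times the relation for x from the one for x² eliminates the
      -- coefficient of the backward difference.
      have : (A s - A') * ((x (s + 1) - x s) * (x (s + 1) - x (s - 1))) = 0 := by
        linear_combination o2 - (x s + x (s - 1)) * o1
      rcases mul_eq_zero.mp this with h0 | h0
      · exact sub_eq_zero.mp h0
      · exact absurd h0 (mul_ne_zero (sub_ne_zero.mpr r2) r4)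
    have hE : E s = E' := by
      have : (E s - E') * (x (s - 1) - x s) = 0 := by
        rw [hA] at o1
        linear_combination o1
      rcases mul_eq_zero.mp this with h0 | h0
      · exact sub_eq_zero.mp h0
      · exact absurd h0 (sub_ne_zero.mpr r3.symm)
    rw [hA, hE]
  · rintro ⟨φ, ψ, lam, -, -, hlam, h⟩
    set A : ℂ → ℂ := fun s => (φ.eval (x s) / (x (s + 1 / 2) - x (s - 1 / 2)) + ψ.eval (x s) / 2)
          / (x (s + 1) - x s) with hA
    set E : ℂ → ℂ := fun s => (φ.eval (x s) / (x (s + 1 / 2) - x (s - 1 / 2)) - ψ.eval (x s) / 2)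
          / (x s - x (s - 1)) with hE
    -- The middle coefficient -A - E turns the two differences into plain values.
    refine ⟨A, fun s => -A s - E s, E, fun n => -lam n, fun m n hmn => hlam (neg_injective hmn),
      fun n s hs => ?_⟩
    have := (hx.solves_iff φ ψ (lam n) (P n)).mp (h n)
    have := congrArg (Polynomial.eval (x s)) this
    rw [hx.op_eval φ ψ _ hs, eval_mul, eval_C] at this
    linear_combination this

theorem isMultipleOf_iff (P R : ℕ → ℂ[X]) :
    (IsMultipleOf x P fun n s => (R n).eval (x s)) ↔ ∀ n, ∃ K : ℂ, K ≠ 0 ∧ P n = C K * R n := by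
  refine forall_congr' fun n => exists_congr fun K => and_congr_right fun _ => ?_
  constructor
  · intro h
    refine hx.poly_ext fun s _ => ?_
    rw [eval_mul, eval_C]
    exact h s
  · intro h s
    rw [h, eval_mul, eval_C]

/-- Polynomials satisfying a Sturm–Liouville equation are determined by the equation. -/
theorem isMultipleOf_of_eigen {φ ψ : ℂ[X]} (hφ : φ.natDegree ≤ 2) (hψ : ψ.natDegree ≤ 1)
    (hinj : Function.Injective (Λ.diag φ ψ)) {P R : ℕ → ℂ[X]}
    (hP : ∀ n, (P n).degree = (n : WithBot ℕ)) (hR : ∀ n, (R n).coeff n ≠ 0)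
    (hLP : ∀ n, Λ.op φ ψ (P n) = C (Λ.diag φ ψ n) * P n)
    (hLR : ∀ n, Λ.op φ ψ (R n) = C (Λ.diag φ ψ n) * R n) :
    IsMultipleOf x P fun n s => (R n).eval (x s) := by
  rw [hx.isMultipleOf_iff]
  intro n
  have hPn : (P n).coeff n ≠ 0 := coeff_ne_zero_of_eq_degree (hP n)
  exact ⟨_, div_ne_zero hPn (hR n),
    Λ.eigenvector_unique hφ hψ hinj (hR n) (hLP n) (hLR n)⟩

/-- The explicit families carry no nondegeneracy condition on their parameters. Being a multiple of
a polynomial of exact degree n supplies it: `R n` has a nonzero n-th coefficient, and `hinj`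
extracts distinct eigenvalues from that. -/
theorem hasSturmLiouville_of_isMultipleOf {φ ψ : ℂ[X]} (hφ : φ.natDegree ≤ 2)
    (hψ : ψ.natDegree ≤ 1) {P R : ℕ → ℂ[X]} (hP : ∀ n, (P n).degree = (n : WithBot ℕ))
    (hinj : (∀ n, (R n).coeff n ≠ 0) → Function.Injective (Λ.diag φ ψ))
    (hLR : ∀ n, Λ.op φ ψ (R n) = C (Λ.diag φ ψ n) * R n)
    (h : IsMultipleOf x P fun n s => (R n).eval (x s)) : HasSturmLiouvilleEquation x P := by
  rw [hx.isMultipleOf_iff] at h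
  rw [hx.hasSturmLiouville_iff hP]
  refine ⟨φ, ψ, hφ, hψ, hinj fun n h0 => ?_, fun n => ?_⟩
  · obtain ⟨K, -, hK⟩ := h n
    refine coeff_ne_zero_of_eq_degree (hP n) ?_
    rw [hK, coeff_C_mul, h0, mul_zero]
  · obtain ⟨K, -, hK⟩ := h n
    rw [hK, ← smul_eq_C_mul K, map_smul, hLR]
    simp only [smul_eq_C_mul]
    ring

end IsLattice

/-- Solving an eigenvalue equation in a basis on which the operator is bidiagonal. -/
theorem bidiagonal_eigen (T : ℂ[X] →ₗ[ℂ] ℂ[X]) (e : ℕ → ℂ[X]) (θ ν : ℕ → ℂ)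
    (h0 : T (e 0) = C (θ 0) * e 0)
    (hs : ∀ k, T (e (k + 1)) = C (θ (k + 1)) * e (k + 1) - C (ν k) * e k) (n : ℕ) (c : ℕ → ℂ)
    (hc : ∀ k < n, c k * (θ k - θ n) = c (k + 1) * ν k) :
    T (∑ k ∈ Finset.range (n + 1), C (c k) * e k)
      = C (θ n) * ∑ k ∈ Finset.range (n + 1), C (c k) * e k := by
  have h1 : T (∑ k ∈ Finset.range (n + 1), C (c k) * e k)
      = (∑ k ∈ Finset.range (n + 1), C (c k * θ k) * e k)
        - ∑ k ∈ Finset.range n, C (c (k + 1) * ν k) * e k := by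
    simp only [map_sum, ← smul_eq_C_mul, map_smul]
    simp only [smul_eq_C_mul]
    -- The lower-diagonal part is reindexed to start at k = 0. In the comparison with `θ n`, the top
    -- index k = n matches by itself, so `hc` is needed only for k < n.
    rw [Finset.sum_range_succ', Finset.sum_range_succ', h0, add_sub_right_comm,
      ← Finset.sum_sub_distrib]
    congr 1
    · refine Finset.sum_congr rfl fun k _ => ?_
      rw [hs, C_mul, C_mul]
      ring
    · rw [C_mul]
      ring
  rw [h1, Finset.mul_sum, Finset.sum_range_succ, Finset.sum_range_succ, add_sub_right_comm,
    ← Finset.sum_sub_distrib]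
  congr 1
  · refine Finset.sum_congr rfl fun k hk => ?_
    rw [← hc k (Finset.mem_range.mp hk), C_mul, C_mul, C_sub]
    ring
  · rw [C_mul]
    ring

end LatticeData
end LatticeEquations

/-! ### Factorisation over ℂ, leading coefficients of sums and products. -/

section Common
open Polynomial

/-- The factorisation l(X + a)(X + b), read off on coefficients; with roots -a, -b the elementary
symmetric functions carry no signs. -/
theorem exists_quadratic_factors (l f₁ f₂ : ℂ) (hl : l ≠ 0) :
    ∃ a b : ℂ, f₁ = l * (a + b) ∧ f₂ = l * (a * b) := by
  have hdeg : (C l * X ^ 2 + C f₁ * X + C f₂).degree ≠ 0 := by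
    rw [degree_quadratic hl]; norm_num
  obtain ⟨r, hr⟩ := IsAlgClosed.exists_root _ hdeg
  simp only [IsRoot, eval_add, eval_mul, eval_C, eval_pow, eval_X] at hr
  refine ⟨-r, f₁ / l + r, ?_, ?_⟩
  · field_simp
    ring
  · field_simp
    linear_combination hr

theorem exists_cubic_factors (l f₁ f₂ f₃ : ℂ) (hl : l ≠ 0) :
    ∃ a b c : ℂ, f₁ = l * (a + b + c) ∧ f₂ = l * (a * b + a * c + b * c) ∧
      f₃ = l * (a * b * c) := by
  have hdeg : (C l * X ^ 3 + C f₁ * X ^ 2 + C f₂ * X + C f₃).degree ≠ 0 := by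
    rw [degree_cubic hl]; norm_num
  obtain ⟨r, hr⟩ := IsAlgClosed.exists_root _ hdeg
  simp only [IsRoot, eval_add, eval_mul, eval_C, eval_pow, eval_X] at hr
  -- These are the coefficients of the quotient by X - r, from Horner's scheme.
  obtain ⟨b, c, h1, h2⟩ := exists_quadratic_factors l (f₁ + l * r) (f₂ + r * (f₁ + l * r)) hl
  refine ⟨-r, b, c, ?_, ?_, ?_⟩
  · linear_combination h1
  · linear_combination h2 - r * h1
  · linear_combination hr - r * h2

theorem exists_quartic_factors (l f₁ f₂ f₃ f₄ : ℂ) (hl : l ≠ 0) :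
    ∃ a b c d : ℂ, f₁ = l * (a + b + c + d) ∧
      f₂ = l * (a * b + a * c + a * d + b * c + b * d + c * d) ∧
      f₃ = l * (a * b * c + a * b * d + a * c * d + b * c * d) ∧ f₄ = l * (a * b * c * d) := by
  have hdeg : (C l * X ^ 4 + C f₁ * X ^ 3 + C f₂ * X ^ 2 + C f₃ * X + C f₄).degree ≠ 0 := by
    have : (C l * X ^ 4 + C f₁ * X ^ 3 + C f₂ * X ^ 2 + C f₃ * X + C f₄).degree = 4 := by
      compute_degree!
    rw [this]; norm_num
  obtain ⟨r, hr⟩ := IsAlgClosed.exists_root _ hdeg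
  simp only [IsRoot, eval_add, eval_mul, eval_C, eval_pow, eval_X] at hr
  obtain ⟨b, c, d, h1, h2, h3⟩ := exists_cubic_factors l (f₁ + l * r) (f₂ + r * (f₁ + l * r))
    (f₃ + r * (f₂ + r * (f₁ + l * r))) hl
  refine ⟨-r, b, c, d, ?_, ?_, ?_, ?_⟩
  · linear_combination h1
  · linear_combination h2 - r * h1
  · linear_combination h3 - r * h2
  · linear_combination hr - r * h3

theorem prod_linear_natDegree (p r : ℕ → ℂ) (k : ℕ) :
    (∏ j ∈ Finset.range k, (C (p j) + C (r j) * X)).natDegree ≤ k ∧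
      (∏ j ∈ Finset.range k, (C (p j) + C (r j) * X)).coeff k = ∏ j ∈ Finset.range k, r j := by
  induction k with
  | zero => simp
  | succ k ih =>
    rw [Finset.prod_range_succ, Finset.prod_range_succ]
    have h1 : (C (p k) + C (r k) * X).natDegree ≤ 1 := by
      rw [add_comm]; exact natDegree_linear_le
    obtain ⟨h2, h3⟩ := natDegree_mul_le_and_coeff ih.1 h1 rfl
    refine ⟨h2, ?_⟩
    rw [h3, ih.2]
    simp

theorem coeff_sum_of_natDegree_le {e : ℕ → ℂ[X]} (he : ∀ k, (e k).natDegree ≤ k) (c : ℕ → ℂ)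
    (n : ℕ) : (∑ k ∈ Finset.range (n + 1), C (c k) * e k).coeff n = c n * (e n).coeff n := by
  rw [finsetSum_coeff, Finset.sum_range_succ, Finset.sum_eq_zero, zero_add, coeff_C_mul]
  intro k hk
  rw [coeff_C_mul, coeff_eq_zero_of_natDegree_lt ((he k).trans_lt (Finset.mem_range.mp hk)),
    mul_zero]

theorem infinite_image_of_surjective {x : ℂ → ℂ} (hx : Function.Surjective x) {A : Set ℂ}
    (hA : (x '' Aᶜ).Finite) : (x '' A).Infinite := by
  intro h
  have : (Set.univ : Set ℂ) = x '' A ∪ x '' Aᶜ := by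
    rw [← Set.image_union, Set.union_compl_self, Set.image_univ, hx.range_eq]
  exact Set.infinite_univ (this ▸ h.union hA)

end Common

/-! ### The quadratic lattice: Wilson and continuous dual Hahn polynomials. -/

section QuadraticLattice
open Polynomial

theorem risingFactorial_eq_prod (a : ℂ) (k : ℕ) :
    risingFactorial a k = ∏ j ∈ Finset.range k, (a + j) := by
  induction k with
  | zero => simp [risingFactorial]
  | succ k ih => rw [Finset.prod_range_succ, ← ih, risingFactorial, ascPochhammer_succ_eval,
      risingFactorial]

theorem risingFactorial_succ (a : ℂ) (k : ℕ) :
    risingFactorial a (k + 1) = risingFactorial a k * (a + k) := by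
  simp only [risingFactorial_eq_prod, Finset.prod_range_succ]

theorem risingFactorial_succ' (a : ℂ) (k : ℕ) :
    risingFactorial a (k + 1) = a * risingFactorial (a + 1) k := by
  simp only [risingFactorial_eq_prod, Finset.prod_range_succ']
  rw [mul_comm]
  simp only [Nat.cast_zero, add_zero, Nat.cast_add, Nat.cast_one]
  congr 1
  exact Finset.prod_congr rfl fun j _ => by ring

theorem risingFactorial_shift (a : ℂ) {n k : ℕ} (hk : k < n) :
    risingFactorial (a + k) (n - k)
      = (a + k) * risingFactorial (a + ((k + 1 : ℕ) : ℂ)) (n - (k + 1)) := by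
  rw [show n - k = n - (k + 1) + 1 by omega, risingFactorial_succ', Nat.cast_add, Nat.cast_one,
    add_assoc]

theorem risingFactorial_neg_ne_zero (n : ℕ) : risingFactorial (-(n : ℂ)) n ≠ 0 := by
  rw [risingFactorial_eq_prod, Finset.prod_ne_zero_iff]
  intro j hj h
  rw [neg_add_eq_zero, Nat.cast_inj] at h
  exact (Finset.mem_range.mp hj).ne h.symm

/-- The constants of the lattice `c₄ s² + c₅ s`. -/
noncomputable def quadraticData (c₄ c₅ : ℂ) : LatticeData where
  α := 1
  β := c₄ / 4
  U := C c₄ * X + C (c₅ ^ 2 / 4)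
  γ n := n
  μ _ := 1
  α_ne := one_ne_zero
  U_natDegree := natDegree_linear_le.trans one_le_two
  U_coeff := by
    rw [coeff_eq_zero_of_natDegree_lt (natDegree_linear_le.trans_lt one_lt_two)]
    norm_num
  γ_zero := by simp
  μ_zero := rfl
  γ_succ n := by push_cast; ring
  μ_succ n := by ring

variable {c₄ : ℂ} (c₅ : ℂ) (hc₄ : c₄ ≠ 0)
include hc₄

theorem quadraticLattice_eq (s : ℂ) : quadraticLattice c₄ c₅ s
    = c₄ * ((s + c₅ / c₄ / 2) ^ 2 - (c₅ / c₄) ^ 2 / 4) := by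
  rw [quadraticLattice]
  field_simp
  ring

theorem quadraticData_isLattice :
    (quadraticData c₄ c₅).IsLattice (quadraticLattice c₄ c₅) where
  sum s := by
    simp only [quadraticLattice, quadraticData]
    ring
  sq s := by
    simp only [quadraticLattice, quadraticData, eval_add, eval_mul, eval_C, eval_X]
    ring
  infinite := by
    refine infinite_image_of_surjective ?_ (Set.Finite.image _ ?_)
    · intro v
      obtain ⟨r, hr⟩ := IsAlgClosed.exists_pow_nat_eq (v / c₄ + (c₅ / c₄) ^ 2 / 4)
        (show 0 < 2 by norm_num)
      refine ⟨r - c₅ / c₄ / 2, ?_⟩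
      rw [quadraticLattice_eq c₅ hc₄, sub_add_cancel, hr]
      field_simp
      ring
    -- The excluded points are those with s + u/2 equal to 0, -1/2 or 1/2.
    · refine Set.Finite.subset (s := {-c₅ / c₄ / 2, -c₅ / c₄ / 2 - 1 / 2, -c₅ / c₄ / 2 + 1 / 2})
        (by simp) ?_
      intro s hs
      simp only [Set.mem_compl_iff, Set.mem_ofPred_eq, RegularPoint, not_and_or, not_not,
        quadraticLattice] at hs
      simp only [Set.mem_insert_iff, Set.mem_singleton_iff]
      rcases hs with h | h | h
      · left
        field_simp
        linear_combination h
      · right; left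
        field_simp
        linear_combination h
      · right; right
        field_simp
        linear_combination h

omit hc₄

/-- The polynomial in `x` with value `(s + u/2)²`, where `u = c₅ / c₄`. -/
noncomputable def shiftSq (c₄ c₅ : ℂ) : ℂ[X] := C (c₄⁻¹) * X + C ((c₅ / c₄) ^ 2 / 4)

/-- The coefficient `φ` belonging to the even part `f₀ + f₂ S² + f₄ S⁴`. -/
noncomputable def quadraticPhi (c₄ c₅ f₀ f₂ f₄ : ℂ) : ℂ[X] :=
  C (c₄ ^ 2) * (C f₀ + C f₂ * shiftSq c₄ c₅ + C f₄ * shiftSq c₄ c₅ ^ 2)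

/-- The coefficient `ψ` belonging to the odd part `f₁ S + f₃ S³`. -/
noncomputable def quadraticPsi (c₄ c₅ f₁ f₃ : ℂ) : ℂ[X] :=
  C c₄ * (C f₁ + C f₃ * shiftSq c₄ c₅)

theorem quadraticPhi_natDegree (c₄ c₅ f₀ f₂ f₄ : ℂ) :
    (quadraticPhi c₄ c₅ f₀ f₂ f₄).natDegree ≤ 2 := by
  rw [quadraticPhi, shiftSq]; compute_degree

theorem quadraticPsi_natDegree (c₄ c₅ f₁ f₃ : ℂ) :
    (quadraticPsi c₄ c₅ f₁ f₃).natDegree ≤ 1 := by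
  rw [quadraticPsi, shiftSq]; compute_degree

include hc₄

theorem shiftSq_eval (s : ℂ) :
    (shiftSq c₄ c₅).eval (quadraticLattice c₄ c₅ s) = (s + c₅ / c₄ / 2) ^ 2 := by
  rw [quadraticLattice_eq c₅ hc₄]
  simp only [shiftSq, eval_add, eval_mul, eval_C, eval_X]
  field_simp
  ring

/-- `shiftSq` is an affine function of x, so any quadratic φ can be re-expanded in it; together with
the same fact for ψ, every pair (φ, ψ) comes from a quartic f. -/
theorem exists_quadraticPhi {φ : ℂ[X]} (hφ : φ.natDegree ≤ 2) :
    ∃ f₀ f₂ f₄, φ = quadraticPhi c₄ c₅ f₀ f₂ f₄ := by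
  refine ⟨(φ.coeff 0 - φ.coeff 1 * c₄ * ((c₅ / c₄) ^ 2 / 4)
      + φ.coeff 2 * c₄ ^ 2 * ((c₅ / c₄) ^ 2 / 4) ^ 2) / c₄ ^ 2,
    (φ.coeff 1 * c₄ - 2 * φ.coeff 2 * c₄ ^ 2 * ((c₅ / c₄) ^ 2 / 4)) / c₄ ^ 2, φ.coeff 2, ?_⟩
  refine Polynomial.funext fun t => ?_
  conv_lhs => rw [φ.as_sum_range_C_mul_X_pow' (Nat.lt_succ_of_le hφ)]
  simp [Finset.sum_range_succ, quadraticPhi, shiftSq]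
  field_simp
  ring

theorem exists_quadraticPsi {ψ : ℂ[X]} (hψ : ψ.natDegree ≤ 1) :
    ∃ f₁ f₃, ψ = quadraticPsi c₄ c₅ f₁ f₃ := by
  refine ⟨(ψ.coeff 0 - ψ.coeff 1 * c₄ * ((c₅ / c₄) ^ 2 / 4)) / c₄, ψ.coeff 1, ?_⟩
  refine Polynomial.funext fun t => ?_
  conv_lhs => rw [ψ.as_sum_range_C_mul_X_pow' (Nat.lt_succ_of_le hψ)]
  simp [Finset.sum_range_succ, quadraticPsi, shiftSq]
  field_simp
  ring

theorem quadratic_diag (f₀ f₁ f₂ f₃ f₄ : ℂ) (n : ℕ) :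
    (quadraticData c₄ c₅).diag (quadraticPhi c₄ c₅ f₀ f₂ f₄) (quadraticPsi c₄ c₅ f₁ f₃) n
      = n * (f₄ * (n - 1) + f₃) := by
  have h1 : (quadraticPhi c₄ c₅ f₀ f₂ f₄).coeff 2 = f₄ := by
    rw [quadraticPhi, shiftSq]
    have e : (C c₄⁻¹ * X + C ((c₅ / c₄) ^ 2 / 4) : ℂ[X]) ^ 2 = C (c₄⁻¹ ^ 2) * X ^ 2
        + C (2 * c₄⁻¹ * ((c₅ / c₄) ^ 2 / 4)) * X + C (((c₅ / c₄) ^ 2 / 4) ^ 2) := by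
      simp only [C_mul, C_pow, map_ofNat]
      ring
    rw [e, coeff_C_mul]
    simp only [coeff_add, coeff_C_mul, coeff_X_pow, coeff_X, coeff_C]
    norm_num
    field_simp
  have h2 : (quadraticPsi c₄ c₅ f₁ f₃).coeff 1 = f₃ := by
    rw [quadraticPsi, shiftSq]
    simp [coeff_C]
    field_simp
  rcases n with _ | n
  · simp [LatticeData.diag, quadraticData]
  · simp only [LatticeData.diag, h1, h2, quadraticData, Nat.add_sub_cancel]
    push_cast
    ring

/-- Since x(s + 1/2) - x(s - 1/2) = 2c₄S, φ contributes the even part and ψ the odd part of one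
polynomial f; the forward coefficient contains f(S), the backward one f(-S). -/
theorem quadratic_op_eval (f₀ f₁ f₂ f₃ f₄ : ℂ) (P : ℂ[X]) {s S : ℂ} (hS : S = s + c₅ / c₄ / 2)
    (hs : RegularPoint (quadraticLattice c₄ c₅) s) : S ≠ 0 ∧ 2 * S + 1 ≠ 0 ∧ 2 * S - 1 ≠ 0 ∧
    ((quadraticData c₄ c₅).op (quadraticPhi c₄ c₅ f₀ f₂ f₄) (quadraticPsi c₄ c₅ f₁ f₃) P).eval
        (quadraticLattice c₄ c₅ s)
      = (f₀ + f₁ * S + f₂ * S ^ 2 + f₃ * S ^ 3 + f₄ * S ^ 4) / (2 * S * (2 * S + 1))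
          * (P.eval (quadraticLattice c₄ c₅ (s + 1)) - P.eval (quadraticLattice c₄ c₅ s))
        + (f₀ - f₁ * S + f₂ * S ^ 2 - f₃ * S ^ 3 + f₄ * S ^ 4) / (2 * S * (2 * S - 1))
          * (P.eval (quadraticLattice c₄ c₅ (s - 1)) - P.eval (quadraticLattice c₄ c₅ s)) := by
  have e1 : quadraticLattice c₄ c₅ (s + 1 / 2) - quadraticLattice c₄ c₅ (s - 1 / 2)
      = c₄ * (2 * S) := by
    rw [quadraticLattice_eq c₅ hc₄, quadraticLattice_eq c₅ hc₄, hS]; ring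
  have e2 : quadraticLattice c₄ c₅ (s + 1) - quadraticLattice c₄ c₅ s = c₄ * (2 * S + 1) := by
    rw [quadraticLattice_eq c₅ hc₄, quadraticLattice_eq c₅ hc₄, hS]; ring
  have e3 : quadraticLattice c₄ c₅ s - quadraticLattice c₄ c₅ (s - 1) = c₄ * (2 * S - 1) := by
    rw [quadraticLattice_eq c₅ hc₄, quadraticLattice_eq c₅ hc₄, hS]; ring
  have n1 : S ≠ 0 := by
    rintro rfl
    exact hs.1 (sub_eq_zero.mp (by rw [e1]; ring))
  have n2 : 2 * S + 1 ≠ 0 := fun h => hs.2.1 (sub_eq_zero.mp (by rw [e2, h, mul_zero]))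
  have n3 : 2 * S - 1 ≠ 0 := fun h => hs.2.2 (sub_eq_zero.mp (by rw [e3, h, mul_zero]))
  refine ⟨n1, n2, n3, ?_⟩
  rw [(quadraticData_isLattice c₅ hc₄).op_eval _ _ _ hs, e1, e2, e3]
  simp only [quadraticPhi, quadraticPsi, eval_add, eval_mul, eval_C, eval_pow,
    shiftSq_eval c₅ hc₄, ← hS]
  congr 2
  · field_simp
    ring
  · field_simp
    ring

omit hc₄

/-- `wilsonBasis a k (-(s + u/2)²)` as a polynomial in `x`. -/
noncomputable def wilsonBasisPoly (c₄ c₅ a : ℂ) (k : ℕ) : ℂ[X] :=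
  ∏ j ∈ Finset.range k, (C ((a + j) ^ 2 - (c₅ / c₄) ^ 2 / 4) + C (-c₄⁻¹) * X)

include hc₄

theorem wilsonBasisPoly_eval (a : ℂ) (k : ℕ) (s : ℂ) :
    (wilsonBasisPoly c₄ c₅ a k).eval (quadraticLattice c₄ c₅ s)
      = wilsonBasis a k (-(s + c₅ / c₄ / 2) ^ 2) := by
  rw [wilsonBasisPoly, wilsonBasis, eval_prod]
  refine Finset.prod_congr rfl fun j _ => ?_
  rw [← shiftSq_eval c₅ hc₄]
  simp only [shiftSq, eval_add, eval_mul, eval_C, eval_X]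
  ring

omit hc₄ in
theorem wilsonBasis_eq (a S : ℂ) (k : ℕ) :
    wilsonBasis a k (-S ^ 2) = risingFactorial (a - S) k * risingFactorial (a + S) k := by
  rw [risingFactorial_eq_prod, risingFactorial_eq_prod, ← Finset.prod_mul_distrib, wilsonBasis]
  exact Finset.prod_congr rfl fun j _ => by ring

omit hc₄ in
-- Under S → S + 1 the products (a - S)_{k+1} and (a + S)_{k+1} shift in opposite directions and
-- keep most factors in common. The prefactor a + S avoids a division and will be the factor of f.
theorem wilsonBasis_diff (a S : ℂ) (k : ℕ) :
    (a + S) * (wilsonBasis a (k + 1) (-(S + 1) ^ 2) - wilsonBasis a (k + 1) (-S ^ 2))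
      = -((k + 1) * (2 * S + 1) * (a + S + k)) * wilsonBasis a k (-S ^ 2) := by
  have e1 := risingFactorial_succ' (a - (S + 1)) k
  have e2 := risingFactorial_succ (a + (S + 1)) k
  have e3 := risingFactorial_succ (a - S) k
  have e4 := risingFactorial_succ' (a + S) k
  have e5 := risingFactorial_succ (a + S) k
  rw [show a - (S + 1) + 1 = a - S by ring] at e1
  rw [show a + S + 1 = a + (S + 1) by ring] at e4
  simp only [wilsonBasis_eq]
  rw [e1, e2, e3]
  linear_combination risingFactorial (a - S) k * (a - S - 1) * (a + S + 1 + k) * (e5 - e4)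
    - risingFactorial (a - S) k * (a - S + k) * (a + S) * e5

/-- Here f(S) = (a + S) g(S) with g cubic. The factor a + S reduces each difference to a multiple of
the k-th basis element, and the remaining even expression is linear in S². The coefficient on the
lower diagonal is (k + 1) g(a + k). -/
theorem wilson_op_basis (a g₀ g₁ g₂ g₃ : ℂ) (k : ℕ) :
    (quadraticData c₄ c₅).op (quadraticPhi c₄ c₅ (a * g₀) (g₁ + a * g₂) g₃)
        (quadraticPsi c₄ c₅ (g₀ + a * g₁) (g₂ + a * g₃)) (wilsonBasisPoly c₄ c₅ a (k + 1))
      = C ((k + 1) * (g₂ + g₃ * (a + k))) * wilsonBasisPoly c₄ c₅ a (k + 1)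
        - C ((k + 1) * (g₀ + g₁ * (a + k) + g₂ * (a + k) ^ 2 + g₃ * (a + k) ^ 3))
          * wilsonBasisPoly c₄ c₅ a k := by
  refine (quadraticData_isLattice c₅ hc₄).poly_ext fun s hs => ?_
  set S := s + c₅ / c₄ / 2 with hS
  obtain ⟨n1, n2, n3, h⟩ := quadratic_op_eval c₅ hc₄ (a * g₀) (g₀ + a * g₁) (g₁ + a * g₂)
    (g₂ + a * g₃) g₃ (wilsonBasisPoly c₄ c₅ a (k + 1)) hS hs
  rw [h]
  simp only [eval_sub, eval_mul, eval_C, wilsonBasisPoly_eval c₅ hc₄]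
  have d1 := wilsonBasis_diff a S k
  have d2 := wilsonBasis_diff a (-S) k
  rw [show -(-S + 1) ^ 2 = -(S - 1) ^ 2 by ring, show -(-S) ^ 2 = -S ^ 2 by ring] at d2
  rw [show s + 1 + c₅ / c₄ / 2 = S + 1 by rw [hS]; ring,
    show s - 1 + c₅ / c₄ / 2 = S - 1 by rw [hS]; ring, ← hS]
  have e : wilsonBasis a (k + 1) (-S ^ 2) = ((a + k) ^ 2 - S ^ 2) * wilsonBasis a k (-S ^ 2) := by
    rw [wilsonBasis, Finset.prod_range_succ, wilsonBasis]
    ring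
  have r1 : a * g₀ + (g₀ + a * g₁) * S + (g₁ + a * g₂) * S ^ 2 + (g₂ + a * g₃) * S ^ 3 + g₃ * S ^ 4
      = (g₀ + g₁ * S + g₂ * S ^ 2 + g₃ * S ^ 3) * (a + S) := by ring
  have r2 : a * g₀ - (g₀ + a * g₁) * S + (g₁ + a * g₂) * S ^ 2 - (g₂ + a * g₃) * S ^ 3 + g₃ * S ^ 4
      = (g₀ - g₁ * S + g₂ * S ^ 2 - g₃ * S ^ 3) * (a + -S) := by ring
  have r3 : ∀ f g h D : ℂ, f * g / h * D = f / h * (g * D) := fun _ _ _ _ => by ring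
  rw [r1, r2, r3 _ (a + S), r3 _ (a + -S), d1, d2, e]
  generalize wilsonBasis a k (-S ^ 2) = W
  clear * - n1 n2 n3
  have t1 : ∀ f y : ℂ, f / (2 * S * (2 * S + 1)) * (-((k + 1) * (2 * S + 1) * y) * W)
      = -((k + 1) * W) * (f * y) / (2 * S) := fun f y => by field_simp
  have t2 : ∀ f y : ℂ, f / (2 * S * (2 * S - 1)) * (-((k + 1) * (2 * -S + 1) * y) * W)
      = (k + 1) * W * (f * y) / (2 * S) := fun f y => by field_simp; ring
  rw [t1, t2, ← add_div, div_eq_iff (mul_ne_zero two_ne_zero n1)]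
  ring

/-- Sums over the Wilson basis which solve the Sturm–Liouville equation. -/
theorem wilson_eigen (a g₀ g₁ g₂ g₃ : ℂ) (n : ℕ) (c : ℕ → ℂ)
    (hc : ∀ k < n, c k * (k * (g₂ + g₃ * (a + k - 1)) - n * (g₂ + g₃ * (a + n - 1)))
      = c (k + 1) * ((k + 1) * (g₀ + g₁ * (a + k) + g₂ * (a + k) ^ 2 + g₃ * (a + k) ^ 3))) :
    (quadraticData c₄ c₅).op (quadraticPhi c₄ c₅ (a * g₀) (g₁ + a * g₂) g₃)
        (quadraticPsi c₄ c₅ (g₀ + a * g₁) (g₂ + a * g₃))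
        (∑ k ∈ Finset.range (n + 1), C (c k) * wilsonBasisPoly c₄ c₅ a k)
      = C ((quadraticData c₄ c₅).diag (quadraticPhi c₄ c₅ (a * g₀) (g₁ + a * g₂) g₃)
        (quadraticPsi c₄ c₅ (g₀ + a * g₁) (g₂ + a * g₃)) n)
        * ∑ k ∈ Finset.range (n + 1), C (c k) * wilsonBasisPoly c₄ c₅ a k := by
  have h := LatticeData.bidiagonal_eigen ((quadraticData c₄ c₅).op
    (quadraticPhi c₄ c₅ (a * g₀) (g₁ + a * g₂) g₃)
    (quadraticPsi c₄ c₅ (g₀ + a * g₁) (g₂ + a * g₃))) (wilsonBasisPoly c₄ c₅ a)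
    (fun k => k * (g₂ + g₃ * (a + k - 1)))
    (fun k => (k + 1) * (g₀ + g₁ * (a + k) + g₂ * (a + k) ^ 2 + g₃ * (a + k) ^ 3)) ?_ ?_ n c hc
  · rw [h, quadratic_diag c₅ hc₄]
    congr 2
    ring
  · have : wilsonBasisPoly c₄ c₅ a 0 = C 1 := by simp [wilsonBasisPoly]
    rw [this, LatticeData.op_apply, LatticeData.D_C]
    simp
  · intro k
    rw [wilson_op_basis c₅ hc₄]
    push_cast
    congr 3
    ring

omit hc₄
/-- The coefficients of the Wilson polynomials in the Wilson basis. -/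
noncomputable def wilsonCoeff (n : ℕ) (a b c d : ℂ) (k : ℕ) : ℂ :=
  risingFactorial (-(n : ℂ)) k * risingFactorial (n + a + b + c + d - 1) k
      * risingFactorial (a + b + k) (n - k) * risingFactorial (a + c + k) (n - k)
      * risingFactorial (a + d + k) (n - k) / (Nat.factorial k : ℂ)

/-- The coefficients of the continuous dual Hahn polynomials in the Wilson basis. -/
noncomputable def dualHahnCoeff (n : ℕ) (a b c : ℂ) (k : ℕ) : ℂ :=
  risingFactorial (-(n : ℂ)) k
      * risingFactorial (a + b + k) (n - k) * risingFactorial (a + c + k) (n - k)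
      / (Nat.factorial k : ℂ)

/-- The recursion of `wilson_eigen` for g(S) = (b + S)(c + S)(d + S). No condition on the parameters
is needed, since the denominators of the hypergeometric term have been cleared. -/
theorem wilsonCoeff_succ (n : ℕ) (a b c d : ℂ) {k : ℕ} (hk : k < n) :
    wilsonCoeff n a b c d k * ((k - n) * (k + n + a + b + c + d - 1))
      = wilsonCoeff n a b c d (k + 1) * ((k + 1) * ((a + b + k) * (a + c + k) * (a + d + k))) := by
  simp only [wilsonCoeff]
  rw [risingFactorial_shift _ hk, risingFactorial_shift _ hk, risingFactorial_shift _ hk,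
    risingFactorial_succ, risingFactorial_succ, Nat.factorial_succ]
  have : (Nat.factorial k : ℂ) ≠ 0 := Nat.cast_ne_zero.mpr (Nat.factorial_ne_zero k)
  have : (k : ℂ) + 1 ≠ 0 := Nat.cast_add_one_ne_zero k
  push_cast
  field_simp
  ring

theorem dualHahnCoeff_succ (n : ℕ) (a b c : ℂ) {k : ℕ} (hk : k < n) :
    dualHahnCoeff n a b c k * (k - n)
      = dualHahnCoeff n a b c (k + 1) * ((k + 1) * ((a + b + k) * (a + c + k))) := by
  simp only [dualHahnCoeff]
  rw [risingFactorial_shift _ hk, risingFactorial_shift _ hk, risingFactorial_succ,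
    Nat.factorial_succ]
  have : (Nat.factorial k : ℂ) ≠ 0 := Nat.cast_ne_zero.mpr (Nat.factorial_ne_zero k)
  have : (k : ℂ) + 1 ≠ 0 := Nat.cast_add_one_ne_zero k
  push_cast
  field_simp
  ring

/-- The Wilson polynomials as polynomials in `x`. -/
noncomputable def wilsonX (c₄ c₅ a b c d : ℂ) (n : ℕ) : ℂ[X] :=
  ∑ k ∈ Finset.range (n + 1), C (wilsonCoeff n a b c d k) * wilsonBasisPoly c₄ c₅ a k

/-- The continuous dual Hahn polynomials as polynomials in `x`. -/
noncomputable def dualHahnX (c₄ c₅ a b c : ℂ) (n : ℕ) : ℂ[X] :=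
  ∑ k ∈ Finset.range (n + 1), C (dualHahnCoeff n a b c k) * wilsonBasisPoly c₄ c₅ a k

theorem wilsonBasisPoly_natDegree (c₄ a : ℂ) (k : ℕ) :
    (wilsonBasisPoly c₄ c₅ a k).natDegree ≤ k := (prod_linear_natDegree _ _ k).1

include hc₄

theorem wilsonBasisPoly_coeff (a : ℂ) (k : ℕ) : (wilsonBasisPoly c₄ c₅ a k).coeff k ≠ 0 := by
  rw [wilsonBasisPoly, (prod_linear_natDegree _ _ k).2, Finset.prod_ne_zero_iff]
  intro j _
  exact neg_ne_zero.mpr (inv_ne_zero hc₄)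

theorem wilsonX_eval (a b c d : ℂ) (n : ℕ) (s : ℂ) :
    (wilsonX c₄ c₅ a b c d n).eval (quadraticLattice c₄ c₅ s)
      = wilsonPoly n a b c d (-(s + c₅ / c₄ / 2) ^ 2) := by
  simp only [wilsonX, wilsonPoly, wilsonCoeff, eval_finsetSum, eval_mul, eval_C,
    wilsonBasisPoly_eval c₅ hc₄]
  exact Finset.sum_congr rfl fun k _ => by ring

theorem dualHahnX_eval (a b c : ℂ) (n : ℕ) (s : ℂ) :
    (dualHahnX c₄ c₅ a b c n).eval (quadraticLattice c₄ c₅ s)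
      = continuousDualHahn n a b c (-(s + c₅ / c₄ / 2) ^ 2) := by
  simp only [dualHahnX, continuousDualHahn, dualHahnCoeff, eval_finsetSum, eval_mul, eval_C,
    wilsonBasisPoly_eval c₅ hc₄]
  exact Finset.sum_congr rfl fun k _ => by ring

/-- The condition for full degree; `wilson_injective_iff` shows that it is also the condition for
distinct eigenvalues. -/
theorem wilsonX_coeff_ne_zero_iff (a b c d : ℂ) (n : ℕ) : (wilsonX c₄ c₅ a b c d n).coeff n ≠ 0 ↔
    risingFactorial (n + a + b + c + d - 1) n ≠ 0 := by
  rw [wilsonX, coeff_sum_of_natDegree_le (wilsonBasisPoly_natDegree c₅ c₄ a)]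
  have h1 := wilsonBasisPoly_coeff c₅ hc₄ a n
  have h2 := risingFactorial_neg_ne_zero n
  have h3 : (Nat.factorial n : ℂ) ≠ 0 := Nat.cast_ne_zero.mpr (Nat.factorial_ne_zero n)
  have h4 : ∀ b, risingFactorial b 0 = 1 := fun b => by simp [risingFactorial]
  simp [wilsonCoeff, h1, h2, h3, h4]

theorem dualHahnX_coeff_ne_zero (a b c : ℂ) (n : ℕ) : (dualHahnX c₄ c₅ a b c n).coeff n ≠ 0 := by
  rw [dualHahnX, coeff_sum_of_natDegree_le (wilsonBasisPoly_natDegree c₅ c₄ a)]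
  have h1 := wilsonBasisPoly_coeff c₅ hc₄ a n
  have h2 := risingFactorial_neg_ne_zero n
  have h3 : (Nat.factorial n : ℂ) ≠ 0 := Nat.cast_ne_zero.mpr (Nat.factorial_ne_zero n)
  have h4 : ∀ b, risingFactorial b 0 = 1 := fun b => by simp [risingFactorial]
  simp [dualHahnCoeff, h1, h2, h3, h4]

theorem wilsonX_eigen (l a b c d : ℂ) (n : ℕ) :
    (quadraticData c₄ c₅).op (quadraticPhi c₄ c₅ (l * (a * b * c * d))
        (l * (a * b + a * c + a * d + b * c + b * d + c * d)) l)
        (quadraticPsi c₄ c₅ (l * (a * b * c + a * b * d + a * c * d + b * c * d))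
          (l * (a + b + c + d))) (wilsonX c₄ c₅ a b c d n)
      = C ((quadraticData c₄ c₅).diag (quadraticPhi c₄ c₅ (l * (a * b * c * d))
        (l * (a * b + a * c + a * d + b * c + b * d + c * d)) l)
        (quadraticPsi c₄ c₅ (l * (a * b * c + a * b * d + a * c * d + b * c * d))
          (l * (a + b + c + d))) n) * wilsonX c₄ c₅ a b c d n := by
  have := wilson_eigen c₅ hc₄ a (l * (b * c * d)) (l * (b * c + b * d + c * d))
    (l * (b + c + d)) l n
    (wilsonCoeff n a b c d) fun k hk => by
      linear_combination l * wilsonCoeff_succ n a b c d hk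
  simp only [wilsonX]
  convert this using 4 <;> ring_nf

theorem dualHahnX_eigen (l a b c : ℂ) (n : ℕ) :
    (quadraticData c₄ c₅).op (quadraticPhi c₄ c₅ (l * (a * b * c)) (l * (a + b + c)) 0)
        (quadraticPsi c₄ c₅ (l * (a * b + a * c + b * c)) l) (dualHahnX c₄ c₅ a b c n)
      = C ((quadraticData c₄ c₅).diag (quadraticPhi c₄ c₅ (l * (a * b * c)) (l * (a + b + c)) 0)
        (quadraticPsi c₄ c₅ (l * (a * b + a * c + b * c)) l) n) * dualHahnX c₄ c₅ a b c n := by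
  have := wilson_eigen c₅ hc₄ a (l * (b * c)) (l * (b + c)) l 0 n
    (dualHahnCoeff n a b c) fun k hk => by
      linear_combination l * dualHahnCoeff_succ n a b c hk
  simp only [dualHahnX]
  convert this using 4 <;> ring_nf

/-- The m-th minus the n-th entry is l(m - n)(m + n + σ - 1), and for m < n the last factors are
those of (n + σ - 1)_n. -/
theorem wilson_injective_iff (f₀ f₁ f₂ l σ : ℂ) (hl : l ≠ 0) :
    Function.Injective ((quadraticData c₄ c₅).diag (quadraticPhi c₄ c₅ f₀ f₂ l)
      (quadraticPsi c₄ c₅ f₁ (l * σ))) ↔ ∀ n : ℕ, risingFactorial (n + σ - 1) n ≠ 0 := by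
  constructor
  · intro h n h0
    rw [risingFactorial_eq_prod, Finset.prod_eq_zero_iff] at h0
    obtain ⟨j, hj, h0⟩ := h0
    refine (Finset.mem_range.mp hj).ne (h ?_)
    rw [quadratic_diag c₅ hc₄, quadratic_diag c₅ hc₄]
    linear_combination l * (j - n) * h0
  · intro h
    have key : ∀ m n : ℕ, m < n → (quadraticData c₄ c₅).diag (quadraticPhi c₄ c₅ f₀ f₂ l)
        (quadraticPsi c₄ c₅ f₁ (l * σ)) m ≠ (quadraticData c₄ c₅).diag
        (quadraticPhi c₄ c₅ f₀ f₂ l) (quadraticPsi c₄ c₅ f₁ (l * σ)) n := by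
      intro m n hmn h0
      rw [quadratic_diag c₅ hc₄, quadratic_diag c₅ hc₄] at h0
      refine h n ?_
      rw [risingFactorial_eq_prod, Finset.prod_eq_zero_iff]
      refine ⟨m, Finset.mem_range.mpr hmn, ?_⟩
      have hne : (m : ℂ) - n ≠ 0 := sub_ne_zero.mpr (Nat.cast_injective.ne hmn.ne)
      refine mul_left_cancel₀ (mul_ne_zero hl hne) ?_
      linear_combination h0
    intro m n h0
    rcases lt_trichotomy m n with h1 | h1 | h1
    · exact absurd h0 (key m n h1)
    · exact h1
    · exact absurd h0.symm (key n m h1)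

theorem dualHahn_injective (f₀ f₁ f₂ l : ℂ) (hl : l ≠ 0) :
    Function.Injective ((quadraticData c₄ c₅).diag (quadraticPhi c₄ c₅ f₀ f₂ 0)
      (quadraticPsi c₄ c₅ f₁ l)) := by
  intro m n h
  rw [quadratic_diag c₅ hc₄, quadratic_diag c₅ hc₄] at h
  have : (m : ℂ) = n := mul_right_cancel₀ hl (by linear_combination h)
  exact_mod_cast this

theorem hasSturmLiouville_iff_isWilsonFamily {P : ℕ → ℂ[X]}
    (hP : ∀ n, (P n).degree = (n : WithBot ℕ)) :
    HasSturmLiouvilleEquation (quadraticLattice c₄ c₅) P ↔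
      IsWilsonFamily (c₅ / c₄) (quadraticLattice c₄ c₅) P := by
  have hx := quadraticData_isLattice c₅ hc₄
  simp only [IsWilsonFamily, ← wilsonX_eval c₅ hc₄, ← dualHahnX_eval c₅ hc₄]
  constructor
  · rw [hx.hasSturmLiouville_iff hP]
    rintro ⟨φ, ψ, hφ, hψ, hinj, h⟩
    obtain ⟨f₀, f₂, f₄, rfl⟩ := exists_quadraticPhi c₅ hc₄ hφ
    obtain ⟨f₁, f₃, rfl⟩ := exists_quadraticPsi c₅ hc₄ hψ
    by_cases h4 : f₄ = 0
    · subst h4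
      -- With f₃ = f₄ = 0 every diagonal entry would be zero, so f is exactly cubic here.
      have h3 : f₃ ≠ 0 := by
        rintro rfl
        refine zero_ne_one (hinj (a₁ := 0) (a₂ := 1) ?_)
        rw [quadratic_diag c₅ hc₄, quadratic_diag c₅ hc₄]
        simp
      obtain ⟨a, b, c, rfl, rfl, rfl⟩ := exists_cubic_factors f₃ f₂ f₁ f₀ h3
      right
      -- The factors of f are a + S with S = s + u/2, while the parameters of the family are offset
      -- by u/2.
      refine ⟨a - c₅ / c₄ / 2, b - c₅ / c₄ / 2, c - c₅ / c₄ / 2, ?_⟩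
      simp only [sub_add_cancel]
      exact hx.isMultipleOf_of_eigen hφ hψ hinj hP (dualHahnX_coeff_ne_zero c₅ hc₄ a b c) h
        (dualHahnX_eigen c₅ hc₄ f₃ a b c)
    · obtain ⟨a, b, c, d, rfl, rfl, rfl, rfl⟩ := exists_quartic_factors f₄ f₃ f₂ f₁ f₀ h4
      left
      refine ⟨a - c₅ / c₄ / 2, b - c₅ / c₄ / 2, c - c₅ / c₄ / 2, d - c₅ / c₄ / 2, ?_⟩
      simp only [sub_add_cancel]
      refine hx.isMultipleOf_of_eigen hφ hψ hinj hP (fun n => ?_) h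
        (wilsonX_eigen c₅ hc₄ f₄ a b c d)
      rw [wilsonX_coeff_ne_zero_iff c₅ hc₄]
      convert (wilson_injective_iff c₅ hc₄ _ _ _ _ _ h4).mp hinj n using 2
      ring
  · rintro (⟨a, b, c, d, h⟩ | ⟨a, b, c, h⟩)
    · refine hx.hasSturmLiouville_of_isMultipleOf (quadraticPhi_natDegree _ _ _ _ _)
        (quadraticPsi_natDegree _ _ _ _) hP (fun h0 => ?_) (wilsonX_eigen c₅ hc₄ 1 _ _ _ _) h
      rw [wilson_injective_iff c₅ hc₄ _ _ _ _ _ one_ne_zero]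
      intro n
      convert (wilsonX_coeff_ne_zero_iff c₅ hc₄ _ _ _ _ n).mp (h0 n) using 2
      ring
    · exact hx.hasSturmLiouville_of_isMultipleOf (quadraticPhi_natDegree _ _ _ _ _)
        (quadraticPsi_natDegree _ _ _ _) hP
        (fun _ => dualHahn_injective c₅ hc₄ _ _ _ _ one_ne_zero)
        (dualHahnX_eigen c₅ hc₄ 1 _ _ _) h

end QuadraticLattice

/-! ### The q-quadratic lattice and its difference operator. -/

section QLattice
open Polynomial

theorem qPoch_succ (a q : ℂ) (k : ℕ) : qPoch a q (k + 1) = qPoch a q k * (1 - a * q ^ k) := by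
  simp only [qPoch, Finset.prod_range_succ]

theorem qPoch_succ' (a q : ℂ) (k : ℕ) : qPoch a q (k + 1) = (1 - a) * qPoch (a * q) q k := by
  simp only [qPoch, Finset.prod_range_succ', pow_zero, mul_one]
  rw [mul_comm]
  congr 1
  exact Finset.prod_congr rfl fun j _ => by ring

theorem qPoch_shift (a q : ℂ) {n k : ℕ} (hk : k < n) : qPoch (a * q ^ k) q (n - k)
    = (1 - a * q ^ k) * qPoch (a * q ^ (k + 1)) q (n - (k + 1)) := by
  rw [show n - k = n - (k + 1) + 1 by omega, qPoch_succ', pow_succ, mul_assoc]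

theorem qPoch_self_ne_zero {q : ℂ} (hroot : ∀ k : ℕ, 0 < k → q ^ k ≠ 1) (k : ℕ) :
    qPoch q q k ≠ 0 := by
  rw [qPoch, Finset.prod_ne_zero_iff]
  intro j _ h
  refine hroot (j + 1) j.succ_pos ?_
  rw [pow_succ]
  linear_combination -h

theorem qPoch_inv_pow_ne_zero {q : ℂ} (hq : q ≠ 0) (hroot : ∀ k : ℕ, 0 < k → q ^ k ≠ 1) (n : ℕ) :
    qPoch (q ^ n)⁻¹ q n ≠ 0 := by
  rw [qPoch, Finset.prod_ne_zero_iff]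
  intro j hj h
  have hj := Finset.mem_range.mp hj
  refine hroot (n - j) (by omega) ?_
  have e : q ^ n = q ^ (n - j) * q ^ j := by rw [← pow_add]; congr 1; omega
  have h1 : q ^ j ≠ 0 := pow_ne_zero _ hq
  have h2 : q ^ n ≠ 0 := pow_ne_zero _ hq
  field_simp at h
  refine mul_right_cancel₀ h1 ?_
  rw [← e, one_mul]
  linear_combination h

theorem exists_half_add_inv (y : ℂ) : ∃ z : ℂ, z ≠ 0 ∧ (z + z⁻¹) / 2 = y := by
  obtain ⟨r, hr⟩ := IsAlgClosed.exists_pow_nat_eq (y ^ 2 - 1) (show 0 < 2 by norm_num)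
  have h : (y + r) * (y - r) = 1 := by linear_combination -hr
  refine ⟨y + r, left_ne_zero_of_mul_eq_one h, ?_⟩
  rw [inv_eq_of_mul_eq_one_right h]
  ring

theorem csqrt_sq (u : ℂ) : csqrt u ^ 2 = u := by
  rw [csqrt, ← Complex.cpow_mul_nat]
  norm_num

theorem csqrt_ne_zero {u : ℂ} (hu : u ≠ 0) : csqrt u ≠ 0 := fun h => hu (by
  rw [← csqrt_sq u, h]; ring)

theorem awBasis_eq (a q : ℂ) (k : ℕ) {z : ℂ} (hz : z ≠ 0) :
    awBasis a q k ((z + z⁻¹) / 2) = qPoch (a * z) q k * qPoch (a * z⁻¹) q k := by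
  rw [awBasis, qPoch, qPoch, ← Finset.prod_mul_distrib]
  refine Finset.prod_congr rfl fun j _ => ?_
  rw [pow_mul']
  field_simp
  ring

theorem awBasis_succ (a q : ℂ) (k : ℕ) (y : ℂ) :
    awBasis a q (k + 1) y = awBasis a q k y * (1 - 2 * a * y * q ^ k + (a * q ^ k) ^ 2) := by
  rw [awBasis, Finset.prod_range_succ, awBasis, mul_pow, ← pow_mul, mul_comm k]

/-- The q-analogue of `wilsonBasis_diff`: z → qz shifts (az; q)_{k+1} and (a/z; q)_{k+1} in opposite
directions, and 1 - az is the factor that f will supply. -/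
theorem awBasis_diff (a q : ℂ) (hq : q ≠ 0) (k : ℕ) {z : ℂ} (hz : z ≠ 0) :
    (1 - a * z) * (awBasis a q (k + 1) ((q * z + (q * z)⁻¹) / 2)
        - awBasis a q (k + 1) ((z + z⁻¹) / 2))
      = -((1 - q ^ (k + 1)) * (a / (q * z)) * (1 - q * z ^ 2) * (1 - a * z * q ^ k))
        * awBasis a q k ((z + z⁻¹) / 2) := by
  rw [awBasis_eq a q _ hz, awBasis_eq a q _ (mul_ne_zero hq hz), awBasis_eq a q _ hz]
  have e1 := qPoch_succ (a * (q * z)) q k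
  have e2 := qPoch_succ' (a * (q * z)⁻¹) q k
  have e3 := qPoch_succ (a * z) q k
  have e4 := qPoch_succ' (a * z) q k
  have e5 := qPoch_succ (a * z⁻¹) q k
  rw [show a * (q * z)⁻¹ * q = a * z⁻¹ by field_simp] at e2
  rw [show a * z * q = a * (q * z) by ring] at e4
  rw [e1, e2, e5, e3]
  have e6 : (1 - a * z) * qPoch (a * (q * z)) q k = qPoch (a * z) q k * (1 - a * z * q ^ k) := by
    rw [← e4, e3]
  have e7 : (1 - a * (q * z) * q ^ k) * (1 - a * (q * z)⁻¹) - (1 - a * z) * (1 - a * z⁻¹ * q ^ k)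
      = -((1 - q ^ (k + 1)) * (a / (q * z)) * (1 - q * z ^ 2)) := by
    field_simp
    ring
  linear_combination qPoch (a * z⁻¹) q k * (1 - a * (q * z) * q ^ k) * (1 - a * (q * z)⁻¹) * e6
    + qPoch (a * z⁻¹) q k * qPoch (a * z) q k * (1 - a * z * q ^ k) * e7

/-- The constants of the lattice `c₁ q^{-s} + c₂ q^s` for `q = p²`. -/
noncomputable def qData (p c₁ c₂ : ℂ) (hp : p ≠ 0) (hp4 : p ^ 4 ≠ 1) : LatticeData where
  α := (p + p⁻¹) / 2
  β := 0
  U := C (((p - p⁻¹) / 2) ^ 2) * (X ^ 2 - C (4 * c₁ * c₂))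
  γ n := (p ^ n - (p ^ n)⁻¹) / (p - p⁻¹)
  μ n := (p ^ n + (p ^ n)⁻¹) / 2
  -- The hypothesis p⁴ ≠ 1 serves twice: p² ≠ -1 gives α ≠ 0, and p² ≠ 1 makes the denominator p -
  -- p⁻¹ of `γ` nonzero.
  α_ne := by
    intro h
    refine hp4 ?_
    field_simp at h
    linear_combination (p ^ 2 - 1) * h
  U_natDegree := by compute_degree
  U_coeff := by
    rw [coeff_C_mul, coeff_sub, coeff_X_pow, coeff_C]
    norm_num
    field_simp
    ring
  γ_zero := by simp
  μ_zero := by norm_num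
  γ_succ n := by
    have h1 : p ^ n ≠ 0 := pow_ne_zero _ hp
    have h2 : p ^ 2 - 1 ≠ 0 := fun h => hp4 (by linear_combination (p ^ 2 + 1) * h)
    have h3 : p - p⁻¹ = (p ^ 2 - 1) / p := by field_simp
    rw [h3, pow_succ]
    field_simp
    ring
  μ_succ n := by
    have h1 : p ^ n ≠ 0 := pow_ne_zero _ hp
    have h2 : p ^ 2 - 1 ≠ 0 := fun h => hp4 (by linear_combination (p ^ 2 + 1) * h)
    have h3 : p - p⁻¹ = (p ^ 2 - 1) / p := by field_simp
    rw [h3, pow_succ]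
    field_simp
    ring

/-- The data of a `q`-quadratic lattice with `q` not a root of unity. -/
structure QLattice where
  q : ℂ
  c₁ : ℂ
  c₂ : ℂ
  q_ne : q ≠ 0
  root : ∀ k : ℕ, 0 < k → q ^ k ≠ 1
  c₁_ne : c₁ ≠ 0
  c₂_ne : c₂ ≠ 0

namespace QLattice
variable (Q : QLattice)

/-- The lattice function. -/
noncomputable def x : ℂ → ℂ := qQuadraticLattice Q.q Q.c₁ Q.c₂

/-- The principal square root of `q`. -/
noncomputable def p : ℂ := csqrt Q.q

/-- The square root of `c₂ / c₁`. -/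
noncomputable def r : ℂ := csqrt (Q.c₂ / Q.c₁)

/-- The scale `x / y`. -/
noncomputable def κ : ℂ := 2 * Q.c₁ * Q.r

/-- The exponential variable. -/
noncomputable def z (s : ℂ) : ℂ := Q.r * Q.q ^ s

theorem p_sq : Q.p ^ 2 = Q.q := csqrt_sq _
theorem p_ne : Q.p ≠ 0 := csqrt_ne_zero Q.q_ne
theorem r_sq : Q.r ^ 2 = Q.c₂ / Q.c₁ := csqrt_sq _
theorem r_ne : Q.r ≠ 0 := csqrt_ne_zero (div_ne_zero Q.c₂_ne Q.c₁_ne)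
theorem κ_ne : Q.κ ≠ 0 := mul_ne_zero (mul_ne_zero two_ne_zero Q.c₁_ne) Q.r_ne
theorem one_sub_q_ne : 1 - Q.q ≠ 0 := fun h => Q.root 1 one_pos (by linear_combination -h)
theorem p_pow_four : Q.p ^ 4 ≠ 1 := by
  rw [show Q.p ^ 4 = (Q.p ^ 2) ^ 2 by ring, p_sq]
  exact Q.root 2 two_pos
theorem κ_sq : Q.κ ^ 2 = 4 * Q.c₁ * Q.c₂ := by
  rw [κ, mul_pow, r_sq]
  have := Q.c₁_ne
  field_simp
  ring
theorem z_ne (s : ℂ) : Q.z s ≠ 0 :=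
  mul_ne_zero Q.r_ne (by rw [Ne, Complex.cpow_eq_zero_iff]; exact fun h => Q.q_ne h.1)

theorem awVariable_eq (s : ℂ) : awVariable Q.q (Q.c₂ / Q.c₁) s = (Q.z s + (Q.z s)⁻¹) / 2 := by
  rw [awVariable, z, mul_inv, Complex.cpow_neg, r]

/-- Shifting s multiplies z by powers of p or q, so identities on the lattice become identities
between rational functions of z. -/
theorem x_eq (s : ℂ) : Q.x s = Q.κ * ((Q.z s + (Q.z s)⁻¹) / 2) := by
  have h1 : Q.q ^ s ≠ 0 := by rw [Ne, Complex.cpow_eq_zero_iff]; exact fun h => Q.q_ne h.1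
  have h2 := Q.r_ne
  have h3 := Q.c₁_ne
  have h4 := Q.r_sq
  rw [x, qQuadraticLattice, z, κ, Complex.cpow_neg]
  field_simp at h4 ⊢
  linear_combination -(Q.q ^ s) ^ 2 * h4

theorem z_add_half (s : ℂ) : Q.z (s + 1 / 2) = Q.p * Q.z s := by
  rw [z, Complex.cpow_add _ _ Q.q_ne, z, p, csqrt]; ring

theorem z_sub_half (s : ℂ) : Q.z (s - 1 / 2) = Q.p⁻¹ * Q.z s := by
  rw [z, Complex.cpow_sub _ _ Q.q_ne, z, p, csqrt]; ring

theorem z_add_one (s : ℂ) : Q.z (s + 1) = Q.q * Q.z s := by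
  rw [z, Complex.cpow_add _ _ Q.q_ne, z, Complex.cpow_one]; ring

theorem z_sub_one (s : ℂ) : Q.z (s - 1) = Q.q⁻¹ * Q.z s := by
  rw [z, Complex.cpow_sub _ _ Q.q_ne, z, Complex.cpow_one]; ring

/-- The constants of the lattice. -/
noncomputable def data : LatticeData := qData Q.p Q.c₁ Q.c₂ Q.p_ne Q.p_pow_four

theorem x_half_sub (s : ℂ) : Q.x (s + 1 / 2) - Q.x (s - 1 / 2)
    = -(Q.κ * (1 - Q.q) / (2 * Q.p)) * (Q.z s ^ 2 - 1) / Q.z s := by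
  have h1 := Q.z_ne s
  have h2 := Q.p_ne
  rw [x_eq, x_eq, z_add_half, z_sub_half, ← Q.p_sq]
  field_simp
  ring

theorem x_add_one_sub (s : ℂ) : Q.x (s + 1) - Q.x s
    = Q.κ * (1 - Q.q) * (1 - Q.q * Q.z s ^ 2) / (2 * Q.q * Q.z s) := by
  have h1 := Q.z_ne s
  have h2 := Q.q_ne
  rw [x_eq, x_eq, z_add_one]
  field_simp
  ring

theorem x_sub_sub_one (s : ℂ) : Q.x s - Q.x (s - 1)
    = Q.κ * (1 - Q.q) * (Q.q - Q.z s ^ 2) / (2 * Q.q * Q.z s) := by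
  have h1 := Q.z_ne s
  have h2 := Q.q_ne
  rw [x_eq, x_eq, z_sub_one]
  field_simp
  ring

theorem x_surjective : Function.Surjective Q.x := by
  intro v
  obtain ⟨t, ht, hv⟩ := exists_half_add_inv (v / Q.κ)
  have hlog : Complex.log Q.q ≠ 0 := by
    intro h
    refine Q.root 1 one_pos ?_
    rw [pow_one, ← Complex.exp_log Q.q_ne, h, Complex.exp_zero]
  refine ⟨Complex.log (t / Q.r) / Complex.log Q.q, ?_⟩
  have : Q.z (Complex.log (t / Q.r) / Complex.log Q.q) = t := by
    rw [z, Complex.cpow_def_of_ne_zero Q.q_ne, mul_div_cancel₀ _ hlog,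
      Complex.exp_log (div_ne_zero ht Q.r_ne), mul_div_cancel₀ _ Q.r_ne]
  rw [x_eq, this, hv, mul_div_cancel₀ _ Q.κ_ne]

theorem regular_z {s : ℂ} (hs : RegularPoint Q.x s) :
    Q.z s ^ 2 - 1 ≠ 0 ∧ 1 - Q.q * Q.z s ^ 2 ≠ 0 ∧ Q.q - Q.z s ^ 2 ≠ 0 := by
  refine ⟨fun h => hs.1 ?_, fun h => hs.2.1 ?_, fun h => hs.2.2 ?_⟩ <;> rw [← sub_eq_zero]
  · rw [x_half_sub, h]; ring
  · rw [x_add_one_sub, h]; ring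
  · rw [x_sub_sub_one, h]; ring

theorem finite_sq_eq (a : ℂ) : {v : ℂ | v ^ 2 = a}.Finite := by
  obtain ⟨r, hr⟩ := IsAlgClosed.exists_pow_nat_eq a (show 0 < 2 by norm_num)
  refine Set.Finite.subset (s := {r, -r}) (by simp) fun v hv => ?_
  rw [Set.mem_ofPred_eq, ← hr, sq_eq_sq_iff_eq_or_eq_neg] at hv
  exact hv

theorem isLattice : Q.data.IsLattice Q.x where
  sum s := by
    have h1 := Q.z_ne s
    have h2 := Q.p_ne
    simp only [data, qData]
    rw [x_eq, x_eq, x_eq, z_add_half, z_sub_half]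
    field_simp
    ring
  sq s := by
    have h1 := Q.z_ne s
    have h2 := Q.p_ne
    simp only [data, qData, eval_mul, eval_sub, eval_pow, eval_X, eval_C]
    rw [x_half_sub, ← Q.κ_sq, x_eq, ← Q.p_sq]
    field_simp
    ring
  infinite := by
    refine infinite_image_of_surjective Q.x_surjective ?_
    -- The excluded s satisfy z² = 1, 1/q or q. There may be infinitely many of them, but x² = κ²(z²
    -- + 2 + z⁻²)/4 takes only two values on them.
    refine Set.Finite.subset ((finite_sq_eq (Q.κ ^ 2)).union
      (finite_sq_eq (Q.κ ^ 2 * (Q.q + 2 + Q.q⁻¹) / 4))) ?_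
    rintro _ ⟨s, hs, rfl⟩
    have h1 := Q.z_ne s
    have h2 := Q.q_ne
    have h3 := Q.κ_ne
    have h4 := Q.p_ne
    have h5 := Q.one_sub_q_ne
    simp only [Set.mem_compl_iff, Set.mem_ofPred_eq, RegularPoint, not_and_or, not_not] at hs
    simp only [Set.mem_union, Set.mem_ofPred_eq]
    rw [← sub_eq_zero, ← sub_eq_zero (a := Q.x (s + 1)), ← sub_eq_zero (a := Q.x s),
      x_half_sub, x_add_one_sub, x_sub_sub_one] at hs
    simp only [div_eq_zero_iff, mul_eq_zero, neg_eq_zero, h1, h2, h3, h4, h5, two_ne_zero,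
      or_false, false_or] at hs
    rw [x_eq]
    rcases hs with h | h | h
    · left
      field_simp
      linear_combination (Q.z s ^ 2 - 1) * h
    · right
      field_simp
      linear_combination 4 * (Q.q - Q.z s ^ 2) * h
    · right
      field_simp
      linear_combination 4 * (1 - Q.q * Q.z s ^ 2) * h

/-- The coefficient `φ` belonging to `f = f₀ + f₁ z + f₂ z² + f₃ z³ + f₄ z⁴`. -/
noncomputable def phi (f₀ f₁ f₂ f₃ f₄ : ℂ) : ℂ[X] :=
  C ((1 - Q.q) ^ 2 / (4 * Q.q * Q.p)) * (C (2 * (f₀ + f₄)) * X ^ 2 + C (Q.κ * (f₁ + f₃)) * X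
    + C (Q.κ ^ 2 * (f₂ - f₀ - f₄)))

/-- The coefficient `ψ` belonging to `f = f₀ + f₁ z + f₂ z² + f₃ z³ + f₄ z⁴`. -/
noncomputable def psi (f₀ f₁ f₃ f₄ : ℂ) : ℂ[X] :=
  C ((1 - Q.q) / Q.q) * (C (f₀ - f₄) * X + C (Q.κ * (f₁ - f₃) / 2))

theorem phi_natDegree (f₀ f₁ f₂ f₃ f₄ : ℂ) : (Q.phi f₀ f₁ f₂ f₃ f₄).natDegree ≤ 2 := by
  rw [phi]; compute_degree

theorem psi_natDegree (f₀ f₁ f₃ f₄ : ℂ) : (Q.psi f₀ f₁ f₃ f₄).natDegree ≤ 1 := by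
  rw [psi]; compute_degree

/-- φ sees f₀ + f₄, f₁ + f₃ and f₂, while ψ sees f₀ - f₄ and f₁ - f₃; this linear system is
inverted. -/
theorem exists_phi_psi {φ ψ : ℂ[X]} (hφ : φ.natDegree ≤ 2) (hψ : ψ.natDegree ≤ 1) :
    ∃ f₀ f₁ f₂ f₃ f₄, φ = Q.phi f₀ f₁ f₂ f₃ f₄ ∧ ψ = Q.psi f₀ f₁ f₃ f₄ := by
  have h1 := Q.q_ne
  have h2 := Q.p_ne
  have h3 := Q.κ_ne
  have h4 := Q.one_sub_q_ne
  set m : ℂ := (1 - Q.q) ^ 2 / (4 * Q.q * Q.p) with hm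
  set l : ℂ := (1 - Q.q) / Q.q with hl
  have m0 : m ≠ 0 := by
    rw [hm]
    exact div_ne_zero (pow_ne_zero _ h4) (mul_ne_zero (mul_ne_zero (by norm_num) h1) h2)
  have l0 : l ≠ 0 := div_ne_zero h4 h1
  refine ⟨φ.coeff 2 / (4 * m) + ψ.coeff 1 / (2 * l),
    φ.coeff 1 / (2 * Q.κ * m) + ψ.coeff 0 / (Q.κ * l),
    φ.coeff 0 / (Q.κ ^ 2 * m) + φ.coeff 2 / (2 * m),
    φ.coeff 1 / (2 * Q.κ * m) - ψ.coeff 0 / (Q.κ * l), φ.coeff 2 / (4 * m) - ψ.coeff 1 / (2 * l),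
    Polynomial.funext fun t => ?_, Polynomial.funext fun t => ?_⟩
  · conv_lhs => rw [φ.as_sum_range_C_mul_X_pow' (Nat.lt_succ_of_le hφ)]
    rw [phi, ← hm]
    clear_value m l
    simp only [Finset.sum_range_succ, Finset.sum_range_zero, eval_add, eval_mul, eval_C, eval_pow,
      eval_X, eval_zero]
    field_simp
    ring
  · conv_lhs => rw [ψ.as_sum_range_C_mul_X_pow' (Nat.lt_succ_of_le hψ)]
    rw [psi, ← hl]
    clear_value m l
    simp only [Finset.sum_range_succ, Finset.sum_range_zero, eval_add, eval_mul, eval_C, eval_pow,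
      eval_X, eval_zero]
    field_simp
    ring

/-- Only the extreme coefficients of f enter, so they alone decide whether the eigenvalues are
distinct. -/
theorem diag_eq (f₀ f₁ f₂ f₃ f₄ : ℂ) (n : ℕ) :
    Q.data.diag (Q.phi f₀ f₁ f₂ f₃ f₄) (Q.psi f₀ f₁ f₃ f₄) n
      = f₀ * ((Q.q ^ n)⁻¹ - 1) + f₄ * (Q.q ^ n - 1) * Q.q⁻¹ := by
  have h1 : (Q.phi f₀ f₁ f₂ f₃ f₄).coeff 2 = (1 - Q.q) ^ 2 / (4 * Q.q * Q.p) * (2 * (f₀ + f₄)) := by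
    rw [phi, coeff_C_mul]
    simp only [coeff_add, coeff_C_mul, coeff_X_pow, coeff_X, coeff_C]
    norm_num
  have h2 : (Q.psi f₀ f₁ f₃ f₄).coeff 1 = (1 - Q.q) / Q.q * (f₀ - f₄) := by
    rw [psi, coeff_C_mul]
    simp only [coeff_add, coeff_C_mul, coeff_X, coeff_C]
    norm_num
  rcases n with _ | n
  · simp [LatticeData.diag, data, qData]
  · simp only [LatticeData.diag, h1, h2, data, qData, Nat.add_sub_cancel]
    rw [← Q.p_sq, show (Q.p ^ 2) ^ (n + 1) = (Q.p ^ n * Q.p) ^ 2 by ring,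
      pow_succ Q.p n]
    have h3 : Q.p ^ n ≠ 0 := pow_ne_zero _ Q.p_ne
    have h4 := Q.p_ne
    have h5 : Q.p ^ 2 - 1 ≠ 0 := fun h => Q.p_pow_four (by linear_combination (Q.p ^ 2 + 1) * h)
    rw [show Q.p - Q.p⁻¹ = (Q.p ^ 2 - 1) / Q.p by field_simp]
    generalize Q.p ^ n = t at *
    generalize Q.p = p at *
    field_simp
    ring

/-- The normal form in terms of f: the backward coefficient is the forward one with z replaced by
1/z, reflecting the invariance of x under this inversion. -/
theorem op_eval (f₀ f₁ f₂ f₃ f₄ : ℂ) (P : ℂ[X]) {s : ℂ} (hs : RegularPoint Q.x s) :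
    (Q.data.op (Q.phi f₀ f₁ f₂ f₃ f₄) (Q.psi f₀ f₁ f₃ f₄) P).eval (Q.x s)
      = (f₀ + f₁ * Q.z s + f₂ * Q.z s ^ 2 + f₃ * Q.z s ^ 3 + f₄ * Q.z s ^ 4)
          / ((1 - Q.z s ^ 2) * (1 - Q.q * Q.z s ^ 2)) * (P.eval (Q.x (s + 1)) - P.eval (Q.x s))
        + (f₀ + f₁ * (Q.z s)⁻¹ + f₂ * (Q.z s)⁻¹ ^ 2 + f₃ * (Q.z s)⁻¹ ^ 3 + f₄ * (Q.z s)⁻¹ ^ 4)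
          / ((1 - (Q.z s)⁻¹ ^ 2) * (1 - Q.q * (Q.z s)⁻¹ ^ 2))
          * (P.eval (Q.x (s - 1)) - P.eval (Q.x s)) := by
  obtain ⟨n1, n2, n3⟩ := Q.regular_z hs
  have h1 := Q.q_ne
  have h2 := Q.p_ne
  have h3 := Q.κ_ne
  have h4 := Q.one_sub_q_ne
  have h5 := Q.z_ne s
  rw [Q.isLattice.op_eval _ _ _ hs, x_half_sub, x_add_one_sub, x_sub_sub_one]
  simp only [phi, psi, eval_add, eval_mul, eval_C, eval_pow, eval_X]
  generalize P.eval (Q.x (s + 1)) - P.eval (Q.x s) = P₁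
  generalize P.eval (Q.x (s - 1)) - P.eval (Q.x s) = P₂
  rw [x_eq]
  generalize Q.z s = z at *
  generalize Q.κ = κ at *
  have hp := Q.p_sq
  generalize Q.p = p at *
  generalize Q.q = q at *
  have n4 : 1 - z ^ 2 ≠ 0 := fun h => n1 (by linear_combination -h)
  have e1 : 1 - z⁻¹ ^ 2 = (z ^ 2 - 1) / z ^ 2 := by field_simp
  have e2 : 1 - q * z⁻¹ ^ 2 = -(q - z ^ 2) / z ^ 2 := by field_simp; ring
  rw [e1, e2]
  congr 2
  · field_simp
    ring
  · field_simp
    ring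

end QLattice
end QLattice

/-! ### Continuous q-Hermite polynomials and the action on the Askey–Wilson basis. -/

section QBases
open Polynomial

theorem q_zpow_neg (q : ℂ) (n : ℕ) : q ^ (-(n : ℤ)) = (q ^ n)⁻¹ := by
  rw [zpow_neg, zpow_natCast]

theorem q_zpow_sub_one {q : ℂ} (hq : q ≠ 0) (n : ℕ) : q ^ ((n : ℤ) - 1) = q ^ n * q⁻¹ := by
  rw [zpow_sub_one₀ hq, zpow_natCast]

/-- The Rogers–Szegő polynomials. -/
noncomputable def rogersSzego (q : ℂ) (n : ℕ) (x : ℂ) : ℂ :=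
  ∑ k ∈ Finset.range (n + 1), qPoch q q n / (qPoch q q k * qPoch q q (n - k)) * x ^ k

theorem rogersSzego_zero (q x : ℂ) : rogersSzego q 0 x = 1 := by
  simp [rogersSzego, qPoch]

/-- A q-Pascal rule, from 1 - q^{n+1} = q^k(1 - q^{n+1-k}) + (1 - q^k). -/
theorem rogersSzego_succ {q : ℂ} (hroot : ∀ k : ℕ, 0 < k → q ^ k ≠ 1) (n : ℕ) (x : ℂ) :
    rogersSzego q (n + 1) x = rogersSzego q n (q * x) + x * rogersSzego q n x := by
  have h0 := qPoch_self_ne_zero hroot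
  have hs : ∀ k, qPoch q q (k + 1) = qPoch q q k * (1 - q ^ (k + 1)) := fun k => by
    rw [qPoch_succ, pow_succ']
  have h1 : rogersSzego q (n + 1) x
      = ∑ k ∈ Finset.range (n + 1 + 1), qPoch q q n / (qPoch q q k * qPoch q q (n + 1 - k))
          * (q ^ k * (1 - q ^ (n + 1 - k))) * x ^ k
        + ∑ k ∈ Finset.range (n + 1 + 1), qPoch q q n / (qPoch q q k * qPoch q q (n + 1 - k))
          * (1 - q ^ k) * x ^ k := by
    rw [rogersSzego, ← Finset.sum_add_distrib]
    refine Finset.sum_congr rfl fun k hk => ?_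
    have hk := Finset.mem_range.mp hk
    have e : q ^ (n + 1) = q ^ k * q ^ (n + 1 - k) := by rw [← pow_add]; congr 1; omega
    rw [hs n, e]
    ring
  rw [h1, Finset.sum_range_succ, Finset.sum_range_succ' _ (n + 1)]
  simp only [Nat.sub_self, pow_zero, sub_self, mul_zero, zero_mul, add_zero]
  rw [rogersSzego, rogersSzego, Finset.mul_sum]
  congr 1
  · refine Finset.sum_congr rfl fun k hk => ?_
    have hk := Finset.mem_range.mp hk
    have e : n + 1 - k = n - k + 1 := by omega
    have h2 := h0 (n + 1 - k)
    rw [e, hs] at h2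
    rw [e, hs]
    have h3 := right_ne_zero_of_mul h2
    have h4 := h0 k
    have h5 := h0 (n - k)
    rw [mul_pow]
    field_simp
  · refine Finset.sum_congr rfl fun k hk => ?_
    have h2 := h0 (k + 1)
    rw [hs] at h2
    rw [hs, Nat.add_sub_add_right]
    have h3 := right_ne_zero_of_mul h2
    have h4 := h0 k
    have h5 := h0 (n - k)
    rw [pow_succ' x]
    field_simp

/-- The companion q-Pascal rule, reaching x/q instead of qx. Eliminating shifted arguments between
the two rules gives the three-term recurrence. -/
theorem rogersSzego_succ' {q : ℂ} (hq : q ≠ 0) (hroot : ∀ k : ℕ, 0 < k → q ^ k ≠ 1) (n : ℕ)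
    (x : ℂ) : rogersSzego q (n + 1) x
      = rogersSzego q n x + x * q ^ n * rogersSzego q n (x / q) := by
  induction n generalizing x with
  | zero => simp [rogersSzego_succ hroot, rogersSzego_zero]
  | succ n ih =>
    have h1 := rogersSzego_succ hroot (n + 1) x
    have h2 := ih (q * x)
    have h3 := rogersSzego_succ hroot n (x / q)
    rw [mul_div_cancel_left₀ _ hq] at h2
    rw [mul_div_cancel₀ _ hq] at h3
    rw [h1, h2, h3]
    have h4 := ih x
    have h5 := rogersSzego_succ hroot n x
    have e : x * q ^ (n + 1) * (x / q * rogersSzego q n (x / q))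
        = x * (x * q ^ n * rogersSzego q n (x / q)) := by
      rw [pow_succ]
      field_simp
    linear_combination x * h4 - h5 - e

theorem rogersSzego_add_two {q : ℂ} (hq : q ≠ 0) (hroot : ∀ k : ℕ, 0 < k → q ^ k ≠ 1) (n : ℕ)
    (x : ℂ) : rogersSzego q (n + 2) x
      = (1 + x) * rogersSzego q (n + 1) x - (1 - q ^ (n + 1)) * x * rogersSzego q n x := by
  have h1 := rogersSzego_succ' hq hroot (n + 1) x
  have h2 := rogersSzego_succ hroot n (x / q)
  have h3 := rogersSzego_succ' hq hroot n x
  rw [mul_div_cancel₀ _ hq] at h2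
  rw [h2] at h1
  rw [h1, pow_succ]
  have e : x * (q ^ n * q) * (x / q * rogersSzego q n (x / q))
      = x * (x * q ^ n * rogersSzego q n (x / q)) := by field_simp
  linear_combination e - x * h3

theorem chebyshev_eval_half (m : ℤ) {z : ℂ} (hz : z ≠ 0) :
    (Chebyshev.T ℂ m).eval ((z + z⁻¹) / 2) = (z ^ m + z ^ (-m)) / 2 := by
  have e1 : Complex.exp (-Complex.I * Complex.log z * Complex.I) = z := by
    rw [show -Complex.I * Complex.log z * Complex.I = Complex.log z by
      linear_combination -Complex.log z * Complex.I_sq, Complex.exp_log hz]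
  have e : Complex.cos (-Complex.I * Complex.log z) = (z + z⁻¹) / 2 := by
    rw [Complex.cos, neg_mul (-Complex.I * Complex.log z), Complex.exp_neg, e1]
  rw [← e, Chebyshev.T_complex_cos, Complex.cos]
  rw [show (m : ℂ) * (-Complex.I * Complex.log z) * Complex.I
      = m * (-Complex.I * Complex.log z * Complex.I) by ring,
    show -((m : ℂ) * (-Complex.I * Complex.log z)) * Complex.I
      = -(m * (-Complex.I * Complex.log z * Complex.I)) by ring, Complex.exp_neg,
    Complex.exp_int_mul, e1, zpow_neg]

theorem continuousQHermite_eval (r : ℂ) (n : ℕ) {z : ℂ} (hz : z ≠ 0) :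
    continuousQHermite r n ((z + z⁻¹) / 2) = z ^ n * rogersSzego r n (z⁻¹ ^ 2) := by
  have h1 : ∑ k ∈ Finset.range (n + 1), qPoch r r n / (qPoch r r k * qPoch r r (n - k))
      * z ^ ((n : ℤ) - 2 * k) = z ^ n * rogersSzego r n (z⁻¹ ^ 2) := by
    rw [rogersSzego, Finset.mul_sum]
    refine Finset.sum_congr rfl fun k _ => ?_
    rw [zpow_sub₀ hz, zpow_natCast, zpow_mul, zpow_natCast, ← pow_mul, inv_pow, pow_mul,
      show z ^ (2 : ℤ) = z ^ 2 from zpow_natCast z 2]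
    ring
  have h2 : ∑ k ∈ Finset.range (n + 1), qPoch r r n / (qPoch r r k * qPoch r r (n - k))
      * z ^ (-((n : ℤ) - 2 * k)) = z ^ n * rogersSzego r n (z⁻¹ ^ 2) := by
    -- The q-binomial coefficients are symmetric under k → n - k, so both exponentials of the cosine
    -- contribute the same sum.
    rw [← h1, ← Finset.sum_range_reflect]
    refine Finset.sum_congr rfl fun k hk => ?_
    have hk := Finset.mem_range.mp hk
    have e : n + 1 - 1 - k = n - k := by omega
    rw [e, Nat.sub_sub_self (by omega), mul_comm (qPoch r r (n - k))]
    congr 2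
    rw [Nat.cast_sub (by omega)]
    ring
  rw [continuousQHermite]
  simp only [chebyshev_eval_half _ hz]
  calc _ = (∑ k ∈ Finset.range (n + 1), qPoch r r n / (qPoch r r k * qPoch r r (n - k))
      * z ^ ((n : ℤ) - 2 * k) + ∑ k ∈ Finset.range (n + 1),
        qPoch r r n / (qPoch r r k * qPoch r r (n - k)) * z ^ (-((n : ℤ) - 2 * k))) / 2 := by
        rw [← Finset.sum_add_distrib, Finset.sum_div]
        exact Finset.sum_congr rfl fun k _ => by ring
    _ = _ := by rw [h1, h2]; ring

/-- The three-term recurrence of the continuous `q`-Hermite polynomials. -/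
theorem continuousQHermite_add_two {r : ℂ} (hr : r ≠ 0) (hroot : ∀ k : ℕ, 0 < k → r ^ k ≠ 1)
    (n : ℕ) (y : ℂ) : continuousQHermite r (n + 2) y
      = 2 * y * continuousQHermite r (n + 1) y - (1 - r ^ (n + 1)) * continuousQHermite r n y := by
  obtain ⟨z, hz, rfl⟩ := exists_half_add_inv y
  simp only [continuousQHermite_eval r _ hz, rogersSzego_add_two hr hroot]
  field_simp
  ring

/-- For constant f no factor 1 - az with a ≠ 0 is available. With X = z⁻², the shifts z → qz and z →
z/q lead to Rogers–Szegő values at X/q² and q²X. The recursions express both through the values of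
index n and n + 1 at X, after which the identity is rational. -/
theorem continuousQHermite_eigen {q : ℂ} (hq : q ≠ 0) (hroot : ∀ k : ℕ, 0 < k → q ^ k ≠ 1)
    (n : ℕ) {z : ℂ} (hz : z ≠ 0) (n1 : z ^ 2 - 1 ≠ 0) (n2 : 1 - q * z ^ 2 ≠ 0)
    (n3 : q - z ^ 2 ≠ 0) :
    1 / ((1 - z ^ 2) * (1 - q * z ^ 2)) * (continuousQHermite q n ((q * z + (q * z)⁻¹) / 2)
        - continuousQHermite q n ((z + z⁻¹) / 2))
      + 1 / ((1 - z⁻¹ ^ 2) * (1 - q * z⁻¹ ^ 2))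
        * (continuousQHermite q n ((q⁻¹ * z + (q⁻¹ * z)⁻¹) / 2)
        - continuousQHermite q n ((z + z⁻¹) / 2))
      = ((q ^ n)⁻¹ - 1) * continuousQHermite q n ((z + z⁻¹) / 2) := by
  rw [continuousQHermite_eval q n hz, continuousQHermite_eval q n (mul_ne_zero hq hz),
    continuousQHermite_eval q n (mul_ne_zero (inv_ne_zero hq) hz)]
  have h1 := rogersSzego_succ hroot n (q * z⁻¹ ^ 2)
  have h2 := rogersSzego_succ hroot n (z⁻¹ ^ 2)
  have h3 := rogersSzego_succ hroot (n + 1) (z⁻¹ ^ 2)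
  have h4 := rogersSzego_succ' hq hroot n (z⁻¹ ^ 2)
  have h5 := rogersSzego_succ' hq hroot n (z⁻¹ ^ 2 / q)
  have h6 := rogersSzego_succ' hq hroot (n + 1) (z⁻¹ ^ 2)
  have h7 : rogersSzego q (n + 1 + 1) (z⁻¹ ^ 2) = _ := rogersSzego_add_two hq hroot n (z⁻¹ ^ 2)
  rw [show (q * z)⁻¹ ^ 2 = z⁻¹ ^ 2 / q / q by field_simp,
    show (q⁻¹ * z)⁻¹ ^ 2 = q * (q * z⁻¹ ^ 2) by field_simp]
  have ht : q ^ n ≠ 0 := pow_ne_zero n hq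
  rw [pow_succ q] at h6 h7
  have hu : rogersSzego q n (q * (q * z⁻¹ ^ 2)) = rogersSzego q (n + 1 + 1) (z⁻¹ ^ 2)
      - z⁻¹ ^ 2 * rogersSzego q (n + 1) (z⁻¹ ^ 2) - q * z⁻¹ ^ 2 * (rogersSzego q (n + 1) (z⁻¹ ^ 2)
        - z⁻¹ ^ 2 * rogersSzego q n (z⁻¹ ^ 2)) := by
    linear_combination -h1 - h3 + q * z⁻¹ ^ 2 * h2
  have hv : rogersSzego q n (z⁻¹ ^ 2 / q / q) = (rogersSzego q (n + 1 + 1) (z⁻¹ ^ 2)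
      - rogersSzego q (n + 1) (z⁻¹ ^ 2) - q * (rogersSzego q (n + 1) (z⁻¹ ^ 2)
        - rogersSzego q n (z⁻¹ ^ 2))) / ((z⁻¹ ^ 2) ^ 2 * (q ^ n) ^ 2) := by
    have hX : z⁻¹ ^ 2 ≠ 0 := pow_ne_zero 2 (inv_ne_zero hz)
    rw [eq_div_iff (mul_ne_zero (pow_ne_zero 2 hX) (pow_ne_zero 2 ht))]
    rw [h5] at h6
    have e : z⁻¹ ^ 2 * (q ^ n * q) * (z⁻¹ ^ 2 / q * q ^ n * rogersSzego q n (z⁻¹ ^ 2 / q / q))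
        = rogersSzego q n (z⁻¹ ^ 2 / q / q) * ((z⁻¹ ^ 2) ^ 2 * (q ^ n) ^ 2) := by
      field_simp
    linear_combination -e - h6 + q * h4
  rw [hu, hv, h7, mul_pow, mul_pow, inv_pow q]
  clear hu hv h1 h2 h3 h4 h5 h6 h7
  generalize rogersSzego q n (z⁻¹ ^ 2) = a
  generalize rogersSzego q (n + 1) (z⁻¹ ^ 2) = b
  have e1 : 1 - z⁻¹ ^ 2 = (z ^ 2 - 1) / z ^ 2 := by field_simp
  have e2 : 1 - q * z⁻¹ ^ 2 = -(q - z ^ 2) / z ^ 2 := by field_simp; ring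
  have n4 : 1 - z ^ 2 ≠ 0 := fun h => n1 (by linear_combination -h)
  have hw : z ^ n ≠ 0 := pow_ne_zero n hz
  rw [e1, e2]
  generalize q ^ n = t at *
  generalize z ^ n = w at *
  have n2' : 1 - z ^ 2 * q ≠ 0 := by rwa [mul_comm]
  rw [show (1 - z ^ 2) = -(z ^ 2 - 1) by ring]
  field_simp
  ring

/-- The continuous `q`-Hermite polynomials as polynomials in `y = t x`. -/
noncomputable def hermitePoly (t r : ℂ) : ℕ → ℂ[X]
  | 0 => 1
  | 1 => C (2 * t) * X
  | n + 2 => C (2 * t) * X * hermitePoly t r (n + 1) - C (1 - r ^ (n + 1)) * hermitePoly t r n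

theorem hermitePoly_eval (t : ℂ) {r : ℂ} (hr : r ≠ 0) (hroot : ∀ k : ℕ, 0 < k → r ^ k ≠ 1) (x : ℂ) :
    ∀ n, (hermitePoly t r n).eval x = continuousQHermite r n (t * x)
  | 0 => by simp [hermitePoly, continuousQHermite, qPoch]
  | 1 => by
    obtain ⟨z, hz, hy⟩ := exists_half_add_inv (t * x)
    rw [← hy, continuousQHermite_eval r 1 hz, rogersSzego_succ hroot, rogersSzego_zero,
      rogersSzego_zero, hermitePoly]
    simp only [eval_mul, eval_C, eval_X]
    field_simp at hy ⊢
    linear_combination -hy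
  | n + 2 => by
    rw [continuousQHermite_add_two hr hroot, ← hermitePoly_eval t hr hroot x n,
      ← hermitePoly_eval t hr hroot x (n + 1), hermitePoly]
    simp only [eval_mul, eval_C, eval_X, eval_sub]
    ring

theorem hermitePoly_natDegree (t r : ℂ) :
    ∀ n, (hermitePoly t r n).natDegree ≤ n ∧ (hermitePoly t r n).coeff n = (2 * t) ^ n
  | 0 => by simp [hermitePoly]
  | 1 => by
    refine ⟨(natDegree_C_mul_le _ _).trans natDegree_X_le, ?_⟩
    simp [hermitePoly]
  | n + 2 => by
    obtain ⟨h1, h2⟩ := hermitePoly_natDegree t r (n + 1)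
    have h3 := (hermitePoly_natDegree t r n).1
    obtain ⟨h4, h5⟩ := natDegree_mul_le_and_coeff
      ((natDegree_C_mul_le (2 * t) X).trans natDegree_X_le) h1
      (show 1 + (n + 1) = n + 2 by ring)
    have h6 : (C (1 - r ^ (n + 1)) * hermitePoly t r n).natDegree ≤ n :=
      (natDegree_C_mul_le _ _).trans h3
    rw [hermitePoly]
    refine ⟨(natDegree_sub_le_iff_left (h6.trans (by omega))).mpr h4, ?_⟩
    rw [coeff_sub, h5, h2, coeff_eq_zero_of_natDegree_lt (h6.trans_lt (by omega))]
    simp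
    ring

/-- `awBasis a q k (t x)` as a polynomial in `x`. -/
noncomputable def awBasisPoly (t a q : ℂ) (k : ℕ) : ℂ[X] :=
  ∏ j ∈ Finset.range k, (C (1 + a ^ 2 * q ^ (2 * j)) + C (-2 * a * t * q ^ j) * X)

theorem awBasisPoly_eval (t a q : ℂ) (k : ℕ) (x : ℂ) :
    (awBasisPoly t a q k).eval x = awBasis a q k (t * x) := by
  rw [awBasisPoly, awBasis, eval_prod]
  refine Finset.prod_congr rfl fun j _ => ?_
  simp only [eval_add, eval_mul, eval_C, eval_X]
  ring

namespace QLattice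
variable (Q : QLattice)

theorem κ_inv_mul_x (s : ℂ) : Q.κ⁻¹ * Q.x s = (Q.z s + (Q.z s)⁻¹) / 2 := by
  rw [x_eq, inv_mul_cancel_left₀ Q.κ_ne]

/-- Here f(z) = (1 - az) g(z) with g cubic; as on the quadratic lattice the operator is bidiagonal,
and the lower entry is a multiple of g(aq^k). -/
theorem op_awBasis (a g₀ g₁ g₂ g₃ : ℂ) (k : ℕ) :
    Q.data.op (Q.phi g₀ (g₁ - a * g₀) (g₂ - a * g₁) (g₃ - a * g₂) (-(a * g₃)))
        (Q.psi g₀ (g₁ - a * g₀) (g₃ - a * g₂) (-(a * g₃))) (awBasisPoly Q.κ⁻¹ a Q.q (k + 1))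
      = C (((Q.q ^ (k + 1))⁻¹ - 1) * (g₀ + a * Q.q ^ k * g₃)) * awBasisPoly Q.κ⁻¹ a Q.q (k + 1)
        - C (((Q.q ^ (k + 1))⁻¹ - 1) * (g₀ + g₁ * (a * Q.q ^ k) + g₂ * (a * Q.q ^ k) ^ 2
          + g₃ * (a * Q.q ^ k) ^ 3)) * awBasisPoly Q.κ⁻¹ a Q.q k := by
  refine Q.isLattice.poly_ext fun s hs => ?_
  obtain ⟨n1, n2, n3⟩ := Q.regular_z hs
  rw [Q.op_eval _ _ _ _ _ _ hs]
  simp only [eval_sub, eval_mul, eval_C, awBasisPoly_eval, κ_inv_mul_x, z_add_one, z_sub_one]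
  have hz := Q.z_ne s
  have hq := Q.q_ne
  generalize Q.z s = z at *
  generalize Q.q = q at *
  have d1 := awBasis_diff a q hq k hz
  have d2 := awBasis_diff a q hq k (inv_ne_zero hz)
  rw [inv_inv, add_comm z⁻¹ z, show q * z⁻¹ + (q * z⁻¹)⁻¹ = q⁻¹ * z + (q⁻¹ * z)⁻¹ by
    rw [mul_inv, mul_inv, inv_inv, inv_inv, add_comm]] at d2
  have e := awBasis_succ a q k ((z + z⁻¹) / 2)
  have r1 : g₀ + (g₁ - a * g₀) * z + (g₂ - a * g₁) * z ^ 2 + (g₃ - a * g₂) * z ^ 3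
      + -(a * g₃) * z ^ 4 = (g₀ + g₁ * z + g₂ * z ^ 2 + g₃ * z ^ 3) * (1 - a * z) := by ring
  have r2 : g₀ + (g₁ - a * g₀) * z⁻¹ + (g₂ - a * g₁) * z⁻¹ ^ 2 + (g₃ - a * g₂) * z⁻¹ ^ 3
      + -(a * g₃) * z⁻¹ ^ 4
      = (g₀ + g₁ * z⁻¹ + g₂ * z⁻¹ ^ 2 + g₃ * z⁻¹ ^ 3) * (1 - a * z⁻¹) := by ring
  have r3 : ∀ f g h D : ℂ, f * g / h * D = f / h * (g * D) := fun _ _ _ _ => by ring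
  rw [r1, r2, r3 _ (1 - a * z), r3 _ (1 - a * z⁻¹), d1, d2, e]
  generalize awBasis a q k ((z + z⁻¹) / 2) = W
  have ht : q ^ k ≠ 0 := pow_ne_zero k hq
  rw [pow_succ q]
  clear d1 d2 e r1 r2 r3 hs
  generalize q ^ k = t at *
  have e1 : 1 - z⁻¹ ^ 2 = (z ^ 2 - 1) / z ^ 2 := by field_simp
  have e2 : 1 - q * z⁻¹ ^ 2 = -(q - z ^ 2) / z ^ 2 := by field_simp; ring
  have e3 : 1 - z ^ 2 = -(z ^ 2 - 1) := by ring
  have t1 : ∀ f c d y : ℂ, f / ((1 - z ^ 2) * (1 - q * z ^ 2))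
      * (-(c * d * (1 - q * z ^ 2) * y) * W)
      = f * c * d * y * W / (z ^ 2 - 1) := fun f c d y => by
    rw [e3, div_mul_eq_mul_div, div_eq_div_iff (mul_ne_zero (neg_ne_zero.mpr n1) n2) n1]
    ring
  have t2 : ∀ f c d y : ℂ, f / ((1 - z⁻¹ ^ 2) * (1 - q * z⁻¹ ^ 2))
      * (-(c * d * (1 - q * z⁻¹ ^ 2) * y) * W)
      = -(f * c * d * y * W * z ^ 2) / (z ^ 2 - 1) := fun f c d y => by
    rw [e1, e2]
    field_simp
  rw [t1, t2]
  field_simp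
  ring

/-- Sums over the Askey–Wilson basis which solve the Sturm–Liouville equation. -/
theorem aw_eigen (a g₀ g₁ g₂ g₃ : ℂ) (n : ℕ) (c : ℕ → ℂ)
    (hc : ∀ k < n, c k * (g₀ * ((Q.q ^ k)⁻¹ - (Q.q ^ n)⁻¹) + a * g₃ * (Q.q ^ n - Q.q ^ k) * Q.q⁻¹)
      = c (k + 1) * (((Q.q ^ (k + 1))⁻¹ - 1) * (g₀ + g₁ * (a * Q.q ^ k) + g₂ * (a * Q.q ^ k) ^ 2
          + g₃ * (a * Q.q ^ k) ^ 3))) :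
    Q.data.op (Q.phi g₀ (g₁ - a * g₀) (g₂ - a * g₁) (g₃ - a * g₂) (-(a * g₃)))
        (Q.psi g₀ (g₁ - a * g₀) (g₃ - a * g₂) (-(a * g₃)))
        (∑ k ∈ Finset.range (n + 1), C (c k) * awBasisPoly Q.κ⁻¹ a Q.q k)
      = C (Q.data.diag (Q.phi g₀ (g₁ - a * g₀) (g₂ - a * g₁) (g₃ - a * g₂) (-(a * g₃)))
        (Q.psi g₀ (g₁ - a * g₀) (g₃ - a * g₂) (-(a * g₃))) n)
        * ∑ k ∈ Finset.range (n + 1), C (c k) * awBasisPoly Q.κ⁻¹ a Q.q k := by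
  refine LatticeData.bidiagonal_eigen _ (awBasisPoly Q.κ⁻¹ a Q.q) _
    (fun k => ((Q.q ^ (k + 1))⁻¹ - 1) * (g₀ + g₁ * (a * Q.q ^ k) + g₂ * (a * Q.q ^ k) ^ 2
          + g₃ * (a * Q.q ^ k) ^ 3)) ?_ ?_ n c fun k hk => ?_
  · have : awBasisPoly Q.κ⁻¹ a Q.q 0 = C 1 := by simp [awBasisPoly]
    rw [this, LatticeData.op_apply, LatticeData.D_C, diag_eq]
    simp
  · intro k
    rw [op_awBasis, diag_eq]
    congr 3
    have h1 := Q.q_ne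
    have h2 : Q.q ^ k ≠ 0 := pow_ne_zero k h1
    rw [pow_succ]
    field_simp
    ring
  · rw [← hc k hk, diag_eq, diag_eq]
    ring

theorem hermite_eigen (l : ℂ) (n : ℕ) :
    Q.data.op (Q.phi l 0 0 0 0) (Q.psi l 0 0 0) (hermitePoly Q.κ⁻¹ Q.q n)
      = C (Q.data.diag (Q.phi l 0 0 0 0) (Q.psi l 0 0 0) n) * hermitePoly Q.κ⁻¹ Q.q n := by
  refine Q.isLattice.poly_ext fun s hs => ?_
  obtain ⟨n1, n2, n3⟩ := Q.regular_z hs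
  have h := continuousQHermite_eigen Q.q_ne Q.root n (Q.z_ne s) n1 n2 n3
  rw [Q.op_eval _ _ _ _ _ _ hs, diag_eq]
  simp only [eval_mul, eval_C, hermitePoly_eval _ Q.q_ne Q.root, κ_inv_mul_x, z_add_one, z_sub_one]
  linear_combination l * h

theorem inv_root {q : ℂ} (hroot : ∀ k : ℕ, 0 < k → q ^ k ≠ 1) (k : ℕ) (hk : 0 < k) :
    q⁻¹ ^ k ≠ 1 := by
  rw [inv_pow, Ne, inv_eq_one]
  exact hroot k hk

/-- Because z⁴/((1 - z²)(1 - qz²)) = q⁻¹/((1 - z⁻²)(1 - q⁻¹z⁻²)), the case f = l z⁴ in base q is the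
constant case in base q⁻¹, with the two shifts exchanged. -/
theorem hermite_inv_eigen (l : ℂ) (n : ℕ) :
    Q.data.op (Q.phi 0 0 0 0 l) (Q.psi 0 0 0 l) (hermitePoly Q.κ⁻¹ Q.q⁻¹ n)
      = C (Q.data.diag (Q.phi 0 0 0 0 l) (Q.psi 0 0 0 l) n) * hermitePoly Q.κ⁻¹ Q.q⁻¹ n := by
  refine Q.isLattice.poly_ext fun s hs => ?_
  obtain ⟨n1, n2, n3⟩ := Q.regular_z hs
  have hq := Q.q_ne
  have hz := Q.z_ne s
  have m2 : 1 - Q.q⁻¹ * Q.z s ^ 2 ≠ 0 := fun h => n3 (by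
    field_simp at h
    linear_combination h)
  have m3 : Q.q⁻¹ - Q.z s ^ 2 ≠ 0 := fun h => n2 (by
    field_simp at h
    linear_combination h)
  have h := continuousQHermite_eigen (inv_ne_zero hq) (inv_root Q.root) n hz n1 m2 m3
  rw [Q.op_eval _ _ _ _ _ _ hs, diag_eq]
  simp only [eval_mul, eval_C, hermitePoly_eval _ (inv_ne_zero hq) (inv_root Q.root), κ_inv_mul_x,
    z_add_one, z_sub_one]
  rw [inv_inv, inv_pow Q.q, inv_inv] at h
  generalize Q.z s = z at *
  generalize Q.q = q at *
  rw [show (0 : ℂ) * ((q ^ n)⁻¹ - 1) + l * (q ^ n - 1) * q⁻¹ = l * q⁻¹ * (q ^ n - 1) by ring,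
    mul_assoc (l * q⁻¹), ← h]
  have e1 : 1 - z⁻¹ ^ 2 = (z ^ 2 - 1) / z ^ 2 := by field_simp
  have e2 : 1 - q * z⁻¹ ^ 2 = -(q - z ^ 2) / z ^ 2 := by field_simp; ring
  have e4 : 1 - q⁻¹ * z⁻¹ ^ 2 = -(1 - q * z ^ 2) / (q * z ^ 2) := by field_simp; ring
  have e5 : 1 - q⁻¹ * z ^ 2 = (q - z ^ 2) / q := by field_simp
  have e3 : 1 - z ^ 2 = -(z ^ 2 - 1) := by ring
  rw [e1, e2, e4, e5, e3]
  field_simp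
  ring

end QLattice
end QBases

/-! ### The Askey–Wilson polynomials, their limiting families, and the classification. -/

section QFamilies
open Polynomial

/-- The coefficients of the Askey–Wilson polynomials in the Askey–Wilson basis. -/
noncomputable def awCoeff (q : ℂ) (n : ℕ) (a b c d : ℂ) (k : ℕ) : ℂ :=
  (a ^ n)⁻¹ * (qPoch (q ^ (-(n : ℤ))) q k * qPoch (a * b * c * d * q ^ ((n : ℤ) - 1)) q k
      * qPoch (a * b * q ^ k) q (n - k) * qPoch (a * c * q ^ k) q (n - k)
      * qPoch (a * d * q ^ k) q (n - k) * (q ^ k / qPoch q q k))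

/-- The coefficients of `askeyWilsonLim₁` in the Askey–Wilson basis. -/
noncomputable def awCoeff₁ (q : ℂ) (n : ℕ) (a b c : ℂ) (k : ℕ) : ℂ :=
  qPoch (q ^ (-(n : ℤ))) q k * qPoch (a * b * q ^ k) q (n - k)
      * qPoch (a * c * q ^ k) q (n - k) * ((b * c * q ^ n) ^ k / qPoch q q k)

/-- The coefficients of `askeyWilsonLim₂` in the Askey–Wilson basis. -/
noncomputable def awCoeff₂ (q : ℂ) (n : ℕ) (a b : ℂ) (k : ℕ) : ℂ :=
  qPoch (q ^ (-(n : ℤ))) q k * qPoch (a * b * q ^ k) q (n - k)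
      * (q ^ k.choose 2)⁻¹ * ((-(b * q ^ n / a)) ^ k / qPoch q q k)

/-- The coefficients of `askeyWilsonLim₃` in the Askey–Wilson basis. -/
noncomputable def awCoeff₃ (q : ℂ) (n : ℕ) (a : ℂ) (k : ℕ) : ℂ :=
  qPoch (q ^ (-(n : ℤ))) q k * (q ^ (2 * k.choose 2))⁻¹ * ((q ^ n / a ^ 2) ^ k / qPoch q q k)

section Coefficients
variable {q : ℂ} (hq : q ≠ 0) (hroot : ∀ k : ℕ, 0 < k → q ^ k ≠ 1)
include hq hroot

omit hq in
theorem one_sub_mul_pow_ne_zero (k : ℕ) : 1 - q * q ^ k ≠ 0 := by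
  intro h
  refine hroot (k + 1) k.succ_pos ?_
  rw [pow_succ]
  linear_combination -h

/-- The recursion of `aw_eigen` for g(z) = (1 - bz)(1 - cz)(1 - dz). The three variants below belong
to z(1 - bz)(1 - cz), z²(1 - bz) and z³. -/
theorem awCoeff_succ (n : ℕ) (a b c d : ℂ) {k : ℕ} (hk : k < n) :
    awCoeff q n a b c d k
        * (((q ^ k)⁻¹ - (q ^ n)⁻¹) - a * b * c * d * (q ^ n - q ^ k) * q⁻¹)
      = awCoeff q n a b c d (k + 1) * (((q ^ (k + 1))⁻¹ - 1) * ((1 - a * b * q ^ k)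
          * (1 - a * c * q ^ k) * (1 - a * d * q ^ k))) := by
  have h1 := one_sub_mul_pow_ne_zero hroot k
  have h1' : 1 - q ^ k * q ≠ 0 := by rwa [mul_comm]
  have h2 := qPoch_self_ne_zero hroot k
  have h3 : q ^ k ≠ 0 := pow_ne_zero k hq
  have h4 : q ^ n ≠ 0 := pow_ne_zero n hq
  simp only [awCoeff, q_zpow_neg, q_zpow_sub_one hq]
  rw [qPoch_shift (a * b) q hk, qPoch_shift (a * c) q hk, qPoch_shift (a * d) q hk, qPoch_succ,
    qPoch_succ, qPoch_succ q, pow_succ q k]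
  generalize qPoch (a * b * (q ^ k * q)) q (n - (k + 1)) = A
  generalize qPoch (a * c * (q ^ k * q)) q (n - (k + 1)) = B
  generalize qPoch (a * d * (q ^ k * q)) q (n - (k + 1)) = D
  generalize qPoch (q ^ n)⁻¹ q k = E
  generalize qPoch (a * b * c * d * (q ^ n * q⁻¹)) q k = F
  generalize qPoch q q k = G at *
  generalize q ^ k = t at *
  generalize q ^ n = s at *
  generalize (a ^ n)⁻¹ = α
  field_simp

theorem awCoeff₁_succ (n : ℕ) (a b c : ℂ) {k : ℕ} (hk : k < n) :
    awCoeff₁ q n a b c k * (a * (b * c) * (q ^ n - q ^ k) * q⁻¹)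
      = awCoeff₁ q n a b c (k + 1) * (((q ^ (k + 1))⁻¹ - 1) * (a * q ^ k * ((1 - a * b * q ^ k)
          * (1 - a * c * q ^ k)))) := by
  have h1 := one_sub_mul_pow_ne_zero hroot k
  have h1' : 1 - q ^ k * q ≠ 0 := by rwa [mul_comm]
  have h2 := qPoch_self_ne_zero hroot k
  have h3 : q ^ k ≠ 0 := pow_ne_zero k hq
  have h4 : q ^ n ≠ 0 := pow_ne_zero n hq
  simp only [awCoeff₁, q_zpow_neg]
  rw [qPoch_shift (a * b) q hk, qPoch_shift (a * c) q hk, qPoch_succ, qPoch_succ q,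
    pow_succ (b * c * q ^ n), pow_succ q k]
  generalize qPoch (a * b * (q ^ k * q)) q (n - (k + 1)) = A
  generalize qPoch (a * c * (q ^ k * q)) q (n - (k + 1)) = B
  generalize qPoch (q ^ n)⁻¹ q k = E
  generalize qPoch q q k = G at *
  generalize (b * c * q ^ n) ^ k = F
  generalize q ^ k = t at *
  generalize q ^ n = s at *
  field_simp

theorem awCoeff₂_succ (n : ℕ) {a : ℂ} (ha : a ≠ 0) (b : ℂ) {k : ℕ} (hk : k < n) :
    awCoeff₂ q n a b k * (-(a * b) * (q ^ n - q ^ k) * q⁻¹)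
      = awCoeff₂ q n a b (k + 1) * (((q ^ (k + 1))⁻¹ - 1) * ((a * q ^ k) ^ 2
          * (1 - a * b * q ^ k))) := by
  have h1 := one_sub_mul_pow_ne_zero hroot k
  have h1' : 1 - q ^ k * q ≠ 0 := by rwa [mul_comm]
  have h2 := qPoch_self_ne_zero hroot k
  have h3 : q ^ k ≠ 0 := pow_ne_zero k hq
  have h4 : q ^ n ≠ 0 := pow_ne_zero n hq
  have h5 : q ^ k.choose 2 ≠ 0 := pow_ne_zero _ hq
  simp only [awCoeff₂, q_zpow_neg]
  rw [qPoch_shift (a * b) q hk, qPoch_succ, qPoch_succ q, Nat.choose_succ_succ' k 1,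
    Nat.choose_one_right, pow_add q k (k.choose 2), pow_succ (-(b * q ^ n / a)), pow_succ q k]
  generalize qPoch (a * b * (q ^ k * q)) q (n - (k + 1)) = A
  generalize qPoch (q ^ n)⁻¹ q k = E
  generalize qPoch q q k = G at *
  generalize (-(b * q ^ n / a)) ^ k = F
  generalize q ^ k.choose 2 = H at *
  generalize q ^ k = t at *
  generalize q ^ n = s at *
  field_simp

theorem awCoeff₃_succ (n : ℕ) {a : ℂ} (ha : a ≠ 0) {k : ℕ} :
    awCoeff₃ q n a k * (a * (q ^ n - q ^ k) * q⁻¹)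
      = awCoeff₃ q n a (k + 1) * (((q ^ (k + 1))⁻¹ - 1) * (a * q ^ k) ^ 3) := by
  have h1 := one_sub_mul_pow_ne_zero hroot k
  have h1' : 1 - q ^ k * q ≠ 0 := by rwa [mul_comm]
  have h2 := qPoch_self_ne_zero hroot k
  have h3 : q ^ k ≠ 0 := pow_ne_zero k hq
  have h4 : q ^ n ≠ 0 := pow_ne_zero n hq
  have h5 : q ^ k.choose 2 ≠ 0 := pow_ne_zero _ hq
  simp only [awCoeff₃, q_zpow_neg]
  rw [qPoch_succ, qPoch_succ q, Nat.choose_succ_succ' k 1,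
    Nat.choose_one_right, mul_add, pow_add, mul_comm 2, mul_comm 2, pow_mul, pow_mul,
    pow_succ (q ^ n / a ^ 2), pow_succ q k]
  generalize qPoch (q ^ n)⁻¹ q k = E
  generalize qPoch q q k = G at *
  generalize (q ^ n / a ^ 2) ^ k = F
  generalize q ^ k.choose 2 = H at *
  generalize q ^ k = t at *
  generalize q ^ n = s at *
  field_simp

omit hroot in
theorem qPoch_inv_pow_mul (n : ℕ) :
    qPoch (q ^ n)⁻¹ q n * ∏ j ∈ Finset.range n, -q ^ (j + 1) = qPoch q q n := by
  rw [qPoch, ← Finset.prod_range_reflect (fun j => -q ^ (j + 1)), ← Finset.prod_mul_distrib, qPoch,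
    ← Finset.prod_range_reflect (fun j => 1 - q * q ^ j)]
  refine Finset.prod_congr rfl fun j hj => ?_
  have hj := Finset.mem_range.mp hj
  have e : q ^ n = q ^ (n - 1 - j + 1) * q ^ j := by rw [← pow_add]; congr 1; omega
  have h1 : q ^ (n - 1 - j + 1) ≠ 0 := pow_ne_zero _ hq
  have h2 : q ^ j ≠ 0 := pow_ne_zero _ hq
  rw [e, ← pow_succ']
  field_simp
  ring

theorem pow_injective_of_root : Function.Injective fun n : ℕ => q ^ n := by
  have key : ∀ m n : ℕ, m < n → q ^ m ≠ q ^ n := by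
    intro m n h h0
    have e : q ^ n = q ^ (n - m) * q ^ m := by rw [← pow_add]; congr 1; omega
    refine hroot (n - m) (by omega) (mul_right_cancel₀ (pow_ne_zero m hq) ?_)
    rw [← e, ← h0, one_mul]
  intro m n h
  rcases lt_trichotomy m n with h1 | h1 | h1
  · exact absurd h (key m n h1)
  · exact h1
  · exact absurd h.symm (key n m h1)

end Coefficients

/-- The polynomial in `x` with the given coefficients in the Askey–Wilson basis. -/
noncomputable def awSum (t a q : ℂ) (c : ℕ → ℂ) (n : ℕ) : ℂ[X] :=
  ∑ k ∈ Finset.range (n + 1), C (c k) * awBasisPoly t a q k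

theorem awSum_coeff (t a q : ℂ) (c : ℕ → ℂ) (n : ℕ) :
    (awSum t a q c n).coeff n = c n * ∏ j ∈ Finset.range n, (-2 * a * t * q ^ j) := by
  rw [awSum, coeff_sum_of_natDegree_le (e := awBasisPoly t a q)
    fun k => (prod_linear_natDegree _ _ k).1, awBasisPoly,
    (prod_linear_natDegree _ _ n).2]

theorem awSum_natDegree (t a q : ℂ) (c : ℕ → ℂ) (n : ℕ) : (awSum t a q c n).natDegree ≤ n := by
  refine natDegree_sum_le_of_forall_le _ _ fun k hk => (natDegree_C_mul_le _ _).trans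
    ((prod_linear_natDegree _ _ k).1.trans ?_)
  have := Finset.mem_range.mp hk
  omega

theorem awSum_coeff_ne_zero {t a q : ℂ} (ht : t ≠ 0) (ha : a ≠ 0) (hq : q ≠ 0) {c : ℕ → ℂ} {n : ℕ}
    (hc : c n ≠ 0) : (awSum t a q c n).coeff n ≠ 0 := by
  rw [awSum_coeff]
  refine mul_ne_zero hc (Finset.prod_ne_zero_iff.mpr fun j _ => ?_)
  exact mul_ne_zero (mul_ne_zero (mul_ne_zero (by norm_num) ha) ht) (pow_ne_zero j hq)

theorem awSum_awCoeff_eval (t : ℂ) (q : ℂ) (n : ℕ) (a b c d x : ℂ) :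
    (awSum t a q (awCoeff q n a b c d) n).eval x = askeyWilson q n a b c d (t * x) := by
  simp only [awSum, askeyWilson, awCoeff, eval_finsetSum, eval_mul, eval_C, awBasisPoly_eval]
  rw [Finset.mul_sum]
  exact Finset.sum_congr rfl fun k _ => by ring

theorem awSum_awCoeff₁_eval (t : ℂ) (q : ℂ) (n : ℕ) (a b c x : ℂ) :
    (awSum t a q (awCoeff₁ q n a b c) n).eval x = askeyWilsonLim₁ q n a b c (t * x) := by
  simp only [awSum, askeyWilsonLim₁, awCoeff₁, eval_finsetSum, eval_mul, eval_C, awBasisPoly_eval]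
  exact Finset.sum_congr rfl fun k _ => by ring

theorem awSum_awCoeff₂_eval (t : ℂ) (q : ℂ) (n : ℕ) (a b x : ℂ) :
    (awSum t a q (awCoeff₂ q n a b) n).eval x = askeyWilsonLim₂ q n a b (t * x) := by
  simp only [awSum, askeyWilsonLim₂, awCoeff₂, eval_finsetSum, eval_mul, eval_C, awBasisPoly_eval]
  exact Finset.sum_congr rfl fun k _ => by ring

theorem awSum_awCoeff₃_eval (t : ℂ) (q : ℂ) (n : ℕ) (a x : ℂ) :
    (awSum t a q (awCoeff₃ q n a) n).eval x = askeyWilsonLim₃ q n a (t * x) := by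
  simp only [awSum, askeyWilsonLim₃, awCoeff₃, eval_finsetSum, eval_mul, eval_C, awBasisPoly_eval]
  exact Finset.sum_congr rfl fun k _ => by ring

/-- The prefactor a^{-n} cancels the a^n from the basis, so only the product abcd remains. This
controls both the degree condition and the limits in which all four parameters move. -/
theorem awSum_awCoeff_coeff {q : ℂ} (hq : q ≠ 0) (hroot : ∀ k : ℕ, 0 < k → q ^ k ≠ 1) (t : ℂ)
    (n : ℕ) {a : ℂ} (ha : a ≠ 0) (b c d : ℂ) : (awSum t a q (awCoeff q n a b c d) n).coeff n
      = (2 * t) ^ n * qPoch (a * b * c * d * q ^ ((n : ℤ) - 1)) q n := by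
  have h := qPoch_inv_pow_mul hq n
  have h1 := qPoch_self_ne_zero hroot n
  have h2 : ∀ b, qPoch b q 0 = 1 := fun b => by simp [qPoch]
  have h3 : ∏ j ∈ Finset.range n, -q ^ (j + 1) = (∏ j ∈ Finset.range n, -q ^ j) * q ^ n := by
    rw [show q ^ n = ∏ j ∈ Finset.range n, q by simp, ← Finset.prod_mul_distrib]
    exact Finset.prod_congr rfl fun j _ => by ring
  have h4 : ∏ j ∈ Finset.range n, (-2 * a * t * q ^ j)
      = (2 * t) ^ n * a ^ n * ∏ j ∈ Finset.range n, -q ^ j := by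
    rw [← mul_pow, show (2 * t * a) ^ n = ∏ j ∈ Finset.range n, (2 * t * a) by simp,
      ← Finset.prod_mul_distrib]
    exact Finset.prod_congr rfl fun j _ => by ring
  have h5 : a ^ n ≠ 0 := pow_ne_zero n ha
  rw [awSum_coeff, awCoeff, h4, Nat.sub_self, h2, h2, h2, q_zpow_neg]
  rw [h3] at h
  generalize qPoch (q ^ n)⁻¹ q n = E at *
  field_simp
  linear_combination (2 * t) ^ n * qPoch (a * b * c * d * q ^ ((n : ℤ) - 1)) q n * h

namespace QLattice
variable (Q : QLattice)

theorem askeyWilson_eigen (l a b c d : ℂ) (n : ℕ) :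
    Q.data.op (Q.phi l (-(l * (a + b + c + d)))
        (l * (a * b + a * c + a * d + b * c + b * d + c * d))
        (-(l * (a * b * c + a * b * d + a * c * d + b * c * d))) (l * (a * b * c * d)))
        (Q.psi l (-(l * (a + b + c + d)))
        (-(l * (a * b * c + a * b * d + a * c * d + b * c * d))) (l * (a * b * c * d)))
        (awSum Q.κ⁻¹ a Q.q (awCoeff Q.q n a b c d) n)
      = C (Q.data.diag (Q.phi l (-(l * (a + b + c + d)))
        (l * (a * b + a * c + a * d + b * c + b * d + c * d))
        (-(l * (a * b * c + a * b * d + a * c * d + b * c * d))) (l * (a * b * c * d)))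
        (Q.psi l (-(l * (a + b + c + d)))
        (-(l * (a * b * c + a * b * d + a * c * d + b * c * d))) (l * (a * b * c * d))) n)
        * awSum Q.κ⁻¹ a Q.q (awCoeff Q.q n a b c d) n := by
  have := Q.aw_eigen a l (-(l * (b + c + d))) (l * (b * c + b * d + c * d)) (-(l * (b * c * d))) n
    (awCoeff Q.q n a b c d) fun k hk => by
      linear_combination l * awCoeff_succ Q.q_ne Q.root n a b c d hk
  simp only [awSum]
  convert this using 4 <;> ring_nf

theorem askeyWilsonLim₁_eigen (l a b c : ℂ) (n : ℕ) :
    Q.data.op (Q.phi 0 l (-(l * (a + b + c))) (l * (a * b + a * c + b * c)) (-(l * (a * b * c))))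
        (Q.psi 0 l (l * (a * b + a * c + b * c)) (-(l * (a * b * c))))
        (awSum Q.κ⁻¹ a Q.q (awCoeff₁ Q.q n a b c) n)
      = C (Q.data.diag (Q.phi 0 l (-(l * (a + b + c))) (l * (a * b + a * c + b * c))
          (-(l * (a * b * c)))) (Q.psi 0 l (l * (a * b + a * c + b * c)) (-(l * (a * b * c)))) n)
        * awSum Q.κ⁻¹ a Q.q (awCoeff₁ Q.q n a b c) n := by
  have := Q.aw_eigen a 0 l (-(l * (b + c))) (l * (b * c)) n
    (awCoeff₁ Q.q n a b c) fun k hk => by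
      linear_combination l * awCoeff₁_succ Q.q_ne Q.root n a b c hk
  simp only [awSum]
  convert this using 4 <;> ring_nf

theorem askeyWilsonLim₂_eigen (l : ℂ) {a : ℂ} (ha : a ≠ 0) (b : ℂ) (n : ℕ) :
    Q.data.op (Q.phi 0 0 l (-(l * (a + b))) (l * (a * b)))
        (Q.psi 0 0 (-(l * (a + b))) (l * (a * b)))
        (awSum Q.κ⁻¹ a Q.q (awCoeff₂ Q.q n a b) n)
      = C (Q.data.diag (Q.phi 0 0 l (-(l * (a + b))) (l * (a * b)))
        (Q.psi 0 0 (-(l * (a + b))) (l * (a * b))) n)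
        * awSum Q.κ⁻¹ a Q.q (awCoeff₂ Q.q n a b) n := by
  have := Q.aw_eigen a 0 0 l (-(l * b)) n
    (awCoeff₂ Q.q n a b) fun k hk => by
      linear_combination l * awCoeff₂_succ Q.q_ne Q.root n ha b hk
  simp only [awSum]
  convert this using 4 <;> ring_nf

theorem askeyWilsonLim₃_eigen (l : ℂ) {a : ℂ} (ha : a ≠ 0) (n : ℕ) :
    Q.data.op (Q.phi 0 0 0 l (-(l * a))) (Q.psi 0 0 l (-(l * a)))
        (awSum Q.κ⁻¹ a Q.q (awCoeff₃ Q.q n a) n)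
      = C (Q.data.diag (Q.phi 0 0 0 l (-(l * a))) (Q.psi 0 0 l (-(l * a))) n)
        * awSum Q.κ⁻¹ a Q.q (awCoeff₃ Q.q n a) n := by
  have := Q.aw_eigen a 0 0 0 l n
    (awCoeff₃ Q.q n a) fun k hk => by
      linear_combination l * awCoeff₃_succ Q.q_ne Q.root n ha (k := k)
  simp only [awSum]
  convert this using 4 <;> ring_nf

/-- The difference of the entries m and n contains the factor 1 - e q^{m+n-1}, a factor of (e
q^{n-1}; q)_n when m < n; the rest vanishes only for m = n. In the application e = abcd. -/
theorem diag_injective_iff {l : ℂ} (hl : l ≠ 0) (f₁ f₂ f₃ e : ℂ) :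
    Function.Injective (Q.data.diag (Q.phi l f₁ f₂ f₃ (l * e)) (Q.psi l f₁ f₃ (l * e))) ↔
      ∀ n : ℕ, qPoch (e * Q.q ^ ((n : ℤ) - 1)) Q.q n ≠ 0 := by
  have key : ∀ m n : ℕ, Q.data.diag (Q.phi l f₁ f₂ f₃ (l * e)) (Q.psi l f₁ f₃ (l * e)) m
      - Q.data.diag (Q.phi l f₁ f₂ f₃ (l * e)) (Q.psi l f₁ f₃ (l * e)) n
      = l * (Q.q ^ n - Q.q ^ m) / (Q.q ^ m * Q.q ^ n)
        * (1 - e * Q.q ^ ((n : ℤ) - 1) * Q.q ^ m) := by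
    intro m n
    have h1 : Q.q ^ m ≠ 0 := pow_ne_zero m Q.q_ne
    have h2 : Q.q ^ n ≠ 0 := pow_ne_zero n Q.q_ne
    have h3 := Q.q_ne
    rw [diag_eq, diag_eq, q_zpow_sub_one Q.q_ne]
    field_simp
    ring
  have hinj := pow_injective_of_root Q.q_ne Q.root
  constructor
  · intro h n h0
    rw [qPoch, Finset.prod_eq_zero_iff] at h0
    obtain ⟨j, hj, h0⟩ := h0
    refine (Finset.mem_range.mp hj).ne (h (sub_eq_zero.mp ?_))
    rw [key, h0, mul_zero]
  · intro h
    have hne : ∀ m n : ℕ, m < n → Q.data.diag (Q.phi l f₁ f₂ f₃ (l * e)) (Q.psi l f₁ f₃ (l * e)) m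
        ≠ Q.data.diag (Q.phi l f₁ f₂ f₃ (l * e)) (Q.psi l f₁ f₃ (l * e)) n := by
      intro m n hmn h0
      rw [← sub_eq_zero, key] at h0
      have h1 : Q.q ^ m ≠ 0 := pow_ne_zero m Q.q_ne
      have h2 : Q.q ^ n ≠ 0 := pow_ne_zero n Q.q_ne
      have h3 : Q.q ^ n - Q.q ^ m ≠ 0 := sub_ne_zero.mpr (hinj.ne hmn.ne')
      have h4 := (mul_eq_zero.mp h0).resolve_left
        (div_ne_zero (mul_ne_zero hl h3) (mul_ne_zero h1 h2))
      refine h n ?_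
      rw [qPoch, Finset.prod_eq_zero_iff]
      exact ⟨m, Finset.mem_range.mpr hmn, h4⟩
    intro m n h0
    rcases lt_trichotomy m n with h1 | h1 | h1
    · exact absurd h0 (hne m n h1)
    · exact h1
    · exact absurd h0.symm (hne n m h1)

theorem diag_injective_of_zero {f₄ : ℂ} (hf : f₄ ≠ 0) (f₁ f₂ f₃ : ℂ) :
    Function.Injective (Q.data.diag (Q.phi 0 f₁ f₂ f₃ f₄) (Q.psi 0 f₁ f₃ f₄)) := by
  intro m n h
  rw [diag_eq, diag_eq] at h
  refine pow_injective_of_root Q.q_ne Q.root ?_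
  refine mul_left_cancel₀ (mul_ne_zero hf (inv_ne_zero Q.q_ne)) ?_
  linear_combination h

theorem awCoeff₁_ne_zero (n : ℕ) (a : ℂ) {b c : ℂ} (hb : b ≠ 0) (hc : c ≠ 0) :
    awCoeff₁ Q.q n a b c n ≠ 0 := by
  have h1 := qPoch_inv_pow_ne_zero Q.q_ne Q.root n
  have h2 : ∀ b, qPoch b Q.q 0 = 1 := fun b => by simp [qPoch]
  have h3 := qPoch_self_ne_zero Q.root n
  rw [awCoeff₁, Nat.sub_self, h2, h2, q_zpow_neg, mul_one, mul_one]
  exact mul_ne_zero h1 (div_ne_zero (pow_ne_zero _ (mul_ne_zero (mul_ne_zero hb hc)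
    (pow_ne_zero _ Q.q_ne))) h3)

theorem awCoeff₂_ne_zero (n : ℕ) {a b : ℂ} (ha : a ≠ 0) (hb : b ≠ 0) :
    awCoeff₂ Q.q n a b n ≠ 0 := by
  have h1 := qPoch_inv_pow_ne_zero Q.q_ne Q.root n
  have h2 : ∀ b, qPoch b Q.q 0 = 1 := fun b => by simp [qPoch]
  have h3 := qPoch_self_ne_zero Q.root n
  rw [awCoeff₂, Nat.sub_self, h2, q_zpow_neg, mul_one]
  exact mul_ne_zero (mul_ne_zero h1 (inv_ne_zero (pow_ne_zero _ Q.q_ne))) (div_ne_zero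
    (pow_ne_zero _ (neg_ne_zero.mpr (div_ne_zero (mul_ne_zero hb (pow_ne_zero _ Q.q_ne)) ha))) h3)

theorem awCoeff₃_ne_zero (n : ℕ) {a : ℂ} (ha : a ≠ 0) : awCoeff₃ Q.q n a n ≠ 0 := by
  have h1 := qPoch_inv_pow_ne_zero Q.q_ne Q.root n
  have h3 := qPoch_self_ne_zero Q.root n
  rw [awCoeff₃, q_zpow_neg]
  exact mul_ne_zero (mul_ne_zero h1 (inv_ne_zero (pow_ne_zero _ Q.q_ne))) (div_ne_zero
    (pow_ne_zero _ (div_ne_zero (pow_ne_zero _ Q.q_ne) (pow_ne_zero _ ha))) h3)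

/-- The factorisation l(1 - az)(1 - bz)(1 - cz)(1 - dz), normalised at z = 0, so a zero parameter
means a drop in degree. A nonzero parameter is moved to the first place, since the expansion basis
requires a ≠ 0; this fails only for constant f. -/
theorem exists_quartic_factors_ne_zero (l f₁ f₂ f₃ f₄ : ℂ) (hl : l ≠ 0) :
    (f₁ = 0 ∧ f₂ = 0 ∧ f₃ = 0 ∧ f₄ = 0) ∨ ∃ a b c d : ℂ, a ≠ 0 ∧ f₁ = -(l * (a + b + c + d)) ∧
      f₂ = l * (a * b + a * c + a * d + b * c + b * d + c * d) ∧
      f₃ = -(l * (a * b * c + a * b * d + a * c * d + b * c * d)) ∧ f₄ = l * (a * b * c * d) := by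
  obtain ⟨a, b, c, d, h1, h2, h3, h4⟩ := exists_quartic_factors l (-f₁) f₂ (-f₃) f₄ hl
  rw [neg_eq_iff_eq_neg] at h1 h3
  by_cases ha : a = 0
  · by_cases hb : b = 0
    · by_cases hc : c = 0
      · by_cases hd : d = 0
        · left
          subst ha hb hc hd
          simp [h1, h2, h3, h4]
        · right
          exact ⟨d, a, b, c, hd, by rw [h1]; ring, by rw [h2]; ring, by rw [h3]; ring,
            by rw [h4]; ring⟩
      · right
        exact ⟨c, a, b, d, hc, by rw [h1]; ring, by rw [h2]; ring, by rw [h3]; ring,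
          by rw [h4]; ring⟩
    · right
      exact ⟨b, a, c, d, hb, by rw [h1]; ring, by rw [h2]; ring, by rw [h3]; ring,
        by rw [h4]; ring⟩
  · right
    exact ⟨a, b, c, d, ha, h1, h2, h3, h4⟩

theorem hasSturmLiouville_iff_isAskeyWilsonFamily {P : ℕ → ℂ[X]}
    (hP : ∀ n, (P n).degree = (n : WithBot ℕ)) :
    HasSturmLiouvilleEquation Q.x P ↔ IsAskeyWilsonFamily Q.q (Q.c₂ / Q.c₁) Q.x P := by
  have hx := Q.isLattice
  have hκ := inv_ne_zero Q.κ_ne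
  have hr := Q.r_ne
  have hq := Q.q_ne
  have hy : ∀ s, awVariable Q.q (Q.c₂ / Q.c₁) s = Q.κ⁻¹ * Q.x s := fun s => by
    rw [awVariable_eq, κ_inv_mul_x]
  have hc : csqrt (Q.c₂ / Q.c₁) = Q.r := rfl
  have hH : ∀ n, (hermitePoly Q.κ⁻¹ Q.q n).coeff n ≠ 0 := fun n => by
    rw [(hermitePoly_natDegree _ _ n).2]
    exact pow_ne_zero n (mul_ne_zero two_ne_zero hκ)
  have hH' : ∀ n, (hermitePoly Q.κ⁻¹ Q.q⁻¹ n).coeff n ≠ 0 := fun n => by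
    rw [(hermitePoly_natDegree _ _ n).2]
    exact pow_ne_zero n (mul_ne_zero two_ne_zero hκ)
  have hcancel : ∀ a, Q.r * (a / Q.r) = a := fun a => mul_div_cancel₀ a hr
  simp only [IsAskeyWilsonFamily, hy, hc, ← awSum_awCoeff_eval, ← awSum_awCoeff₁_eval,
    ← awSum_awCoeff₂_eval, ← awSum_awCoeff₃_eval, ← hermitePoly_eval _ hq Q.root,
    ← hermitePoly_eval _ (inv_ne_zero hq) (inv_root Q.root)]
  constructor
  · rw [hx.hasSturmLiouville_iff hP]
    rintro ⟨φ, ψ, hφ, hψ, hinj, h⟩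
    obtain ⟨f₀, f₁, f₂, f₃, f₄, rfl, rfl⟩ := Q.exists_phi_psi hφ hψ
    -- The cases follow the order of vanishing of f at z = 0, which is the number of parameters at
    -- infinity.
    by_cases h0 : f₀ = 0
    swap
    · rcases exists_quartic_factors_ne_zero f₀ f₁ f₂ f₃ f₄ h0 with
        ⟨rfl, rfl, rfl, rfl⟩ | ⟨a, b, c, d, ha, rfl, rfl, rfl, rfl⟩
      · right; left
        exact hx.isMultipleOf_of_eigen hφ hψ hinj hP hH h (Q.hermite_eigen f₀)
      · left
        refine ⟨a / Q.r, b / Q.r, c / Q.r, d / Q.r, div_ne_zero ha hr, ?_⟩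
        simp only [hcancel]
        refine hx.isMultipleOf_of_eigen hφ hψ hinj hP (fun n => ?_) h
          (Q.askeyWilson_eigen f₀ a b c d)
        rw [awSum_awCoeff_coeff hq Q.root _ _ ha]
        exact mul_ne_zero (pow_ne_zero n (mul_ne_zero two_ne_zero hκ))
          ((Q.diag_injective_iff h0 _ _ _ _).mp hinj n)
    subst h0
    -- With f₀ = f₄ = 0 all diagonal entries vanish. So f has degree exactly 4, which makes all
    -- finite parameters below nonzero.
    have h4 : f₄ ≠ 0 := by
      rintro rfl
      refine zero_ne_one (hinj (a₁ := 0) (a₂ := 1) ?_)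
      rw [diag_eq, diag_eq]
      simp
    right; right
    by_cases h1 : f₁ = 0
    swap
    · obtain ⟨a, b, c, e1, rfl, e3⟩ := exists_cubic_factors f₁ (-f₂) f₃ (-f₄) h1
      rw [neg_eq_iff_eq_neg] at e1 e3
      subst e1 e3
      have habc := neg_ne_zero.mp h4
      have hb : b ≠ 0 := by rintro rfl; simp at habc
      have ha : a ≠ 0 := by rintro rfl; simp at habc
      have hc : c ≠ 0 := by rintro rfl; simp at habc
      left
      refine ⟨a / Q.r, b / Q.r, c / Q.r, div_ne_zero ha hr, div_ne_zero hb hr,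
        div_ne_zero hc hr, ?_⟩
      simp only [hcancel]
      exact hx.isMultipleOf_of_eigen hφ hψ hinj hP
        (fun n => awSum_coeff_ne_zero hκ ha hq (Q.awCoeff₁_ne_zero n a hb hc)) h
        (Q.askeyWilsonLim₁_eigen f₁ a b c)
    subst h1
    right
    by_cases h2 : f₂ = 0
    swap
    · obtain ⟨a, b, e1, rfl⟩ := exists_quadratic_factors f₂ (-f₃) f₄ h2
      rw [neg_eq_iff_eq_neg] at e1
      subst e1
      have hb : b ≠ 0 := by rintro rfl; simp at h4
      have ha : a ≠ 0 := by rintro rfl; simp at h4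
      left
      refine ⟨a / Q.r, b / Q.r, div_ne_zero ha hr, div_ne_zero hb hr, ?_⟩
      simp only [hcancel]
      exact hx.isMultipleOf_of_eigen hφ hψ hinj hP
        (fun n => awSum_coeff_ne_zero hκ ha hq (Q.awCoeff₂_ne_zero n ha hb)) h
        (Q.askeyWilsonLim₂_eigen f₂ ha b)
    subst h2
    right
    by_cases h3 : f₃ = 0
    swap
    · obtain ⟨a, rfl⟩ : ∃ a, f₄ = -(f₃ * a) := ⟨-(f₄ / f₃), by field_simp⟩
      have ha : a ≠ 0 := by rintro rfl; simp at h4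
      left
      refine ⟨a / Q.r, div_ne_zero ha hr, ?_⟩
      simp only [hcancel]
      exact hx.isMultipleOf_of_eigen hφ hψ hinj hP
        (fun n => awSum_coeff_ne_zero hκ ha hq (Q.awCoeff₃_ne_zero n ha)) h
        (Q.askeyWilsonLim₃_eigen f₃ ha)
    subst h3
    right
    exact hx.isMultipleOf_of_eigen hφ hψ hinj hP hH' h (Q.hermite_inv_eigen f₄)
  · rintro (⟨a, b, c, d, ha, h⟩ | h | ⟨a, b, c, ha, hb, hc, h⟩ | ⟨a, b, ha, hb, h⟩ | ⟨a, ha, h⟩ | h)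
    · have ha' := mul_ne_zero hr ha
      refine hx.hasSturmLiouville_of_isMultipleOf (Q.phi_natDegree _ _ _ _ _)
        (Q.psi_natDegree _ _ _ _) hP (fun h0 => ?_) (Q.askeyWilson_eigen 1 _ _ _ _) h
      rw [Q.diag_injective_iff one_ne_zero]
      intro n
      have := h0 n
      rw [awSum_awCoeff_coeff hq Q.root _ _ ha'] at this
      exact right_ne_zero_of_mul this
    · refine hx.hasSturmLiouville_of_isMultipleOf (Q.phi_natDegree _ _ _ _ _)
        (Q.psi_natDegree _ _ _ _) hP (fun _ => ?_) (Q.hermite_eigen 1) h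
      have := (Q.diag_injective_iff one_ne_zero 0 0 0 0).mpr fun n => by simp [qPoch]
      rwa [mul_zero] at this
    · have ha' := mul_ne_zero hr ha
      exact hx.hasSturmLiouville_of_isMultipleOf (Q.phi_natDegree _ _ _ _ _)
        (Q.psi_natDegree _ _ _ _) hP (fun _ => Q.diag_injective_of_zero
          (neg_ne_zero.mpr (mul_ne_zero one_ne_zero (mul_ne_zero (mul_ne_zero ha'
            (mul_ne_zero hr hb)) (mul_ne_zero hr hc)))) _ _ _) (Q.askeyWilsonLim₁_eigen 1 _ _ _) h
    · have ha' := mul_ne_zero hr ha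
      exact hx.hasSturmLiouville_of_isMultipleOf (Q.phi_natDegree _ _ _ _ _)
        (Q.psi_natDegree _ _ _ _) hP (fun _ => Q.diag_injective_of_zero
          (mul_ne_zero one_ne_zero (mul_ne_zero ha' (mul_ne_zero hr hb))) _ _ _)
          (Q.askeyWilsonLim₂_eigen 1 ha' _) h
    · have ha' := mul_ne_zero hr ha
      exact hx.hasSturmLiouville_of_isMultipleOf (Q.phi_natDegree _ _ _ _ _)
        (Q.psi_natDegree _ _ _ _) hP (fun _ => Q.diag_injective_of_zero
          (neg_ne_zero.mpr (mul_ne_zero one_ne_zero ha')) _ _ _) (Q.askeyWilsonLim₃_eigen 1 ha') h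
    · exact hx.hasSturmLiouville_of_isMultipleOf (Q.phi_natDegree _ _ _ _ _)
        (Q.psi_natDegree _ _ _ _) hP (fun _ => Q.diag_injective_of_zero one_ne_zero _ _ _)
        (Q.hermite_inv_eigen 1) h

end QLattice
end QFamilies

/-! ### Continuity of eigenvectors and the limit of vanishing parameters. -/

section Limits
open Polynomial Filter Topology

namespace LatticeData
variable (Λ : LatticeData)

/-- The lower coefficients of an eigenvector in terms of the higher ones. -/
theorem eigenvector_coeff {φ ψ : ℂ[X]} (hφ : φ.natDegree ≤ 2) (hψ : ψ.natDegree ≤ 1) {P : ℂ[X]}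
    {n : ℕ} (hP : P.natDegree ≤ n) {θ : ℂ} (h : Λ.op φ ψ P = C θ * P) {j : ℕ} (hj : j ≤ n) :
    (θ - Λ.diag φ ψ j) * P.coeff j
      = ∑ i ∈ Finset.Ico (j + 1) (n + 1), P.coeff i * (Λ.op φ ψ (X ^ i)).coeff j := by
  have h1 := congrArg (fun p => p.coeff j) h
  simp only [coeff_C_mul] at h1
  rw [linearMap_apply_eq_sum _ hP, finsetSum_coeff] at h1
  simp only [coeff_C_mul] at h1
  rw [← Finset.sum_range_add_sum_Ico _ (show j + 1 ≤ n + 1 by omega), Finset.sum_range_succ,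
    Finset.sum_eq_zero, zero_add, (Λ.op_natDegree hφ hψ (natDegree_X_pow_le j)).2, coeff_X_pow,
    if_pos rfl] at h1
  · linear_combination -h1
  · intro i hi
    have := (Λ.op_natDegree hφ hψ (natDegree_X_pow_le (R := ℂ) i)).1
    rw [coeff_eq_zero_of_natDegree_lt (this.trans_lt (Finset.mem_range.mp hi)), mul_zero]

/-- Eigenvectors depend continuously on the operator. -/
theorem tendsto_eigenvector_coeff {ι : Type*} {l : Filter ι} {φ ψ : ι → ℂ[X]} {φ₀ ψ₀ : ℂ[X]}
    (hφ : ∀ p, (φ p).natDegree ≤ 2) (hψ : ∀ p, (ψ p).natDegree ≤ 1) (hφ₀ : φ₀.natDegree ≤ 2)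
    (hψ₀ : ψ₀.natDegree ≤ 1) (tφ : ∀ i, Tendsto (fun p => (φ p).coeff i) l (𝓝 (φ₀.coeff i)))
    (tψ : ∀ i, Tendsto (fun p => (ψ p).coeff i) l (𝓝 (ψ₀.coeff i))) {n : ℕ} {R : ι → ℂ[X]}
    {R₀ : ℂ[X]} (hR : ∀ p, (R p).natDegree ≤ n) (hR₀ : R₀.natDegree ≤ n)
    (eR : ∀ᶠ p in l, Λ.op (φ p) (ψ p) (R p) = C (Λ.diag (φ p) (ψ p) n) * R p)
    (eR₀ : Λ.op φ₀ ψ₀ R₀ = C (Λ.diag φ₀ ψ₀ n) * R₀)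
    (hinj : Function.Injective (Λ.diag φ₀ ψ₀))
    (tR : Tendsto (fun p => (R p).coeff n) l (𝓝 (R₀.coeff n))) (j : ℕ) :
    Tendsto (fun p => (R p).coeff j) l (𝓝 (R₀.coeff j)) := by
  have tdiag : ∀ m, Tendsto (fun p => Λ.diag (φ p) (ψ p) m) l (𝓝 (Λ.diag φ₀ ψ₀ m)) := fun m =>
    (((tφ 2).mul_const _).add ((tψ 1).mul_const _)).const_mul _
  have tmul : ∀ (f : ι → ℂ[X]) (f₀ : ℂ[X]),
      (∀ i, Tendsto (fun p => (f p).coeff i) l (𝓝 (f₀.coeff i))) → ∀ (g : ℂ[X]) (i : ℕ),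
      Tendsto (fun p => (f p * g).coeff i) l (𝓝 ((f₀ * g).coeff i)) := by
    intro f f₀ hf g i
    simp only [coeff_mul]
    exact tendsto_finsetSum _ fun x _ => (hf x.1).mul_const _
  have top : ∀ i m, Tendsto (fun p => (Λ.op (φ p) (ψ p) (X ^ i)).coeff m) l
      (𝓝 ((Λ.op φ₀ ψ₀ (X ^ i)).coeff m)) := by
    intro i m
    simp only [op_apply, coeff_add]
    exact (tmul φ φ₀ tφ _ m).add (tmul ψ ψ₀ tψ _ m)
  rcases lt_or_ge n j with hj | hj
  · rw [coeff_eq_zero_of_natDegree_lt (hR₀.trans_lt hj)]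
    refine tendsto_const_nhds.congr fun p => ?_
    rw [coeff_eq_zero_of_natDegree_lt ((hR p).trans_lt hj)]
  · obtain ⟨m, hm⟩ : ∃ m, n - j = m := ⟨_, rfl⟩
    -- Descending induction on the coefficient index: each lower coefficient is a combination of
    -- higher ones divided by a difference of diagonal entries, whose limit is nonzero.
    induction m using Nat.strong_induction_on generalizing j with
    | _ m ih =>
      rcases hj.eq_or_lt with rfl | hlt
      · exact tR
      have h0 : Λ.diag φ₀ ψ₀ n - Λ.diag φ₀ ψ₀ j ≠ 0 :=
        sub_ne_zero.mpr fun h => hlt.ne (hinj h).symm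
      have t1 := (tdiag n).sub (tdiag j)
      have t2 : Tendsto (fun p => (∑ i ∈ Finset.Ico (j + 1) (n + 1),
          (R p).coeff i * (Λ.op (φ p) (ψ p) (X ^ i)).coeff j)
            / (Λ.diag (φ p) (ψ p) n - Λ.diag (φ p) (ψ p) j)) l
          (𝓝 ((∑ i ∈ Finset.Ico (j + 1) (n + 1), R₀.coeff i * (Λ.op φ₀ ψ₀ (X ^ i)).coeff j)
            / (Λ.diag φ₀ ψ₀ n - Λ.diag φ₀ ψ₀ j))) := by
        refine (tendsto_finsetSum _ fun i hi => ?_).div t1 h0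
        have hi := Finset.mem_Ico.mp hi
        exact (ih (n - i) (by omega) i (by omega) rfl).mul (top i j)
      rw [← Λ.eigenvector_coeff hφ₀ hψ₀ hR₀ eR₀ hj, mul_div_cancel_left₀ _ h0] at t2
      refine t2.congr' ?_
      filter_upwards [eR, t1.eventually_ne h0] with p h1 h2
      rw [← Λ.eigenvector_coeff (hφ p) (hψ p) (hR p) h1 hj, mul_div_cancel_left₀ _ h2]

end LatticeData

theorem qPoch_split (a q : ℂ) {n k : ℕ} (hk : k ≤ n) :
    qPoch a q n = qPoch a q k * qPoch (a * q ^ k) q (n - k) := by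
  obtain ⟨m, rfl⟩ := Nat.exists_eq_add_of_le hk
  rw [Nat.add_sub_cancel_left, qPoch, Finset.prod_range_add, qPoch, qPoch]
  congr 1
  exact Finset.prod_congr rfl fun j _ => by rw [pow_add]; ring

theorem prod_pow_range (q : ℂ) (k : ℕ) : ∏ j ∈ Finset.range k, q ^ j = q ^ k.choose 2 := by
  induction k with
  | zero => simp
  | succ k ih =>
    rw [Finset.prod_range_succ, ih, Nat.choose_succ_succ' k 1, Nat.choose_one_right, pow_add,
      mul_comm]

theorem eventually_qPoch_ne_zero {ι : Type*} {l : Filter ι} {f : ι → ℂ}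
    (hf : Tendsto f l (Bornology.cobounded ℂ)) {q : ℂ} (hq : q ≠ 0) (n : ℕ) :
    ∀ᶠ p in l, qPoch (f p) q n ≠ 0 := by
  have h1 : Tendsto (fun p => (f p)⁻¹) l (𝓝 0) := tendsto_inv₀_cobounded.comp hf
  have h2 : ∀ᶠ p in l, ∀ j ∈ Finset.range n, (f p)⁻¹ ≠ q ^ j :=
    (eventually_all_finset _).mpr fun j _ => h1.eventually_ne (pow_ne_zero j hq).symm
  filter_upwards [h2] with p hp
  rw [qPoch, Finset.prod_ne_zero_iff]
  intro j hj h0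
  refine hp j hj (inv_eq_of_mul_eq_one_right ?_)
  linear_combination -h0

theorem continuous_qPoch (q : ℂ) (n : ℕ) : Continuous fun a => qPoch a q n := by
  simp only [qPoch]
  fun_prop

namespace QLattice
variable (Q : QLattice)

theorem tendsto_eval {ι : Type*} {l : Filter ι} {f₀ f₁ f₂ f₃ f₄ : ι → ℂ} {g₀ g₁ g₂ g₃ g₄ : ℂ}
    (h₀ : Tendsto f₀ l (𝓝 g₀)) (h₁ : Tendsto f₁ l (𝓝 g₁)) (h₂ : Tendsto f₂ l (𝓝 g₂))
    (h₃ : Tendsto f₃ l (𝓝 g₃)) (h₄ : Tendsto f₄ l (𝓝 g₄)) {n : ℕ} {R : ι → ℂ[X]} {R₀ : ℂ[X]}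
    (hR : ∀ p, (R p).natDegree ≤ n) (hR₀ : R₀.natDegree ≤ n)
    (eR : ∀ p, Q.data.op (Q.phi (f₀ p) (f₁ p) (f₂ p) (f₃ p) (f₄ p))
        (Q.psi (f₀ p) (f₁ p) (f₃ p) (f₄ p)) (R p)
      = C (Q.data.diag (Q.phi (f₀ p) (f₁ p) (f₂ p) (f₃ p) (f₄ p))
        (Q.psi (f₀ p) (f₁ p) (f₃ p) (f₄ p)) n) * R p)
    (eR₀ : Q.data.op (Q.phi g₀ g₁ g₂ g₃ g₄) (Q.psi g₀ g₁ g₃ g₄) R₀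
      = C (Q.data.diag (Q.phi g₀ g₁ g₂ g₃ g₄) (Q.psi g₀ g₁ g₃ g₄) n) * R₀)
    (hinj : Function.Injective (Q.data.diag (Q.phi g₀ g₁ g₂ g₃ g₄) (Q.psi g₀ g₁ g₃ g₄)))
    (tR : Tendsto (fun p => (R p).coeff n) l (𝓝 (R₀.coeff n))) (x : ℂ) :
    Tendsto (fun p => (R p).eval x) l (𝓝 (R₀.eval x)) := by
  have key := Q.data.tendsto_eigenvector_coeff (l := l) (fun p => Q.phi_natDegree _ _ _ _ _)
    (fun p => Q.psi_natDegree _ _ _ _) (Q.phi_natDegree _ _ _ _ _) (Q.psi_natDegree _ _ _ _)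
    (fun i => ?_) (fun i => ?_) hR hR₀ (Eventually.of_forall eR) eR₀ hinj tR
  · rw [eval_eq_sum_range' (Nat.lt_succ_of_le hR₀)]
    refine (tendsto_finsetSum _ fun i _ => (key i).mul_const (x ^ i)).congr fun p => ?_
    rw [eval_eq_sum_range' (Nat.lt_succ_of_le (hR p))]
  · simp only [phi, coeff_C_mul, coeff_add, coeff_C]
    refine ((((h₀.add h₄).const_mul 2).mul_const _).add
      (((h₁.add h₃).const_mul Q.κ).mul_const _) |>.add ?_).const_mul _
    split_ifs
    · exact ((h₂.sub h₀).sub h₄).const_mul _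
    · exact tendsto_const_nhds
  · simp only [psi, coeff_C_mul, coeff_add, coeff_C]
    refine (((h₀.sub h₄).mul_const _).add ?_).const_mul _
    split_ifs
    · exact ((h₁.sub h₃).const_mul _).div_const _
    · exact tendsto_const_nhds

end QLattice

section
variable {q : ℂ} (hq : q ≠ 0) (hroot : ∀ k : ℕ, 0 < k → q ^ k ≠ 1) (n : ℕ) (y : ℂ)
include hq hroot

/-- The factor a^{-n} prevents a termwise limit. Instead f tends to 1, whose eigenpolynomials are
the q-Hermite polynomials, and the leading coefficients converge. -/
theorem tendsto_askeyWilson_zero :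
    Tendsto (fun p : ℂ × ℂ × ℂ × ℂ => askeyWilson q n p.1 p.2.1 p.2.2.1 p.2.2.2 y)
      (𝓝[{0}ᶜ] 0 ×ˢ 𝓝 0 ×ˢ 𝓝 0 ×ˢ 𝓝 0) (𝓝 (continuousQHermite q n y)) := by
  set F : Filter (ℂ × ℂ × ℂ × ℂ) := 𝓝[{0}ᶜ] 0 ×ˢ 𝓝 0 ×ˢ 𝓝 0 ×ˢ 𝓝 0 with hF
  -- An auxiliary lattice that only provides the operator; the given y is the rescaled variable at x
  -- = κy.
  let Q : QLattice := ⟨q, 1, 1, hq, hroot, one_ne_zero, one_ne_zero⟩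
  have ha : Tendsto (fun p : ℂ × ℂ × ℂ × ℂ => p.1) F (𝓝 0) :=
    tendsto_fst.mono_right nhdsWithin_le_nhds
  have hb : Tendsto (fun p : ℂ × ℂ × ℂ × ℂ => p.2.1) F (𝓝 0) := tendsto_fst.comp tendsto_snd
  have hc : Tendsto (fun p : ℂ × ℂ × ℂ × ℂ => p.2.2.1) F (𝓝 0) :=
    tendsto_fst.comp (tendsto_snd.comp tendsto_snd)
  have hd : Tendsto (fun p : ℂ × ℂ × ℂ × ℂ => p.2.2.2) F (𝓝 0) :=
    tendsto_snd.comp (tendsto_snd.comp tendsto_snd)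
  have ha0 : ∀ᶠ p : ℂ × ℂ × ℂ × ℂ in F, p.1 ≠ 0 :=
    tendsto_fst.eventually (eventually_mem_nhdsWithin (a := (0 : ℂ)) (s := {0}ᶜ))
  have hF0 : Tendsto (fun p => p) F (𝓝 (0 : ℂ × ℂ × ℂ × ℂ)) :=
    ha.prodMk_nhds (hb.prodMk_nhds (hc.prodMk_nhds hd))
  have hlim : ∀ f : ℂ × ℂ × ℂ × ℂ → ℂ, Continuous f → Tendsto f F (𝓝 (f 0)) := fun f hf =>
    (hf.tendsto 0).comp hF0
  have hlim' : ∀ f : ℂ × ℂ × ℂ × ℂ → ℂ, Continuous f → f 0 = 0 → Tendsto f F (𝓝 0) :=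
    fun f hf h0 => h0 ▸ hlim f hf
  have key := Q.tendsto_eval (l := F) (n := n)
    (R := fun p => awSum Q.κ⁻¹ p.1 q (awCoeff q n p.1 p.2.1 p.2.2.1 p.2.2.2) n)
    (R₀ := hermitePoly Q.κ⁻¹ q n)
    (tendsto_const_nhds (x := (1 : ℂ)))
    (hlim' _ (by fun_prop) (by simp)) (hlim' _ (by fun_prop) (by simp))
    (hlim' _ (by fun_prop) (by simp)) (hlim' _ (by fun_prop) (by simp))
    (fun p => awSum_natDegree _ _ _ _ _) (hermitePoly_natDegree _ _ _).1
    (fun p => Q.askeyWilson_eigen 1 _ _ _ _ n) (Q.hermite_eigen 1 n) ?_ ?_ (Q.κ * y)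
  · rw [hermitePoly_eval _ hq hroot, inv_mul_cancel_left₀ Q.κ_ne] at key
    refine key.congr fun p => ?_
    rw [awSum_awCoeff_eval, inv_mul_cancel_left₀ Q.κ_ne]
  · have := (Q.diag_injective_iff one_ne_zero 0 0 0 0).mpr fun n => by simp [qPoch]
    rwa [mul_zero] at this
  · rw [(hermitePoly_natDegree _ _ _).2]
    have h := hlim (fun p => (2 * Q.κ⁻¹) ^ n
      * qPoch (p.1 * p.2.1 * p.2.2.1 * p.2.2.2 * q ^ ((n : ℤ) - 1)) q n)
      (continuous_const.mul ((continuous_qPoch q n).comp (by fun_prop)))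
    rw [show qPoch ((0 : ℂ × ℂ × ℂ × ℂ).1 * (0 : ℂ × ℂ × ℂ × ℂ).2.1 * (0 : ℂ × ℂ × ℂ × ℂ).2.2.1
      * (0 : ℂ × ℂ × ℂ × ℂ).2.2.2 * q ^ ((n : ℤ) - 1)) q n = 1 by simp [qPoch], mul_one] at h
    refine h.congr' ?_
    filter_upwards [ha0] with p hp
    exact (awSum_awCoeff_coeff hq hroot _ n hp _ _ _).symm

end

end Limits

/-! ### Limits with parameters tending to infinity. -/

section InfiniteLimits
open Polynomial Filter Topology Bornology

/-- Pairing j with n - 1 - j; this fixes the constant in the limit with four infinite parameters. -/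
theorem prod_pow_sub_one_div {q : ℂ} (hq : q ≠ 0) (n : ℕ) :
    ∏ j ∈ Finset.range n, (q ^ n * q⁻¹ / (q ^ j) ^ 2) = 1 := by
  have h1 : ∏ j ∈ Finset.range n, q ^ j ≠ 0 :=
    Finset.prod_ne_zero_iff.mpr fun j _ => pow_ne_zero j hq
  have h2 : ∏ _j ∈ Finset.range n, (q ^ n * q⁻¹)
      = (∏ j ∈ Finset.range n, q ^ j) * ∏ j ∈ Finset.range n, q ^ j := by
    nth_rw 2 [← Finset.prod_range_reflect]
    rw [← Finset.prod_mul_distrib]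
    refine Finset.prod_congr rfl fun j hj => ?_
    have hj := Finset.mem_range.mp hj
    rw [← pow_add, show n = j + (n - 1 - j) + 1 by omega, pow_succ, mul_inv_cancel_right₀ hq,
      show j + (n - 1 - j) + 1 - 1 - j = n - 1 - j by omega, add_comm j]
  rw [Finset.prod_div_distrib, Finset.prod_pow, h2, sq, div_self (mul_ne_zero h1 h1)]

theorem qPoch_mul_shift_div {a q : ℂ} {n k : ℕ} (hk : k ≤ n) (h : qPoch a q n ≠ 0) :
    qPoch (a * q ^ k) q (n - k) / qPoch a q n = (qPoch a q k)⁻¹ := by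
  rw [qPoch_split a q hk] at h ⊢
  rw [div_mul_cancel_right₀ (right_ne_zero_of_mul h)]

theorem tendsto_mul_cobounded {ι : Type*} {l : Filter ι} {f : ι → ℂ}
    (hf : Tendsto f l (cobounded ℂ)) {a : ℂ} (ha : a ≠ 0) :
    Tendsto (fun p => a * f p) l (cobounded ℂ) :=
  (tendsto_mul_left_cobounded ha).comp hf

section
variable {q : ℂ} (hq : q ≠ 0) (n : ℕ) {a : ℂ} (ha : a ≠ 0) (y : ℂ)

theorem pow_mul_askeyWilson_div (q : ℂ) (n : ℕ) {a : ℂ} (ha : a ≠ 0) (b c d y D : ℂ) :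
    a ^ n * askeyWilson q n a b c d y / D = ∑ k ∈ Finset.range (n + 1),
      qPoch (q ^ (-(n : ℤ))) q k * awBasis a q k y * (q ^ k / qPoch q q k)
        * (qPoch (a * b * c * d * q ^ ((n : ℤ) - 1)) q k * (qPoch (a * b * q ^ k) q (n - k)
          * qPoch (a * c * q ^ k) q (n - k) * qPoch (a * d * q ^ k) q (n - k) / D)) := by
  rw [askeyWilson, mul_inv_cancel_left₀ (pow_ne_zero n ha), Finset.sum_div]
  exact Finset.sum_congr rfl fun k _ => by ring

include hq ha

/-- In the k-th term d enters only through (abcd q^{n-1}; q)_k / (ad; q)_k. Each factor, divided by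
d above and below, tends to bc q^{n-1}. The next two limits work alike, with each further infinite
parameter contributing an extra q^{-j} to the factor of index j. -/
theorem tendsto_askeyWilsonLim₁ (b c : ℂ) :
    Tendsto (fun d : ℂ => a ^ n * askeyWilson q n a b c d y / qPoch (a * d) q n)
      (cobounded ℂ) (𝓝 (askeyWilsonLim₁ q n a b c y)) := by
  simp only [pow_mul_askeyWilson_div q n ha, askeyWilsonLim₁]
  refine tendsto_finsetSum _ fun k hk => ?_
  have hk : k ≤ n := Nat.lt_succ_iff.mp (Finset.mem_range.mp hk)
  have hd := tendsto_mul_cobounded (f := fun d => d) tendsto_id ha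
  have hi : Tendsto (fun d : ℂ => d⁻¹) (cobounded ℂ) (𝓝 0) := tendsto_inv₀_cobounded
  have key : Tendsto (fun d : ℂ => ∏ j ∈ Finset.range k,
      (d⁻¹ - a * b * c * (q ^ n * q⁻¹) * q ^ j) / (d⁻¹ - a * q ^ j)) (cobounded ℂ)
      (𝓝 (∏ j ∈ Finset.range k, (b * c * (q ^ n * q⁻¹)))) := by
    refine tendsto_finsetProd _ fun j _ => ?_
    have hj : q ^ j ≠ 0 := pow_ne_zero j hq
    have h := (hi.sub_const (a * b * c * (q ^ n * q⁻¹) * q ^ j)).div (hi.sub_const (a * q ^ j))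
      (by rw [zero_sub]; exact neg_ne_zero.mpr (mul_ne_zero ha hj))
    refine h.trans_eq (congrArg 𝓝 ?_)
    simp only [zero_sub]
    field_simp
  have key2 := key.const_mul (qPoch (q ^ (-(n : ℤ))) q k * awBasis a q k y * (q ^ k / qPoch q q k)
    * (qPoch (a * b * q ^ k) q (n - k) * qPoch (a * c * q ^ k) q (n - k)))
  rw [Finset.prod_const, Finset.card_range] at key2
  rw [show (b * c * q ^ n) ^ k = (b * c * (q ^ n * q⁻¹)) ^ k * q ^ k by
    rw [← mul_pow]; congr 1; field_simp]
  refine Tendsto.congr' ?_ (key2.trans_eq ?_)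
  · filter_upwards [eventually_qPoch_ne_zero hd hq n, eventually_ne_cobounded (0 : ℂ)] with d h1 h2
    have h3 : qPoch (a * b * c * d * (q ^ n * q⁻¹)) q k * (qPoch (a * d) q k)⁻¹
        = ∏ j ∈ Finset.range k,
          (d⁻¹ - a * b * c * (q ^ n * q⁻¹) * q ^ j) / (d⁻¹ - a * q ^ j) := by
      rw [qPoch, qPoch, ← div_eq_mul_inv, ← Finset.prod_div_distrib]
      refine Finset.prod_congr rfl fun j _ => ?_
      symm
      rw [← mul_div_mul_left _ _ h2]
      congr 1 <;> field_simp
    rw [← h3, q_zpow_sub_one hq, ← qPoch_mul_shift_div hk h1]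
    ring
  · ring_nf

theorem tendsto_askeyWilsonLim₂ (b : ℂ) :
    Tendsto (fun p : ℂ × ℂ => a ^ n * askeyWilson q n a b p.1 p.2 y
        / (qPoch (a * p.1) q n * qPoch (a * p.2) q n))
      (cobounded ℂ ×ˢ cobounded ℂ) (𝓝 (askeyWilsonLim₂ q n a b y)) := by
  simp only [pow_mul_askeyWilson_div q n ha, askeyWilsonLim₂]
  refine tendsto_finsetSum _ fun k hk => ?_
  have hk : k ≤ n := Nat.lt_succ_iff.mp (Finset.mem_range.mp hk)
  have tc : Tendsto (fun p : ℂ × ℂ => p.1) (cobounded ℂ ×ˢ cobounded ℂ) (cobounded ℂ) :=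
    tendsto_fst
  have td : Tendsto (fun p : ℂ × ℂ => p.2) (cobounded ℂ ×ˢ cobounded ℂ) (cobounded ℂ) :=
    tendsto_snd
  have hc := tendsto_inv₀_cobounded.comp tc
  have hd := tendsto_inv₀_cobounded.comp td
  have key : Tendsto (fun p : ℂ × ℂ => ∏ j ∈ Finset.range k,
      (p.1⁻¹ * p.2⁻¹ - a * b * (q ^ n * q⁻¹) * q ^ j)
        / ((p.1⁻¹ - a * q ^ j) * (p.2⁻¹ - a * q ^ j))) (cobounded ℂ ×ˢ cobounded ℂ)
      (𝓝 (∏ j ∈ Finset.range k, (-(b * (q ^ n * q⁻¹) / a)) / q ^ j)) := by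
    refine tendsto_finsetProd _ fun j _ => ?_
    have hj : q ^ j ≠ 0 := pow_ne_zero j hq
    have h0 : 0 - a * q ^ j ≠ 0 := by rw [zero_sub]; exact neg_ne_zero.mpr (mul_ne_zero ha hj)
    have h := ((hc.mul hd).sub_const (a * b * (q ^ n * q⁻¹) * q ^ j)).div
      ((hc.sub_const (a * q ^ j)).mul (hd.sub_const (a * q ^ j))) (mul_ne_zero h0 h0)
    refine h.trans_eq (congrArg 𝓝 ?_)
    simp only [zero_sub, mul_zero]
    field_simp
  have key2 := key.const_mul (qPoch (q ^ (-(n : ℤ))) q k * awBasis a q k y * (q ^ k / qPoch q q k)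
    * qPoch (a * b * q ^ k) q (n - k))
  rw [Finset.prod_div_distrib, prod_pow_range, Finset.prod_const, Finset.card_range] at key2
  rw [show (-(b * q ^ n / a)) ^ k = (-(b * (q ^ n * q⁻¹) / a)) ^ k * q ^ k by
    rw [← mul_pow]; congr 1; field_simp]
  refine Tendsto.congr' ?_ (key2.trans_eq ?_)
  · filter_upwards [eventually_qPoch_ne_zero (tendsto_mul_cobounded tc ha) hq n,
      eventually_qPoch_ne_zero (tendsto_mul_cobounded td ha) hq n,
      tc.eventually (eventually_ne_cobounded (0 : ℂ)),
      td.eventually (eventually_ne_cobounded (0 : ℂ))] with p h1 h2 h3 h4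
    have h5 : qPoch (a * b * p.1 * p.2 * (q ^ n * q⁻¹)) q k
        * ((qPoch (a * p.1) q k)⁻¹ * (qPoch (a * p.2) q k)⁻¹) = ∏ j ∈ Finset.range k,
          (p.1⁻¹ * p.2⁻¹ - a * b * (q ^ n * q⁻¹) * q ^ j)
            / ((p.1⁻¹ - a * q ^ j) * (p.2⁻¹ - a * q ^ j)) := by
      rw [← mul_inv, qPoch, qPoch, qPoch, ← div_eq_mul_inv, ← Finset.prod_mul_distrib,
        ← Finset.prod_div_distrib]
      refine Finset.prod_congr rfl fun j _ => ?_
      symm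
      rw [← mul_div_mul_left _ _ (mul_ne_zero h3 h4)]
      congr 1 <;> field_simp
    rw [← h5, q_zpow_sub_one hq, ← qPoch_mul_shift_div hk h1, ← qPoch_mul_shift_div hk h2]
    ring
  · ring_nf

theorem tendsto_askeyWilsonLim₃ :
    Tendsto (fun p : ℂ × ℂ × ℂ => a ^ n * askeyWilson q n a p.1 p.2.1 p.2.2 y
        / (qPoch (a * p.1) q n * qPoch (a * p.2.1) q n * qPoch (a * p.2.2) q n))
      (cobounded ℂ ×ˢ cobounded ℂ ×ˢ cobounded ℂ) (𝓝 (askeyWilsonLim₃ q n a y)) := by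
  simp only [pow_mul_askeyWilson_div q n ha, askeyWilsonLim₃]
  refine tendsto_finsetSum _ fun k hk => ?_
  have hk : k ≤ n := Nat.lt_succ_iff.mp (Finset.mem_range.mp hk)
  set F : Filter (ℂ × ℂ × ℂ) := cobounded ℂ ×ˢ cobounded ℂ ×ˢ cobounded ℂ
  have tb : Tendsto (fun p : ℂ × ℂ × ℂ => p.1) F (cobounded ℂ) := tendsto_fst
  have tc : Tendsto (fun p : ℂ × ℂ × ℂ => p.2.1) F (cobounded ℂ) := tendsto_fst.comp tendsto_snd
  have td : Tendsto (fun p : ℂ × ℂ × ℂ => p.2.2) F (cobounded ℂ) := tendsto_snd.comp tendsto_snd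
  have hb := tendsto_inv₀_cobounded.comp tb
  have hc := tendsto_inv₀_cobounded.comp tc
  have hd := tendsto_inv₀_cobounded.comp td
  have key : Tendsto (fun p : ℂ × ℂ × ℂ => ∏ j ∈ Finset.range k,
      (p.1⁻¹ * p.2.1⁻¹ * p.2.2⁻¹ - a * (q ^ n * q⁻¹) * q ^ j)
        / ((p.1⁻¹ - a * q ^ j) * (p.2.1⁻¹ - a * q ^ j) * (p.2.2⁻¹ - a * q ^ j))) F
      (𝓝 (∏ j ∈ Finset.range k, (q ^ n * q⁻¹ / a ^ 2) / (q ^ j) ^ 2)) := by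
    refine tendsto_finsetProd _ fun j _ => ?_
    have hj : q ^ j ≠ 0 := pow_ne_zero j hq
    have h0 : 0 - a * q ^ j ≠ 0 := by rw [zero_sub]; exact neg_ne_zero.mpr (mul_ne_zero ha hj)
    have h := (((hb.mul hc).mul hd).sub_const (a * (q ^ n * q⁻¹) * q ^ j)).div
      (((hb.sub_const (a * q ^ j)).mul (hc.sub_const (a * q ^ j))).mul (hd.sub_const (a * q ^ j)))
      (mul_ne_zero (mul_ne_zero h0 h0) h0)
    refine h.trans_eq (congrArg 𝓝 ?_)
    simp only [zero_sub, mul_zero]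
    field_simp
  have key2 := key.const_mul (qPoch (q ^ (-(n : ℤ))) q k * awBasis a q k y * (q ^ k / qPoch q q k))
  rw [Finset.prod_div_distrib, Finset.prod_pow, prod_pow_range, Finset.prod_const,
    Finset.card_range, ← pow_mul, mul_comm _ 2] at key2
  rw [show (q ^ n / a ^ 2) ^ k = (q ^ n * q⁻¹ / a ^ 2) ^ k * q ^ k by
    rw [← mul_pow]; congr 1; field_simp]
  refine Tendsto.congr' ?_ (key2.trans_eq ?_)
  · filter_upwards [eventually_qPoch_ne_zero (tendsto_mul_cobounded tb ha) hq n,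
      eventually_qPoch_ne_zero (tendsto_mul_cobounded tc ha) hq n,
      eventually_qPoch_ne_zero (tendsto_mul_cobounded td ha) hq n,
      tb.eventually (eventually_ne_cobounded (0 : ℂ)),
      tc.eventually (eventually_ne_cobounded (0 : ℂ)),
      td.eventually (eventually_ne_cobounded (0 : ℂ))] with p h1 h2 h3 h4 h5 h6
    have h7 : qPoch (a * p.1 * p.2.1 * p.2.2 * (q ^ n * q⁻¹)) q k
        * ((qPoch (a * p.1) q k)⁻¹ * (qPoch (a * p.2.1) q k)⁻¹ * (qPoch (a * p.2.2) q k)⁻¹)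
        = ∏ j ∈ Finset.range k, (p.1⁻¹ * p.2.1⁻¹ * p.2.2⁻¹ - a * (q ^ n * q⁻¹) * q ^ j)
        / ((p.1⁻¹ - a * q ^ j) * (p.2.1⁻¹ - a * q ^ j) * (p.2.2⁻¹ - a * q ^ j)) := by
      rw [← mul_inv, ← mul_inv, qPoch, qPoch, qPoch, qPoch, ← div_eq_mul_inv,
        ← Finset.prod_mul_distrib, ← Finset.prod_mul_distrib, ← Finset.prod_div_distrib]
      refine Finset.prod_congr rfl fun j _ => ?_
      symm
      rw [← mul_div_mul_left _ _ (mul_ne_zero (mul_ne_zero h4 h5) h6)]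
      congr 1 <;> field_simp
    rw [← h7, q_zpow_sub_one hq, ← qPoch_mul_shift_div hk h1, ← qPoch_mul_shift_div hk h2,
      ← qPoch_mul_shift_div hk h3]
    ring
  · ring_nf

end

/-- Now the expansion basis itself degenerates, so the operator argument is used again: f divided by
abcd has coefficients that are polynomials in the inverse parameters and tends to z⁴. -/
theorem tendsto_askeyWilson_infinity {q : ℂ} (hq : q ≠ 0)
    (hroot : ∀ k : ℕ, 0 < k → q ^ k ≠ 1) (n : ℕ) (y : ℂ) :
    Tendsto (fun p : ℂ × ℂ × ℂ × ℂ =>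
        p.1 ^ (2 * n) * askeyWilson q n p.1 p.2.1 p.2.2.1 p.2.2.2 y
          / (qPoch (p.1 * p.2.1) q n * qPoch (p.1 * p.2.2.1) q n * qPoch (p.1 * p.2.2.2) q n))
      (cobounded ℂ ×ˢ cobounded ℂ ×ˢ cobounded ℂ ×ˢ cobounded ℂ)
      (𝓝 (continuousQHermite q⁻¹ n y)) := by
  set F : Filter (ℂ × ℂ × ℂ × ℂ) := cobounded ℂ ×ˢ cobounded ℂ ×ˢ cobounded ℂ ×ˢ cobounded ℂ
  let Q : QLattice := ⟨q, 1, 1, hq, hroot, one_ne_zero, one_ne_zero⟩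
  have ta : Tendsto (fun p : ℂ × ℂ × ℂ × ℂ => p.1) F (cobounded ℂ) := tendsto_fst
  have tb : Tendsto (fun p : ℂ × ℂ × ℂ × ℂ => p.2.1) F (cobounded ℂ) :=
    tendsto_fst.comp tendsto_snd
  have tc : Tendsto (fun p : ℂ × ℂ × ℂ × ℂ => p.2.2.1) F (cobounded ℂ) :=
    tendsto_fst.comp (tendsto_snd.comp tendsto_snd)
  have td : Tendsto (fun p : ℂ × ℂ × ℂ × ℂ => p.2.2.2) F (cobounded ℂ) :=
    tendsto_snd.comp (tendsto_snd.comp tendsto_snd)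
  have hne : ∀ᶠ p : ℂ × ℂ × ℂ × ℂ in F, p.1 ≠ 0 ∧ p.2.1 ≠ 0 ∧ p.2.2.1 ≠ 0 ∧ p.2.2.2 ≠ 0 :=
    (ta.eventually (eventually_ne_cobounded 0)).and <|
      (tb.eventually (eventually_ne_cobounded 0)).and <|
        (tc.eventually (eventually_ne_cobounded 0)).and (td.eventually (eventually_ne_cobounded 0))
  let inv4 : ℂ × ℂ × ℂ × ℂ → ℂ × ℂ × ℂ × ℂ := fun p => (p.1⁻¹, p.2.1⁻¹, p.2.2.1⁻¹, p.2.2.2⁻¹)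
  have hF0 : Tendsto inv4 F (𝓝 0) :=
    (tendsto_inv₀_cobounded.comp ta).prodMk_nhds ((tendsto_inv₀_cobounded.comp tb).prodMk_nhds
      ((tendsto_inv₀_cobounded.comp tc).prodMk_nhds (tendsto_inv₀_cobounded.comp td)))
  have hlim : ∀ (g f : ℂ × ℂ × ℂ × ℂ → ℂ) (v : ℂ), Continuous f → f 0 = v →
      (∀ p : ℂ × ℂ × ℂ × ℂ, p.1 ≠ 0 ∧ p.2.1 ≠ 0 ∧ p.2.2.1 ≠ 0 ∧ p.2.2.2 ≠ 0 → f (inv4 p) = g p) →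
      Tendsto g F (𝓝 v) := fun g f v hf h0 h =>
    h0 ▸ ((hf.tendsto 0).comp hF0).congr' (hne.mono fun p hp => h p hp)
  have key := Q.tendsto_eval (l := F) (n := n)
    (R := fun p => C (p.1 ^ (2 * n)
      / (qPoch (p.1 * p.2.1) q n * qPoch (p.1 * p.2.2.1) q n * qPoch (p.1 * p.2.2.2) q n))
      * awSum Q.κ⁻¹ p.1 q (awCoeff q n p.1 p.2.1 p.2.2.1 p.2.2.2) n)
    (R₀ := hermitePoly Q.κ⁻¹ q⁻¹ n)
    (f₀ := fun p => p.1⁻¹ * p.2.1⁻¹ * p.2.2.1⁻¹ * p.2.2.2⁻¹)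
    (f₁ := fun p => -(p.1⁻¹ * p.2.1⁻¹ * p.2.2.1⁻¹ * p.2.2.2⁻¹
      * (p.1 + p.2.1 + p.2.2.1 + p.2.2.2)))
    (f₂ := fun p => p.1⁻¹ * p.2.1⁻¹ * p.2.2.1⁻¹ * p.2.2.2⁻¹
      * (p.1 * p.2.1 + p.1 * p.2.2.1 + p.1 * p.2.2.2 + p.2.1 * p.2.2.1 + p.2.1 * p.2.2.2
        + p.2.2.1 * p.2.2.2))
    (f₃ := fun p => -(p.1⁻¹ * p.2.1⁻¹ * p.2.2.1⁻¹ * p.2.2.2⁻¹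
      * (p.1 * p.2.1 * p.2.2.1 + p.1 * p.2.1 * p.2.2.2 + p.1 * p.2.2.1 * p.2.2.2
        + p.2.1 * p.2.2.1 * p.2.2.2)))
    (f₄ := fun p => p.1⁻¹ * p.2.1⁻¹ * p.2.2.1⁻¹ * p.2.2.2⁻¹
      * (p.1 * p.2.1 * p.2.2.1 * p.2.2.2))
    (hlim _ (fun p => p.1 * p.2.1 * p.2.2.1 * p.2.2.2) 0 (by fun_prop) (by simp) fun p _ => rfl)
    (hlim _ (fun p => -(p.2.1 * p.2.2.1 * p.2.2.2 + p.1 * p.2.2.1 * p.2.2.2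
      + p.1 * p.2.1 * p.2.2.2 + p.1 * p.2.1 * p.2.2.1)) 0 (by fun_prop) (by simp) ?_)
    (hlim _ (fun p => p.2.2.1 * p.2.2.2 + p.2.1 * p.2.2.2 + p.2.1 * p.2.2.1
      + p.1 * p.2.2.2 + p.1 * p.2.2.1 + p.1 * p.2.1) 0 (by fun_prop) (by simp) ?_)
    (hlim _ (fun p => -(p.2.2.2 + p.2.2.1 + p.2.1 + p.1)) 0 (by fun_prop) (by simp) ?_)
    (hlim _ (fun p => 1) 1 (by fun_prop) (by simp) ?_)
    (fun p => (natDegree_C_mul_le _ _).trans (awSum_natDegree _ _ _ _ _))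
    (hermitePoly_natDegree _ _ _).1
    (fun p => ?_) (Q.hermite_inv_eigen 1 n) (Q.diag_injective_of_zero one_ne_zero _ _ _)
    ?_ (Q.κ * y)
  · rw [hermitePoly_eval _ (inv_ne_zero hq) (QLattice.inv_root hroot),
      inv_mul_cancel_left₀ Q.κ_ne] at key
    refine key.congr fun p => ?_
    rw [eval_mul, eval_C, awSum_awCoeff_eval, inv_mul_cancel_left₀ Q.κ_ne, div_mul_eq_mul_div]
  pick_goal 5
  · rw [← smul_eq_C_mul, map_smul, Q.askeyWilson_eigen _ _ _ _ _ n, smul_eq_C_mul, smul_eq_C_mul]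
    ring
  pick_goal 5
  · rw [(hermitePoly_natDegree _ _ _).2]
    have h0 : Tendsto (fun p => ∏ j ∈ Finset.range n,
        (p.1 * p.2.1 * p.2.2.1 * p.2.2.2 - q ^ n * q⁻¹ * q ^ j) / ((p.1 * p.2.1 - q ^ j)
          * (p.1 * p.2.2.1 - q ^ j) * (p.1 * p.2.2.2 - q ^ j))) (𝓝 (0 : ℂ × ℂ × ℂ × ℂ)) (𝓝 1) := by
      rw [← prod_pow_sub_one_div hq n]
      refine tendsto_finsetProd _ fun j _ => ?_
      have hj := pow_ne_zero j hq
      have h1 : Tendsto (fun p : ℂ × ℂ × ℂ × ℂ =>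
          p.1 * p.2.1 * p.2.2.1 * p.2.2.2 - q ^ n * q⁻¹ * q ^ j) (𝓝 0)
          (𝓝 (-(q ^ n * q⁻¹ * q ^ j))) :=
        Continuous.tendsto' (by fun_prop) _ _ (by simp)
      have h2 : Tendsto (fun p : ℂ × ℂ × ℂ × ℂ => (p.1 * p.2.1 - q ^ j)
          * (p.1 * p.2.2.1 - q ^ j) * (p.1 * p.2.2.2 - q ^ j)) (𝓝 0)
          (𝓝 (-q ^ j * -q ^ j * -q ^ j)) :=
        Continuous.tendsto' (by fun_prop) _ _ (by simp)
      have h3 : -q ^ j ≠ 0 := neg_ne_zero.mpr hj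
      refine (h1.div h2 (mul_ne_zero (mul_ne_zero h3 h3) h3)).trans_eq (congrArg 𝓝 ?_)
      field_simp
    have h1 := (h0.comp hF0).const_mul ((2 * Q.κ⁻¹) ^ n)
    rw [mul_one] at h1
    refine h1.congr' ?_
    filter_upwards [hne] with p ⟨ha, hb, hc, hd⟩
    rw [coeff_C_mul, awSum_awCoeff_coeff hq hroot _ n ha, mul_left_comm]
    congr 1
    rw [mul_comm 2 n, pow_mul', div_mul_eq_mul_div, q_zpow_sub_one hq]
    simp only [qPoch, Function.comp, inv4]
    rw [← Finset.prod_mul_distrib, ← Finset.prod_mul_distrib]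
    rw [show (p.1 ^ 2) ^ n = ∏ _j ∈ Finset.range n, p.1 ^ 2 by simp, ← Finset.prod_mul_distrib,
      ← Finset.prod_div_distrib]
    refine Finset.prod_congr rfl fun j _ => ?_
    -- The multiplier a³bcd = (ab)(ac)(ad) clears the inverse parameters from numerator and
    -- denominator.
    rw [← mul_div_mul_left _ _
      (mul_ne_zero (mul_ne_zero (mul_ne_zero (pow_ne_zero 3 ha) hb) hc) hd)]
    congr 1 <;> field_simp
  all_goals
    rintro p ⟨ha, hb, hc, hd⟩
    try simp only [inv4]
    field_simp

end InfiniteLimits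

/-! ### Identification with terminating hypergeometric series. -/

section Hypergeometric
open Polynomial

theorem qPoch_inv_pow_eq_zero {q : ℂ} (hq : q ≠ 0) {n k : ℕ} (h : n < k) :
    qPoch (q ^ (-(n : ℤ))) q k = 0 := by
  refine Finset.prod_eq_zero (Finset.mem_range.mpr h) ?_
  rw [q_zpow_neg, inv_mul_cancel₀ (pow_ne_zero n hq), sub_self]

/-- The factor (q^{-n}; q)_k ends the series at k = n, and (abuq^k; q)_{n-k}/(abu; q)_n = 1/(abu;
q)_k restores the denominators. The square roots of u occur in pairs or cancel: with z = u^{1/2}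
q^s, (u^{1/2}a)z = auq^s and (u^{1/2}a)/z = aq^{-s}. -/
theorem basicHypergeometric_eq_askeyWilson {q : ℂ} (hq : q ≠ 0) {u : ℂ} (hu : u ≠ 0) (n : ℕ)
    {a : ℂ} (ha : a ≠ 0) (b c d s : ℂ) (hab : qPoch (a * b * u) q n ≠ 0)
    (hac : qPoch (a * c * u) q n ≠ 0) (had : qPoch (a * d * u) q n ≠ 0) :
    basicHypergeometric
        [q ^ (-(n : ℤ)), u ^ 2 * a * b * c * d * q ^ ((n : ℤ) - 1), a * q ^ (-s), a * u * q ^ s]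
        [a * b * u, a * c * u, a * d * u] q q
      = (csqrt u * a) ^ n
        * askeyWilson q n (csqrt u * a) (csqrt u * b) (csqrt u * c) (csqrt u * d)
            (awVariable q u s)
        / (qPoch (a * b * u) q n * qPoch (a * c * u) q n * qPoch (a * d * u) q n) := by
  have hr := csqrt_ne_zero hu
  have hr2 := csqrt_sq u
  have hs : q ^ s ≠ 0 := by rw [Ne, Complex.cpow_eq_zero_iff]; exact fun h => hq h.1
  set r := csqrt u with hrdef
  have e1 : ∀ b, r * a * (r * b) = a * b * u := fun b => by linear_combination a * b * hr2
  have e2 : a * b * u * (r * c) * (r * d) = u ^ 2 * a * b * c * d := by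
    linear_combination a * b * c * d * u * hr2
  have e3 : awVariable q u s = (r * q ^ s + (r * q ^ s)⁻¹) / 2 := by
    rw [awVariable, mul_inv, Complex.cpow_neg]
  have e4 : r * a * (r * q ^ s) = a * u * q ^ s := by linear_combination a * q ^ s * hr2
  have e5 : r * a * (r * q ^ s)⁻¹ = a * q ^ (-s) := by
    rw [Complex.cpow_neg]
    field_simp
  rw [pow_mul_askeyWilson_div q n (mul_ne_zero hr ha), basicHypergeometric,
    tsum_eq_sum (s := Finset.range (n + 1))]
  · refine Finset.sum_congr rfl fun k hk => ?_
    have hk : k ≤ n := Nat.lt_succ_iff.mp (Finset.mem_range.mp hk)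
    simp only [List.map_cons, List.map_nil, List.prod_cons, List.prod_nil, mul_one]
    rw [e3, awBasis_eq _ _ _ (mul_ne_zero hr hs), e4, e5, e1, e1, e1, e2,
      div_eq_mul_inv _ (_ * (_ * _)), mul_inv, mul_inv, ← qPoch_mul_shift_div hk hab,
      ← qPoch_mul_shift_div hk hac, ← qPoch_mul_shift_div hk had]
    ring
  · intro k hk
    rw [Finset.mem_range, not_lt] at hk
    simp only [List.map_cons, List.prod_cons]
    rw [qPoch_inv_pow_eq_zero hq hk, zero_mul, zero_div, zero_mul]

theorem risingFactorial_mul_shift_div {a : ℂ} {n k : ℕ} (hk : k ≤ n)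
    (h : risingFactorial a n ≠ 0) :
    risingFactorial (a + k) (n - k) / risingFactorial a n = (risingFactorial a k)⁻¹ := by
  have e : risingFactorial a n = risingFactorial a k * risingFactorial (a + k) (n - k) := by
    obtain ⟨m, rfl⟩ := Nat.exists_eq_add_of_le hk
    rw [Nat.add_sub_cancel_left, risingFactorial_eq_prod, Finset.prod_range_add,
      risingFactorial_eq_prod, risingFactorial_eq_prod]
    congr 1
    exact Finset.prod_congr rfl fun j _ => by push_cast; ring
  rw [e] at h ⊢
  rw [div_mul_cancel_right₀ (right_ne_zero_of_mul h)]

theorem risingFactorial_neg_eq_zero {n k : ℕ} (h : n < k) : risingFactorial (-(n : ℂ)) k = 0 := by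
  rw [risingFactorial_eq_prod]
  exact Finset.prod_eq_zero (Finset.mem_range.mpr h) (by ring)

section
variable {u : ℂ} (n : ℕ) {a b c : ℂ} (s : ℂ) (hab : risingFactorial (a + b + u) n ≠ 0)
  (hac : risingFactorial (a + c + u) n ≠ 0)
include hab hac

theorem hypergeometric_eq_wilsonPoly {d : ℂ} (had : risingFactorial (a + d + u) n ≠ 0) :
    hypergeometric [-(n : ℂ), a + b + c + d + 2 * u + n - 1, a - s, a + u + s]
        [a + b + u, a + c + u, a + d + u] 1
      = wilsonPoly n (a + u / 2) (b + u / 2) (c + u / 2) (d + u / 2) (-(s + u / 2) ^ 2)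
        / (risingFactorial (a + b + u) n * risingFactorial (a + c + u) n
          * risingFactorial (a + d + u) n) := by
  rw [wilsonPoly, Finset.sum_div, hypergeometric, tsum_eq_sum (s := Finset.range (n + 1))]
  · refine Finset.sum_congr rfl fun k hk => ?_
    have hk : k ≤ n := Nat.lt_succ_iff.mp (Finset.mem_range.mp hk)
    simp only [List.map_cons, List.map_nil, List.prod_cons, List.prod_nil, mul_one, one_pow]
    have e1 : ∀ b, a + u / 2 + (b + u / 2) = a + b + u := fun b => by ring
    rw [wilsonBasis_eq, e1, e1, e1, show a + u / 2 - (s + u / 2) = a - s by ring,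
      show a + u / 2 + (s + u / 2) = a + u + s by ring,
      show (n : ℂ) + (a + u / 2) + (b + u / 2) + (c + u / 2) + (d + u / 2) - 1
        = a + b + c + d + 2 * u + n - 1 by ring, div_eq_mul_inv _ (_ * (_ * _)), mul_inv, mul_inv,
      ← risingFactorial_mul_shift_div hk hab, ← risingFactorial_mul_shift_div hk hac,
      ← risingFactorial_mul_shift_div hk had]
    ring
  · intro k hk
    rw [Finset.mem_range, not_lt] at hk
    simp only [List.map_cons, List.prod_cons]
    rw [risingFactorial_neg_eq_zero hk, zero_mul, zero_div, zero_mul]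

theorem hypergeometric_eq_continuousDualHahn :
    hypergeometric [-(n : ℂ), a - s, a + u + s] [a + b + u, a + c + u] 1
      = continuousDualHahn n (a + u / 2) (b + u / 2) (c + u / 2) (-(s + u / 2) ^ 2)
        / (risingFactorial (a + b + u) n * risingFactorial (a + c + u) n) := by
  rw [continuousDualHahn, Finset.sum_div, hypergeometric,
    tsum_eq_sum (s := Finset.range (n + 1))]
  · refine Finset.sum_congr rfl fun k hk => ?_
    have hk : k ≤ n := Nat.lt_succ_iff.mp (Finset.mem_range.mp hk)
    simp only [List.map_cons, List.map_nil, List.prod_cons, List.prod_nil, mul_one, one_pow]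
    have e1 : ∀ b, a + u / 2 + (b + u / 2) = a + b + u := fun b => by ring
    rw [wilsonBasis_eq, e1, e1, show a + u / 2 - (s + u / 2) = a - s by ring,
      show a + u / 2 + (s + u / 2) = a + u + s by ring, div_eq_mul_inv _ (_ * _), mul_inv,
      ← risingFactorial_mul_shift_div hk hab, ← risingFactorial_mul_shift_div hk hac]
    ring
  · intro k hk
    rw [Finset.mem_range, not_lt] at hk
    simp only [List.map_cons, List.prod_cons]
    rw [risingFactorial_neg_eq_zero hk, zero_mul, zero_div, zero_mul]

end

end Hypergeometric

theorem theorem3p5 :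
    -- the `q`-quadratic lattice
    (∀ q c₁ c₂ : ℂ, q ≠ 0 → (∀ k : ℕ, 0 < k → q ^ k ≠ 1) → c₁ ≠ 0 → c₂ ≠ 0 →
      ((∀ P : ℕ → Polynomial ℂ, (∀ n, (P n).degree = (n : WithBot ℕ)) →
          (HasSturmLiouvilleEquation (qQuadraticLattice q c₁ c₂) P ↔
            IsAskeyWilsonFamily q (c₂ / c₁) (qQuadraticLattice q c₁ c₂) P) ∧
          (HasVinetZhedanovEquation (qQuadraticLattice q c₁ c₂) P ↔
            IsAskeyWilsonFamily q (c₂ / c₁) (qQuadraticLattice q c₁ c₂) P)) ∧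
        -- the basic hypergeometric representation
        (∀ u : ℂ, u = c₂ / c₁ → ∀ (n : ℕ) (a b c d s : ℂ), a ≠ 0 →
          qPoch (a * b * u) q n ≠ 0 → qPoch (a * c * u) q n ≠ 0 → qPoch (a * d * u) q n ≠ 0 →
          basicHypergeometric
              [q ^ (-(n : ℤ)), u ^ 2 * a * b * c * d * q ^ ((n : ℤ) - 1), a * q ^ (-s),
                a * u * q ^ s]
              [a * b * u, a * c * u, a * d * u] q q
            = (csqrt u * a) ^ n
              * askeyWilson q n (csqrt u * a) (csqrt u * b) (csqrt u * c) (csqrt u * d)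
                  (awVariable q u s)
              / (qPoch (a * b * u) q n * qPoch (a * c * u) q n * qPoch (a * d * u) q n)))) ∧
    -- the remaining members are the case of zero parameters and the limits as parameters tend to ∞
    (∀ q : ℂ, q ≠ 0 → (∀ k : ℕ, 0 < k → q ^ k ≠ 1) → ∀ (n : ℕ) (y : ℂ),
      Filter.Tendsto (fun p : ℂ × ℂ × ℂ × ℂ => askeyWilson q n p.1 p.2.1 p.2.2.1 p.2.2.2 y)
        (nhdsWithin 0 {0}ᶜ ×ˢ nhds 0 ×ˢ nhds 0 ×ˢ nhds 0) (nhds (continuousQHermite q n y)) ∧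
      (∀ a b c : ℂ, a ≠ 0 →
        Filter.Tendsto (fun d : ℂ => a ^ n * askeyWilson q n a b c d y / qPoch (a * d) q n)
          (Bornology.cobounded ℂ) (nhds (askeyWilsonLim₁ q n a b c y))) ∧
      (∀ a b : ℂ, a ≠ 0 →
        Filter.Tendsto
          (fun p : ℂ × ℂ => a ^ n * askeyWilson q n a b p.1 p.2 y
            / (qPoch (a * p.1) q n * qPoch (a * p.2) q n))
          (Bornology.cobounded ℂ ×ˢ Bornology.cobounded ℂ)
          (nhds (askeyWilsonLim₂ q n a b y))) ∧
      (∀ a : ℂ, a ≠ 0 →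
        Filter.Tendsto
          (fun p : ℂ × ℂ × ℂ => a ^ n * askeyWilson q n a p.1 p.2.1 p.2.2 y
            / (qPoch (a * p.1) q n * qPoch (a * p.2.1) q n * qPoch (a * p.2.2) q n))
          (Bornology.cobounded ℂ ×ˢ Bornology.cobounded ℂ ×ˢ Bornology.cobounded ℂ)
          (nhds (askeyWilsonLim₃ q n a y))) ∧
      Filter.Tendsto
        (fun p : ℂ × ℂ × ℂ × ℂ =>
          p.1 ^ (2 * n) * askeyWilson q n p.1 p.2.1 p.2.2.1 p.2.2.2 y
            / (qPoch (p.1 * p.2.1) q n * qPoch (p.1 * p.2.2.1) q n * qPoch (p.1 * p.2.2.2) q n))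
        (Bornology.cobounded ℂ ×ˢ Bornology.cobounded ℂ ×ˢ Bornology.cobounded ℂ
          ×ˢ Bornology.cobounded ℂ)
        (nhds (continuousQHermite q⁻¹ n y))) ∧
    -- the quadratic lattice
    (∀ c₄ c₅ : ℂ, c₄ ≠ 0 →
      ((∀ P : ℕ → Polynomial ℂ, (∀ n, (P n).degree = (n : WithBot ℕ)) →
          (HasSturmLiouvilleEquation (quadraticLattice c₄ c₅) P ↔
            IsWilsonFamily (c₅ / c₄) (quadraticLattice c₄ c₅) P) ∧
          (HasVinetZhedanovEquation (quadraticLattice c₄ c₅) P ↔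
            IsWilsonFamily (c₅ / c₄) (quadraticLattice c₄ c₅) P)) ∧
        -- the hypergeometric representations
        (∀ u : ℂ, u = c₅ / c₄ → ∀ (n : ℕ) (a b c s : ℂ),
          risingFactorial (a + b + u) n ≠ 0 → risingFactorial (a + c + u) n ≠ 0 →
          (∀ d : ℂ, risingFactorial (a + d + u) n ≠ 0 →
            hypergeometric [-(n : ℂ), a + b + c + d + 2 * u + n - 1, a - s, a + u + s]
                [a + b + u, a + c + u, a + d + u] 1
              = wilsonPoly n (a + u / 2) (b + u / 2) (c + u / 2) (d + u / 2) (-(s + u / 2) ^ 2)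
                / (risingFactorial (a + b + u) n * risingFactorial (a + c + u) n
                  * risingFactorial (a + d + u) n)) ∧
          hypergeometric [-(n : ℂ), a - s, a + u + s] [a + b + u, a + c + u] 1
            = continuousDualHahn n (a + u / 2) (b + u / 2) (c + u / 2) (-(s + u / 2) ^ 2)
              / (risingFactorial (a + b + u) n * risingFactorial (a + c + u) n)))) := by
  refine ⟨fun q c₁ c₂ hq hroot hc₁ hc₂ => ⟨fun P hP => ?_,
      fun u hu n a b c d s ha hab hac had => ?_⟩,
    fun q hq hroot n y => ⟨tendsto_askeyWilson_zero hq hroot n y,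
      fun a b c ha => tendsto_askeyWilsonLim₁ hq n ha y b c,
      fun a b ha => tendsto_askeyWilsonLim₂ hq n ha y b,
      fun a ha => tendsto_askeyWilsonLim₃ hq n ha y, tendsto_askeyWilson_infinity hq hroot n y⟩,
    fun c₄ c₅ hc₄ => ⟨fun P hP => ?_, fun u hu n a b c s hab hac =>
      ⟨fun d had => hypergeometric_eq_wilsonPoly n s hab hac had,
        hypergeometric_eq_continuousDualHahn n s hab hac⟩⟩⟩
  · let Q : QLattice := ⟨q, c₁, c₂, hq, hroot, hc₁, hc₂⟩
    have h := Q.hasSturmLiouville_iff_isAskeyWilsonFamily hP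
    exact ⟨h, (Q.isLattice.vinetZhedanov_iff hP).trans h⟩
  · exact basicHypergeometric_eq_askeyWilson hq (hu ▸ div_ne_zero hc₂ hc₁) n ha b c d s hab hac had
  · have h := hasSturmLiouville_iff_isWilsonFamily c₅ hc₄ hP
    exact ⟨h, ((quadraticData_isLattice c₅ hc₄).vinetZhedanov_iff hP).trans h⟩
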